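/- **Setting.** Let $k\ge 0$ be an integer, $p\in\{1,2\}$, and let $b,\sigma:\mathbb R\to\mathbb R$ be $1$-periodic and of class $\mathcal C^{\max(2k+2,\,2p)}$ (that is, $\mathcal C^{2k+2}$, except that $\mathcal C^{4}$ is required when $k=0$, $p=2$). Let $r\in\mathbb R$, put $\mathcal A w:=\frac{\sigma(x)^2}{2}w_{xx}+b(x)w_x-r\,w$, and consider on $\Omega=(0,1)$, with periodic boundary conditions, the equation $$v_t-\tfrac{\sigma(x)^2}{2}v_{xx}-b(x)v_x+r\,v=f(t,x),\qquad t\in(0,T), \tag{1}$$ where $f$ is $1$-periodic in $x$ and of class $\mathcal C^{k+2p}$ in $(t,x)$. For integers $N,M\ge1$ let $\Delta t=T/N$, $t_n=n\Delta t$, $\Delta x=1/M$, $I_j=(j\Delta x,(j+1)\Delta x)$ for $j\in\mathbb Z$, and let $V_k$ be the space of ($1$-periodically extended) functions in $L^2(\Omega)$ whose restriction to each $I_j$ is a polynomial of degree at most $k$. Let $(\cdot,\cdot)$ and $\|\cdot\|_{L^2}$ be the scalar product and norm of $L^2(\Omega)$. **Schemes.** With $h=\Delta t$ put $\gamma^q_h(x)=x+b(x)h+q\,\sigma(x)\sqrt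 h$. * SLDG-1 (weak Euler): $y^q_h=\gamma^q_h$, $q=\pm1$, $\alpha_{\pm1}=\frac12$. * SLDG-2 (Platen): $q\in\{-1,0,1\}$, $\alpha_{\pm1}=\frac16$, $\alpha_0=\frac23$, $$y^q_h=x+\tfrac12\big(b(\gamma_h^{\sqrt3q})+b\big)h+\tfrac14\Big[\big(\sigma(\gamma^1_h)+\sigma(\gamma^{-1}_h)+2\sigma\big)\sqrt3\,q+\big(\sigma(\gamma^1_h)-\sigma(\gamma^{-1}_h)\big)(3q^2-1)\Big]\sqrt h .$$ For each $q$, $(\cdot,\cdot)_{G^q}$ denotes the quadrature obtained by cutting every cell $I_i$, $0\le i<M$, at the points which $y^q_h$ maps to mesh points $j\Delta x$, $j\in\mathbb Z$, and applying the $(k+1)$-point Gauss rule on each of the resulting intervals. The implementable scheme SLDG-$p$ starts from some $u^0\in V_k$ and sets $$u^{n+1}=e^{-r\Delta t}\,\widetilde S^{(p)}_{\Delta t}u^n+w^n,\qquad \widetilde S^{(p)}_{\Delta t}u^n\in V_k,\quad (\widetilde S^{(p)}_{\Delta t}u^n,\varphi)=\sum_q\alpha_q\,(u^n(y^q_{\Delta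 t}),\varphi)_{G^q}\quad\forall\varphi\in V_k,$$ where $w^n\in V_k$ takes at the $k+1$ Gauss points of each cell the values of $\Delta t\,f(t_n,\cdot)$ if $p=1$, and of $\Delta t\,f(t_n,\cdot)+\frac{\Delta t^2}{2}(\mathcal A f+f_t)(t_n,\cdot)$ if $p=2$. (For $r=0$, $f=0$ the scheme is $u^{n+1}=\widetilde S^{(p)}_{\Delta t}u^n$.) **Theorem.** Let $k,p,b,\sigma,r$ be as above and let $\lambda>0$, $\theta<1$. There is a constant $L_1\ge0$, depending only on $k,p,b,\sigma,r,\lambda,\theta$, such that the following holds. Let $T>0$, let $f$ be as above, and let $v$ be a classical solution of (1), continuous on $[0,T]\times\mathbb R$ and $1$-periodic in $x$, such that $v(t,\cdot)$ is of class $\mathcal C^q$ for every $t\in[0,T]$ and $\frac{\partial^q v}{\partial x^q}$ is bounded on $[0,T]\times\mathbb R$, for $q=\max(2p+2,k+1)$. Then there is a constant $C\ge0$, independent of $N$, $M$ and $(u^n)$, such that, for all $N,M\ge1$ satisfying the weak CFL condition $$\Delta x^4\le\lambda\,\Delta t$$ and the condition that $\Delta t$ be small enough for the maps $y^q_{\Delta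 t}$ to be increasing bijections, namely $\|\Delta t\,b'\pm\sqrt{\Delta t}\,\sigma'\|_{L^\infty}\le\theta$ (both signs) if $p=1$ and $\Delta t\,\|b'\|_{L^\infty}+3\sqrt{\Delta t}\,\|\sigma'\|_{L^\infty}\le\theta$ if $p=2$, and for every sequence $(u^n)$ given by the scheme SLDG-$p$ from any $u^0\in V_k$, with $v^n:=v(t_n,\cdot)$, $$\|u^n-v^n\|_{L^2}\le e^{L_1T}\Big(\|u^0-v^0\|_{L^2}+C\,T\Big(\frac{\Delta x^{k+1}}{\Delta t}+\Delta t^p\Big)\Big)\qquad\forall\, n\le N.$$ -/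

import Mathlib

/-- Gauss quadrature on `(-1, 1)` with `k + 1` nodes `ξ` and weights `ω`: nodes in `(-1, 1)`,
positive weights, exact on polynomials of degree at most `2 k + 1`. -/
structure IsGaussRule (k : ℕ) (ξ ω : Fin (k + 1) → ℝ) : Prop where
  node_mem : ∀ α, ξ α ∈ Set.Ioo (-1 : ℝ) 1
  weight_pos : ∀ α, 0 < ω α
  exact : ∀ P : Polynomial ℝ, P.natDegree ≤ 2 * k + 1 →
    ∫ x in (-1 : ℝ)..1, P.eval x = ∑ α, ω α * P.eval (ξ α)

/-- Integration of polynomials over `(-1, 1)`, as a linear form. -/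
noncomputable def polyIntegral : Polynomial ℝ →ₗ[ℝ] ℝ where
  toFun P := ∫ x in (-1 : ℝ)..1, P.eval x
  map_add' P Q := by
    simp only [Polynomial.eval_add]
    exact intervalIntegral.integral_add (P.continuous.intervalIntegrable _ _)
      (Q.continuous.intervalIntegrable _ _)
  map_smul' c P := by
    simp [Polynomial.eval_smul, intervalIntegral.integral_const_mul]

theorem polyIntegral_pos (P : Polynomial ℝ) (hP : P ≠ 0)
    (h : ∀ x ∈ Set.Ioo (-1 : ℝ) 1, 0 ≤ P.eval x) : 0 < polyIntegral P := by
  have hcl : ∀ x ∈ Set.Icc (-1 : ℝ) 1, 0 ≤ P.eval x := by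
    intro x hx
    rw [← closure_Ioo (by norm_num : (-1 : ℝ) ≠ 1)] at hx
    have : IsClosed {x | 0 ≤ P.eval x} := isClosed_le continuous_const P.continuous
    exact this.closure_subset_iff.2 (fun y hy => h y hy) hx
  refine intervalIntegral.integral_pos (by norm_num) P.continuous.continuousOn
    (fun x hx => hcl x ⟨hx.1.le, hx.2⟩) ?_
  by_contra! hc
  apply hP
  refine Polynomial.eq_zero_of_infinite_isRoot P ((Set.Icc_infinite (by norm_num : (-1 : ℝ) < 1)).mono ?_)
  intro x hx
  exact le_antisymm (hc x hx) (hcl x hx)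

theorem exists_sign_change (n : ℕ) : ∀ Q : Polynomial ℝ, Q ≠ 0 → Q.natDegree = n →
    ∃ S : Finset ℝ, (∀ s ∈ S, s ∈ Set.Ioo (-1 : ℝ) 1 ∧ Q.eval s = 0) ∧
      ((∀ x ∈ Set.Ioo (-1 : ℝ) 1,
          0 ≤ (Q * ∏ s ∈ S, (Polynomial.X - Polynomial.C s)).eval x) ∨
        (∀ x ∈ Set.Ioo (-1 : ℝ) 1,
          0 ≤ (-(Q * ∏ s ∈ S, (Polynomial.X - Polynomial.C s))).eval x)) := by
  induction n with
  | zero =>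
    intro Q _ hdeg
    obtain ⟨c, rfl⟩ := Polynomial.natDegree_eq_zero.1 hdeg
    refine ⟨∅, by simp, ?_⟩
    rcases le_total 0 c with hc | hc
    · left; intro x _; simpa using hc
    · right; intro x _; simpa using hc
  | succ n ih =>
    intro Q hQ hdeg
    by_cases hr : ∃ r ∈ Set.Ioo (-1 : ℝ) 1, Q.eval r = 0
    · obtain ⟨r, hrm, hr⟩ := hr
      obtain ⟨Q', rfl⟩ := Polynomial.dvd_iff_isRoot.2 hr
      have hQ' : Q' ≠ 0 := right_ne_zero_of_mul hQ
      have hd' : Q'.natDegree = n := by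
        rw [Polynomial.natDegree_mul (Polynomial.X_sub_C_ne_zero r) hQ',
          Polynomial.natDegree_X_sub_C] at hdeg
        omega
      obtain ⟨S, hS, hsign⟩ := ih Q' hQ' hd'
      by_cases hrS : r ∈ S
      · refine ⟨S.erase r, fun s hs => ⟨(hS s (Finset.mem_of_mem_erase hs)).1, ?_⟩, ?_⟩
        · rw [Polynomial.eval_mul, (hS s (Finset.mem_of_mem_erase hs)).2, mul_zero]
        · have : (Polynomial.X - Polynomial.C r) * Q' *
              ∏ s ∈ S.erase r, (Polynomial.X - Polynomial.C s) =
              Q' * ∏ s ∈ S, (Polynomial.X - Polynomial.C s) := by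
            rw [← Finset.mul_prod_erase S _ hrS]; ring
          rw [this]; exact hsign
      · refine ⟨insert r S, ?_, ?_⟩
        · intro s hs
          rcases Finset.mem_insert.1 hs with rfl | hs
          · exact ⟨hrm, by simp⟩
          · exact ⟨(hS s hs).1, by rw [Polynomial.eval_mul, (hS s hs).2, mul_zero]⟩
        · have : (Polynomial.X - Polynomial.C r) * Q' *
              ∏ s ∈ insert r S, (Polynomial.X - Polynomial.C s) =
              (Polynomial.X - Polynomial.C r) ^ 2 *
                (Q' * ∏ s ∈ S, (Polynomial.X - Polynomial.C s)) := by
            rw [Finset.prod_insert hrS]; ring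
          rw [this]
          rcases hsign with h | h
          · left; intro x hx
            rw [Polynomial.eval_mul, Polynomial.eval_pow]
            exact mul_nonneg (sq_nonneg _) (h x hx)
          · right; intro x hx
            rw [← mul_neg, Polynomial.eval_mul, Polynomial.eval_pow]
            exact mul_nonneg (sq_nonneg _) (h x hx)
    · push Not at hr
      refine ⟨∅, by simp, ?_⟩
      by_contra! hc
      obtain ⟨⟨x, hx, hx'⟩, y, hy, hy'⟩ := hc
      simp only [Finset.prod_empty, mul_one, Polynomial.eval_neg, neg_neg_iff_pos] at hx' hy'
      obtain ⟨z, hz, hz'⟩ := isPreconnected_Ioo.intermediate_value hx hy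
        Q.continuous.continuousOn ⟨hx'.le, hy'.le⟩
      exact hr z hz hz'

theorem exists_orthogonal (n : ℕ) : ∃ P : Polynomial ℝ, P.Monic ∧ P.natDegree = n ∧
    ∀ Q : Polynomial ℝ, Q.degree < n → polyIntegral (P * Q) = 0 := by
  let V := Polynomial.degreeLT ℝ n
  let B : Polynomial ℝ →ₗ[ℝ] Polynomial ℝ →ₗ[ℝ] ℝ :=
    (LinearMap.mul ℝ (Polynomial ℝ)).compr₂ polyIntegral
  let T : V →ₗ[ℝ] Module.Dual ℝ V := B.domRestrict₁₂ V V
  have hB : ∀ p q, B p q = polyIntegral (p * q) := fun p q => rfl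
  have hT : ∀ p q : V, T p q = polyIntegral (p.1 * q.1) := fun p q => rfl
  have hfin : FiniteDimensional ℝ V := Module.Finite.equiv (Polynomial.degreeLTEquiv ℝ n).symm
  have hinj : Function.Injective T := by
    rw [← LinearMap.ker_eq_bot, LinearMap.ker_eq_bot']
    intro p hp
    by_contra hne
    have h1 : (p.1 * p.1) ≠ 0 := by
      have : p.1 ≠ 0 := fun h => hne (Subtype.ext h)
      exact mul_ne_zero this this
    have h2 := polyIntegral_pos _ h1 (fun x _ => by
      rw [Polynomial.eval_mul]; exact mul_self_nonneg _)
    rw [← hT, hp] at h2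
    simp at h2
  have hsurj : Function.Surjective T :=
    (LinearMap.injective_iff_surjective_of_finrank_eq_finrank
      (Subspace.dual_finrank_eq).symm).1 hinj
  obtain ⟨Q, hQ⟩ := hsurj ((B (Polynomial.X ^ n)).domRestrict V)
  have hQd : Q.1.degree < n := Polynomial.mem_degreeLT.1 Q.2
  refine ⟨Polynomial.X ^ n - Q.1, Polynomial.monic_X_pow_sub ?_, ?_, ?_⟩
  · exact hQd
  · apply Polynomial.natDegree_eq_of_degree_eq_some
    rw [Polynomial.degree_sub_eq_left_of_degree_lt] <;> simp [hQd]
  · intro R hR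
    have := LinearMap.congr_fun hQ ⟨R, Polynomial.mem_degreeLT.2 hR⟩
    rw [hT] at this
    change polyIntegral (Q.1 * R) = polyIntegral (Polynomial.X ^ n * R) at this
    rw [sub_mul, map_sub, this, sub_self]

/-- Existence of the Gauss rule with `k + 1` nodes. -/
theorem exists_isGaussRule (k : ℕ) :
    ∃ rule : (Fin (k + 1) → ℝ) × (Fin (k + 1) → ℝ), IsGaussRule k rule.1 rule.2 := by
  obtain ⟨P, hPm, hPd, hPo⟩ := exists_orthogonal (k + 1)
  obtain ⟨S, hS, hsign⟩ := exists_sign_change _ P hPm.ne_zero rfl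
  have hprod : (∏ s ∈ S, (Polynomial.X - Polynomial.C s)) ≠ (0 : Polynomial ℝ) :=
    (Polynomial.monic_prod_of_monic _ _ fun s _ => Polynomial.monic_X_sub_C s).ne_zero
  have hcard : S.card = k + 1 := by
    apply le_antisymm
    · calc S.card ≤ P.roots.toFinset.card := Finset.card_le_card fun s hs => by
            simp [hPm.ne_zero, (hS s hs).2]
        _ ≤ P.roots.card := Multiset.toFinset_card_le _
        _ ≤ P.natDegree := P.card_roots'
        _ = k + 1 := hPd
    · by_contra! hlt
      have h0 := hPo (∏ s ∈ S, (Polynomial.X - Polynomial.C s)) (by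
        rw [Polynomial.degree_prod]
        simpa using (by exact_mod_cast hlt : ((S.card : ℕ) : WithBot ℕ) < ((k + 1 : ℕ) : WithBot ℕ)))
      rcases hsign with h | h
      · exact (polyIntegral_pos _ (mul_ne_zero hPm.ne_zero hprod) h).ne' h0
      · have := polyIntegral_pos _ (neg_ne_zero.2 (mul_ne_zero hPm.ne_zero hprod)) h
        rw [map_neg, h0] at this
        simp at this
  let ξ : Fin (k + 1) → ℝ := S.orderEmbOfFin hcard
  have hξ : ∀ α, ξ α ∈ S := fun α => Finset.orderEmbOfFin_mem S hcard α
  have hinj : Function.Injective ξ := (S.orderEmbOfFin hcard).injective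
  let ω : Fin (k + 1) → ℝ := fun α => polyIntegral (Lagrange.basis Finset.univ ξ α)
  have hlow : ∀ Q : Polynomial ℝ, Q.degree < (k + 1 : ℕ) →
      polyIntegral Q = ∑ α, ω α * Q.eval (ξ α) := by
    intro Q hQ
    conv_lhs => rw [Lagrange.eq_interpolate (s := Finset.univ) (v := ξ) hinj.injOn (f := Q) (by simpa using hQ)]
    rw [Lagrange.interpolate_apply, map_sum]
    refine Finset.sum_congr rfl fun α _ => ?_
    rw [← Polynomial.smul_eq_C_mul, map_smul, smul_eq_mul, mul_comm]
  have hex : ∀ Q : Polynomial ℝ, Q.natDegree ≤ 2 * k + 1 →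
      polyIntegral Q = ∑ α, ω α * Q.eval (ξ α) := by
    intro Q hQ
    have hdm := Polynomial.modByMonic_add_div Q P
    have hdiv : (Q /ₘ P).degree < (k + 1 : ℕ) := by
      refine lt_of_le_of_lt Polynomial.degree_le_natDegree ?_
      rw [Polynomial.natDegree_divByMonic Q hPm, hPd]
      exact_mod_cast (by omega)
    have hmod : (Q %ₘ P).degree < (k + 1 : ℕ) := by
      have := Polynomial.degree_modByMonic_lt Q hPm
      rwa [Polynomial.degree_eq_natDegree hPm.ne_zero, hPd] at this
    rw [← hdm, map_add, hPo _ hdiv, add_zero, hlow _ hmod]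
    refine Finset.sum_congr rfl fun α _ => ?_
    rw [Polynomial.eval_add, Polynomial.eval_mul, (hS _ (hξ α)).2, zero_mul, add_zero]
  refine ⟨(ξ, ω), fun α => (hS _ (hξ α)).1, fun α => ?_, fun Q hQ => hex Q hQ⟩
  have hb : Lagrange.basis Finset.univ ξ α ≠ 0 :=
    Lagrange.basis_ne_zero hinj.injOn (Finset.mem_univ α)
  have h1 := polyIntegral_pos _ (mul_ne_zero hb hb) (fun x _ => by
    rw [Polynomial.eval_mul]; exact mul_self_nonneg _)
  have hbd : (Lagrange.basis Finset.univ ξ α).natDegree = k := by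
    rw [Lagrange.natDegree_basis hinj.injOn (Finset.mem_univ α)]; simp
  rw [hex _ (by rw [Polynomial.natDegree_mul hb hb, hbd]; omega), Finset.sum_eq_single α] at h1
  · rw [Polynomial.eval_mul, Lagrange.eval_basis_self hinj.injOn (Finset.mem_univ α)] at h1
    simpa using h1
  · intro β _ hβ
    rw [Polynomial.eval_mul, Lagrange.eval_basis_of_ne (Ne.symm hβ) (Finset.mem_univ β)]
    simp
  · simp

/-- The Gauss nodes `x_α` in `(-1, 1)`, `0 ≤ α ≤ k`. -/
noncomputable def gaussNode (k : ℕ) : Fin (k + 1) → ℝ := (exists_isGaussRule k).choose.1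

/-- The Gauss weights `w_α`, `0 ≤ α ≤ k`. -/
noncomputable def gaussWeight (k : ℕ) : Fin (k + 1) → ℝ := (exists_isGaussRule k).choose.2

theorem isGaussRule_gauss (k : ℕ) : IsGaussRule k (gaussNode k) (gaussWeight k) :=
  (exists_isGaussRule k).choose_spec

/-- The `(k + 1)`-point Gauss quadrature rule on the interval `(a, c)`, applied to `g`. -/
noncomputable def gaussOn (k : ℕ) (a c : ℝ) (g : ℝ → ℝ) : ℝ :=
  ∑ α, gaussWeight k α / 2 * (c - a) * g ((a + c) / 2 + gaussNode k α * ((c - a) / 2))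

/-- The mesh cell `(j / M, (j + 1) / M)`, of length `Δx = 1 / M`. The cells with `0 ≤ j < M` mesh
`Ω = (0, 1)`; the other ones are their translates under the `1`-periodic extension. -/
def meshCell (M : ℕ) (j : ℤ) : Set ℝ := Set.Ioo ((j : ℝ) / M) (((j : ℝ) + 1) / M)

/-- The discontinuous Galerkin space `V_k`: `1`-periodic functions which coincide on each open mesh
cell with a polynomial of degree at most `k`. The values at the finitely many mesh points of a
period are irrelevant (the elements represent classes in `L²`); no definition below uses them. -/
def dgSpace (k M : ℕ) : Set (ℝ → ℝ) :=
  {u | Function.Periodic u 1 ∧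
    ∀ j : ℤ, ∃ P : Polynomial ℝ, P.natDegree ≤ k ∧ ∀ x ∈ meshCell M j, u x = P.eval x}

/-- The `L²` norm on `Ω = (0, 1)`. -/
noncomputable def normL2 (w : ℝ → ℝ) : ℝ := Real.sqrt (∫ x in (0 : ℝ)..1, w x ^ 2)

/-- Composite Gauss quadrature on `Ω = (0, 1)` adapted to the increasing map `y`: every mesh cell
`I_i` is cut at the points that `y` sends to mesh points, and the Gauss rule is applied on each of
the resulting open intervals `I_i ∩ y⁻¹(I_j)`, `j ∈ ℤ` (only finitely many of them are nonempty;
the empty ones contribute `0`, since `sInf ∅ = sSup ∅ = 0`). -/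
noncomputable def cutQuad (k M : ℕ) (y g : ℝ → ℝ) : ℝ :=
  ∑ i ∈ Finset.range M, ∑ᶠ j : ℤ,
    gaussOn k (sInf (meshCell M i ∩ y ⁻¹' meshCell M j))
      (sSup (meshCell M i ∩ y ⁻¹' meshCell M j)) g

/-- Composite Gauss quadrature on the mesh cells of `Ω = (0, 1)`. -/
noncomputable def meshQuad (k M : ℕ) (g : ℝ → ℝ) : ℝ :=
  ∑ i ∈ Finset.range M, gaussOn k ((i : ℝ) / M) (((i : ℝ) + 1) / M) g

/-- The Euler characteristics `γ^q_h(x) = x + b(x) h + q σ(x) √h`. -/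
noncomputable def eulerFoot (b σ : ℝ → ℝ) (h q x : ℝ) : ℝ :=
  x + b x * h + q * σ x * Real.sqrt h

/-- The characteristics `y^q_h(x)` of Platen's scheme. -/
noncomputable def platenFoot (b σ : ℝ → ℝ) (h q x : ℝ) : ℝ :=
  x + 1 / 2 * (b (eulerFoot b σ h (Real.sqrt 3 * q) x) + b x) * h
    + 1 / 4 * ((σ (eulerFoot b σ h 1 x) + σ (eulerFoot b σ h (-1) x) + 2 * σ x)
          * Real.sqrt 3 * q
        + (σ (eulerFoot b σ h 1 x) - σ (eulerFoot b σ h (-1) x)) * (3 * q ^ 2 - 1))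
      * Real.sqrt h

/-- `∑_q α_q (u(y^q_h), φ)_{G^q}`, the weak form of the implementable scheme: `p = 1` is the weak
Euler scheme, with weights `1/2, 1/2` and `q = ±1`; `p = 2` is Platen's scheme, with weights
`1/6, 2/3, 1/6` and `q = -1, 0, 1`. -/
noncomputable def sldgForm (p k M : ℕ) (b σ : ℝ → ℝ) (h : ℝ) (u φ : ℝ → ℝ) : ℝ :=
  if p = 1 then
    1 / 2 * cutQuad k M (eulerFoot b σ h (-1)) (fun x => u (eulerFoot b σ h (-1) x) * φ x)
      + 1 / 2 * cutQuad k M (eulerFoot b σ h 1) (fun x => u (eulerFoot b σ h 1 x) * φ x)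
  else
    1 / 6 * cutQuad k M (platenFoot b σ h (-1)) (fun x => u (platenFoot b σ h (-1) x) * φ x)
      + 2 / 3 * cutQuad k M (platenFoot b σ h 0) (fun x => u (platenFoot b σ h 0 x) * φ x)
      + 1 / 6 * cutQuad k M (platenFoot b σ h 1) (fun x => u (platenFoot b σ h 1 x) * φ x)

/-- The operator `A w = (σ² / 2) w'' + b w' - r w`. -/
noncomputable def generator (b σ : ℝ → ℝ) (r : ℝ) (w : ℝ → ℝ) (x : ℝ) : ℝ :=
  σ x ^ 2 / 2 * iteratedDeriv 2 w x + b x * deriv w x - r * w x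

/-- The source correction: the Taylor polynomial of degree `p` in `h`, that is `h f(t, x)` for
`p = 1` and `h f(t, x) + (h² / 2) (A f + f_t)(t, x)` for `p = 2`. -/
noncomputable def sourceTerm (p : ℕ) (b σ : ℝ → ℝ) (r : ℝ) (f : ℝ → ℝ → ℝ) (h t x : ℝ) : ℝ :=
  if p = 1 then h * f t x
  else h * f t x + h ^ 2 / 2 * (generator b σ r (f t) x + deriv (fun s => f s x) t)

/-- One step of the implementable scheme SLDG-`p`, from `u` at time `t` to `u'` at time `t + h`:
`u'` is the element of `V_k` equal to `e^{-r h}` times the element defined by the quadrature form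
`sldgForm`, plus the element of `V_k` which takes the values of the source correction at the Gauss
points of the mesh cells (as Gauss quadrature is exact on `V_k · V_k`, the scalar product of the
latter with `φ ∈ V_k` is `meshQuad`). For `r = 0` and `f = 0` this is
`(u', φ) = ∑_q α_q (u(y^q_h), φ)_{G^q}` for all `φ ∈ V_k`. -/
def IsSLDGStep (p k M : ℕ) (b σ : ℝ → ℝ) (r : ℝ) (f : ℝ → ℝ → ℝ) (h t : ℝ)
    (u u' : ℝ → ℝ) : Prop :=
  u' ∈ dgSpace k M ∧ ∀ φ ∈ dgSpace k M,
    ∫ x in (0 : ℝ)..1, u' x * φ x =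
      Real.exp (-r * h) * sldgForm p k M b σ h u φ
        + meshQuad k M (fun x => sourceTerm p b σ r f h t x * φ x)

/-- `v` is a classical `1`-periodic solution on `[0, T]` of
`v_t - (σ(x)² / 2) v_xx - b(x) v_x + r v = f(t, x)`. -/
structure IsPeriodicSolution (b σ : ℝ → ℝ) (r : ℝ) (f : ℝ → ℝ → ℝ) (T : ℝ)
    (v : ℝ → ℝ → ℝ) : Prop where
  periodic : ∀ t ∈ Set.Icc (0 : ℝ) T, Function.Periodic (v t) 1
  continuousOn : ContinuousOn (Function.uncurry v) (Set.Icc (0 : ℝ) T ×ˢ Set.univ)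
  contDiff : ∀ t ∈ Set.Ioo (0 : ℝ) T, ContDiff ℝ 2 (v t)
  pde : ∀ t ∈ Set.Ioo (0 : ℝ) T, ∀ x,
    HasDerivAt (fun s => v s x) (generator b σ r (v t) x + f t x) t

/-- Existence and boundedness on `[0, T] × ℝ` of the derivative `∂^m v / ∂x^m`. -/
def HasBoundedXDeriv (m : ℕ) (T : ℝ) (v : ℝ → ℝ → ℝ) : Prop :=
  (∀ t ∈ Set.Icc (0 : ℝ) T, ContDiff ℝ m (v t)) ∧
    ∃ B : ℝ, ∀ t ∈ Set.Icc (0 : ℝ) T, ∀ x, |iteratedDeriv m (v t) x| ≤ B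

/-- The smallness condition on the time step under which the characteristics `x ↦ y^q_h(x)` of the
scheme SLDG-`p` are increasing bijections of `ℝ`, in the quantitative form `≤ θ` (with `θ < 1`):
`‖h b' ± √h σ'‖_∞ ≤ θ` if `p = 1`, and `h ‖b'‖_∞ + 3 √h ‖σ'‖_∞ ≤ θ` if `p = 2`. -/
def StepCondition (p : ℕ) (b σ : ℝ → ℝ) (θ h : ℝ) : Prop :=
  if p = 1 then
    ∀ x, |h * deriv b x + Real.sqrt h * deriv σ x| ≤ θ ∧
      |h * deriv b x - Real.sqrt h * deriv σ x| ≤ θ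
  else ∀ x z, h * |deriv b x| + 3 * Real.sqrt h * |deriv σ z| ≤ θ

/-! Write h for the time step and ε for its square root; each foot has the form y = x + ε Z(ε, x)
with Z periodic in x. The numerical solution is compared with the cellwise Taylor polynomials π v of
the exact solution. The distance e_n between u^n and π v^n obeys e_{n+1} ≤ exp((|r| + L) h) e_n + B
(Δx^{k+1} + h^{p+1}), and the discrete Gronwall lemma `le_pow_mul_of_le_mul_add` sums this over the
N = T / h steps. No power of h is gained on the spatial term, hence the quotient Δx^{k+1} / Δt in
the result.

The factor of e_n is a stability estimate (`exists_stability`): the weighted quadratures of (u ∘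
y^q)² are at most (1 + L h) ‖u‖². For exact integrals this is a change of variables
(`integral_comp_le`): y' = 1 + ε c s(y) + O(ε²) with s = σ', so the integral of u² ∘ y is that of u²
minus ε c ∫ u² s, up to O(ε²) ‖u‖². The terms of order ε disappear in the average because the
weighted sum of the c_q is zero. The quadratures bring a further error (`exists_quadrature_error`).
On a cut interval u ∘ y is a polynomial in y, and the square is within O(y'', y''') Δx², relative to
the cell norm, of a polynomial of degree 2k + 1, on which the Gauss rule is exact. As y'' and y'''
are O(ε), the error is O(ε Δx²), and the weak CFL condition says precisely that Δx² = O(ε). So it is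
O(h) as well, and L does not depend on T.

The additive term is consistency. In space, quadrature and integral agree on piecewise polynomials,
so smooth functions cost O(Δx^{k+1}). In time, the law of the feet has the right moments: the
average of g ∘ y^q is g + h A g + O(h²) for the Euler feet, and has the further term h² A² g / 2
with error O(h³) for Platen's (`platen_moments`, `isOrder_platen_expansion`), A being taken here
without its zero order term, which the exponential factor restores. This is matched with the
expansion of v in time (`IsRegularSolution.exists_first_order`,
`IsRegularSolution.exists_second_order`). No mixed derivative of v is assumed to exist, so that
expansion is drawn from the equation through difference quotients.
`IsSLDGStep.normL2_sub_cellTaylor_le` combines both halves by testing the scheme with its own error.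
-/

open MeasureTheory Set

/-! ### Circle maps and the intervals they cut out of the mesh -/

/-- Increasing continuous lifts of degree one circle maps. -/
structure IsDegreeOneLift (y : ℝ → ℝ) : Prop where
  strictMono : StrictMono y
  continuous : Continuous y
  map_add_one : ∀ x, y (x + 1) = y x + 1

theorem isDegreeOneLift_id : IsDegreeOneLift id := ⟨strictMono_id, continuous_id, fun _ => rfl⟩

/-- The part of the cell `I_i` which is mapped by `y` into the cell `I_j`. -/
def cutSet (M : ℕ) (y : ℝ → ℝ) (i j : ℤ) : Set ℝ := meshCell M i ∩ y ⁻¹' meshCell M j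

theorem isOpen_meshCell (M : ℕ) (j : ℤ) : IsOpen (meshCell M j) := isOpen_Ioo

theorem measurableSet_cutSet {y : ℝ → ℝ} (hy : IsDegreeOneLift y) (M : ℕ) (i j : ℤ) :
    MeasurableSet (cutSet M y i j) :=
  ((isOpen_meshCell M i).inter ((isOpen_meshCell M j).preimage hy.continuous)).measurableSet

theorem floor_eq_of_mem_meshCell {M : ℕ} (hM : 0 < M) {j : ℤ} {x : ℝ} (hx : x ∈ meshCell M j) :
    ⌊(M : ℝ) * x⌋ = j := by
  have hM' : (0 : ℝ) < M := by exact_mod_cast hM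
  rw [Int.floor_eq_iff]
  obtain ⟨h1, h2⟩ := hx
  rw [div_lt_iff₀ hM'] at h1
  rw [lt_div_iff₀ hM'] at h2
  constructor <;> linarith

theorem mem_meshCell_floor {M : ℕ} (hM : 0 < M) {x : ℝ} (hx : ∀ n : ℤ, x ≠ (n : ℝ) / M) :
    x ∈ meshCell M ⌊(M : ℝ) * x⌋ := by
  have hM' : (0 : ℝ) < M := by exact_mod_cast hM
  refine ⟨lt_of_le_of_ne ?_ (hx _).symm, ?_⟩
  · rw [div_le_iff₀ hM', mul_comm]; exact Int.floor_le _
  · rw [lt_div_iff₀ hM', mul_comm]; exact Int.lt_floor_add_one _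

theorem meshCell_subset_Ioo {M : ℕ} {i : ℕ} (hi : i < M) : meshCell M i ⊆ Ioo (0 : ℝ) 1 := by
  have hM' : (0 : ℝ) < M := by exact_mod_cast (Nat.zero_le i).trans_lt hi
  intro x hx
  obtain ⟨h1, h2⟩ := hx
  refine ⟨lt_of_le_of_lt (by positivity) h1, lt_of_lt_of_le h2 ?_⟩
  rw [div_le_one hM']
  exact_mod_cast hi

/-- The preimage of an interval under an increasing continuous map is open and order connected, so
each piece is an interval. The infimum and supremum in the quadrature are therefore its genuine end
points; the empty piece gives the degenerate interval at 0. -/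
theorem cutSet_eq_Ioo {M : ℕ} {y : ℝ → ℝ} (hy : IsDegreeOneLift y) (i j : ℤ) :
    cutSet M y i j = Ioo (sInf (cutSet M y i j)) (sSup (cutSet M y i j)) ∧
      sInf (cutSet M y i j) ≤ sSup (cutSet M y i j) := by
  rcases (cutSet M y i j).eq_empty_or_nonempty with h | h
  · rw [h]; simp
  have hb : BddBelow (cutSet M y i j) := bddBelow_Ioo.mono inter_subset_left
  have ha : BddAbove (cutSet M y i j) := bddAbove_Ioo.mono inter_subset_left
  have hle : sInf (cutSet M y i j) ≤ sSup (cutSet M y i j) :=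
    (csInf_le hb h.some_mem).trans (le_csSup ha h.some_mem)
  have hoc : (cutSet M y i j).OrdConnected :=
    ordConnected_Ioo.inter (ordConnected_Ioo.preimage_mono hy.strictMono.monotone)
  have hop : IsOpen (cutSet M y i j) :=
    (isOpen_meshCell M i).inter ((isOpen_meshCell M j).preimage hy.continuous)
  refine ⟨Subset.antisymm ?_ ?_, hle⟩
  · intro x hx
    obtain ⟨ε, hε, hball⟩ := Metric.isOpen_iff.1 hop x hx
    rw [Real.ball_eq_Ioo] at hball
    have h1 := csInf_le hb (hball (show x - ε / 2 ∈ _ by constructor <;> linarith))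
    have h2 := le_csSup ha (hball (show x + ε / 2 ∈ _ by constructor <;> linarith))
    constructor <;> linarith
  · intro x hx
    obtain ⟨a, ha', hax⟩ := exists_lt_of_csInf_lt h hx.1
    obtain ⟨c, hc, hxc⟩ := exists_lt_of_lt_csSup h hx.2
    exact hoc.out ha' hc ⟨hax.le, hxc.le⟩

/-- A finite range of cells containing the image of `(0, 1)` under `y`. -/
noncomputable def cutRange (M : ℕ) (y : ℝ → ℝ) : Finset ℤ :=
  Finset.Icc (⌊(M : ℝ) * y 0⌋ - 1) ⌈(M : ℝ) * y 1⌉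

theorem mem_cutRange {M : ℕ} {y : ℝ → ℝ} (hy : IsDegreeOneLift y) {i : ℕ} {j : ℤ}
    (hi : i < M) {x : ℝ} (hx : x ∈ cutSet M y i j) : j ∈ cutRange M y := by
  have hM' : (0 : ℝ) < M := by exact_mod_cast (Nat.zero_le i).trans_lt hi
  have h01 := meshCell_subset_Ioo hi hx.1
  obtain ⟨h1, h2⟩ := hx.2
  rw [div_lt_iff₀ hM'] at h1
  rw [lt_div_iff₀ hM'] at h2
  have h3 := hy.strictMono h01.1
  have h4 := hy.strictMono h01.2
  have h5 := Int.floor_le ((M : ℝ) * y 0)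
  have h6 := Int.le_ceil ((M : ℝ) * y 1)
  rw [cutRange, Finset.mem_Icc]
  constructor
  · have : ((⌊(M : ℝ) * y 0⌋ : ℤ) : ℝ) < (j + 1 : ℤ) := by push_cast; nlinarith
    have := Int.cast_lt.1 this
    omega
  · have : (j : ℝ) < (⌈(M : ℝ) * y 1⌉ : ℤ) := by nlinarith
    exact (Int.cast_lt.1 this).le

theorem cutQuad_eq_sum {k M : ℕ} {y : ℝ → ℝ} (hy : IsDegreeOneLift y) (g : ℝ → ℝ) :
    cutQuad k M y g = ∑ i ∈ Finset.range M, ∑ j ∈ cutRange M y,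
      gaussOn k (sInf (cutSet M y i j)) (sSup (cutSet M y i j)) g := by
  refine Finset.sum_congr rfl fun i hi => finsum_eq_sum_of_support_subset _ fun j hj => ?_
  by_contra hc
  apply hj
  have : cutSet M y i j = ∅ := by
    by_contra hne
    obtain ⟨x, hx⟩ := nonempty_iff_ne_empty.2 hne
    exact hc (mem_cutRange hy (Finset.mem_range.1 hi) hx)
  change gaussOn k (sInf (cutSet M y i j)) (sSup (cutSet M y i j)) g = 0
  rw [this]
  simp [gaussOn]

/-! ### The Gauss rule on an interval -/

section Gauss

theorem gaussNode_mem_Ioo {k : ℕ} (α : Fin (k + 1)) {a c : ℝ} (hac : a < c) :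
    (a + c) / 2 + gaussNode k α * ((c - a) / 2) ∈ Ioo a c := by
  obtain ⟨h1, h2⟩ := (isGaussRule_gauss k).node_mem α
  constructor <;> nlinarith

theorem gaussOn_mono {k : ℕ} {a c : ℝ} (hac : a ≤ c) {g g' : ℝ → ℝ}
    (h : ∀ x ∈ Ioo a c, g x ≤ g' x) : gaussOn k a c g ≤ gaussOn k a c g' := by
  rcases hac.eq_or_lt with rfl | hlt
  · simp [gaussOn]
  refine Finset.sum_le_sum fun α _ => mul_le_mul_of_nonneg_left (h _ (gaussNode_mem_Ioo α hlt)) ?_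
  have := (isGaussRule_gauss k).weight_pos α
  have : 0 < c - a := by linarith
  positivity

theorem gaussOn_add (k : ℕ) (a c : ℝ) (g g' : ℝ → ℝ) :
    gaussOn k a c (fun x => g x + g' x) = gaussOn k a c g + gaussOn k a c g' := by
  simp only [gaussOn, mul_add, Finset.sum_add_distrib]

theorem gaussOn_const_mul (k : ℕ) (a c t : ℝ) (g : ℝ → ℝ) :
    gaussOn k a c (fun x => t * g x) = t * gaussOn k a c g := by
  simp only [gaussOn, Finset.mul_sum]
  exact Finset.sum_congr rfl fun α _ => by ring

theorem gaussOn_polynomial {k : ℕ} (a c : ℝ) {P : Polynomial ℝ} (hP : P.natDegree ≤ 2 * k + 1) :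
    gaussOn k a c (fun x => P.eval x) = ∫ x in a..c, P.eval x := by
  let Q : Polynomial ℝ := P.comp (Polynomial.C ((a + c) / 2) + Polynomial.C ((c - a) / 2) * Polynomial.X)
  have hQe : ∀ s, Q.eval s = P.eval ((a + c) / 2 + (c - a) / 2 * s) := fun s => by
    simp [Q, Polynomial.eval_comp]
  have hQ : Q.natDegree ≤ 2 * k + 1 := by
    refine Polynomial.natDegree_comp_le.trans ?_
    have : (Polynomial.C ((a + c) / 2) + Polynomial.C ((c - a) / 2) * Polynomial.X :
        Polynomial ℝ).natDegree ≤ 1 := by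
      rw [add_comm]; exact Polynomial.natDegree_linear_le
    calc _ ≤ P.natDegree * 1 := Nat.mul_le_mul_left _ this
      _ ≤ _ := by simpa using hP
  have h := intervalIntegral.mul_integral_comp_add_mul (a := -1) (b := 1)
    (f := fun x => P.eval x) ((c - a) / 2) ((a + c) / 2)
  have e1 : (a + c) / 2 + (c - a) / 2 * (-1) = a := by ring
  have e2 : (a + c) / 2 + (c - a) / 2 * 1 = c := by ring
  rw [e1, e2] at h
  rw [← h]
  have h2 := (isGaussRule_gauss k).exact Q hQ
  simp only [hQe] at h2
  rw [h2, Finset.mul_sum]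
  refine Finset.sum_congr rfl fun α _ => ?_
  rw [mul_comm (gaussNode k α)]
  ring

/-- The weights are positive and sum to the length, so replacing `F` by `P` moves the rule and the
integral by at most d (c − a) each, and the two coincide on `P`. -/
theorem gaussOn_error_le {k : ℕ} {a c d : ℝ} (hac : a ≤ c) {F : ℝ → ℝ} {P : Polynomial ℝ}
    (hP : P.natDegree ≤ 2 * k + 1) (hF : IntervalIntegrable F volume a c)
    (h : ∀ x ∈ Ioo a c, |F x - P.eval x| ≤ d) :
    |gaussOn k a c F - ∫ x in a..c, F x| ≤ 2 * (d * (c - a)) := by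
  have hconst : gaussOn k a c (fun _ => d) = d * (c - a) := by
    have := gaussOn_polynomial (k := k) a c (P := Polynomial.C d) (by simp)
    simp only [Polynomial.eval_C, intervalIntegral.integral_const, smul_eq_mul] at this
    rw [this, mul_comm]
  have h1 : |gaussOn k a c F - gaussOn k a c (fun x => P.eval x)| ≤ d * (c - a) := by
    have hu : gaussOn k a c F ≤ gaussOn k a c (fun x => P.eval x + d) :=
      gaussOn_mono hac fun x hx => by linarith [(abs_le.1 (h x hx)).2]
    have hl : gaussOn k a c (fun x => P.eval x) ≤ gaussOn k a c (fun x => F x + d) :=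
      gaussOn_mono hac fun x hx => by linarith [(abs_le.1 (h x hx)).1]
    rw [gaussOn_add, hconst] at hu hl
    rw [abs_le]; constructor <;> linarith
  have h2 : |∫ x in a..c, (P.eval x - F x)| ≤ d * (c - a) := by
    have := intervalIntegral.norm_integral_le_of_norm_le_const_ae (a := a) (b := c) (C := d)
      (f := fun x => P.eval x - F x) (by
        have hne : ∀ᵐ x : ℝ, x ≠ c := by
          simpa using (countable_singleton c).ae_notMem (volume : Measure ℝ)
        filter_upwards [hne] with x hx hx2
        rw [uIoc_of_le hac] at hx2
        rw [Real.norm_eq_abs, abs_sub_comm]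
        exact h x ⟨hx2.1, lt_of_le_of_ne hx2.2 hx⟩)
    rwa [Real.norm_eq_abs, abs_of_nonneg (by linarith : 0 ≤ c - a)] at this
  rw [intervalIntegral.integral_sub (P.continuous.intervalIntegrable _ _) hF,
    ← gaussOn_polynomial a c hP] at h2
  calc _ = |(gaussOn k a c F - gaussOn k a c (fun x => P.eval x)) +
        (gaussOn k a c (fun x => P.eval x) - ∫ x in a..c, F x)| := by ring_nf
    _ ≤ _ := (abs_add_le _ _).trans (by linarith)

/-- With a repeated node, the square of the nodal polynomial would have degree at most 2k and vanish
at all nodes, while its integral is positive. Distinct nodes are needed for Lagrange interpolation.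
-/
theorem gaussNode_injective (k : ℕ) : Function.Injective (gaussNode k) := by
  classical
  by_contra hni
  let S := Finset.univ.image (gaussNode k)
  have hS : S.card ≤ k := by
    have h1 : S.card ≤ k + 1 := by simpa using Finset.card_image_le (s := Finset.univ) (f := gaussNode k)
    have h2 : S.card ≠ k + 1 := fun h => hni (by
      have := Finset.card_image_iff.1 (h.trans (by simp : k + 1 = (Finset.univ : Finset (Fin (k + 1))).card))
      simpa using this)
    omega
  let P : Polynomial ℝ := ∏ s ∈ S, (Polynomial.X - Polynomial.C s)
  have hP : P.Monic := Polynomial.monic_prod_of_monic _ _ fun s _ => Polynomial.monic_X_sub_C s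
  have hPd : P.natDegree = S.card := by
    simp only [P]
    rw [Polynomial.natDegree_prod_of_monic _ _ fun s _ => Polynomial.monic_X_sub_C s]
    simp
  have h1 := polyIntegral_pos (P * P) (mul_ne_zero hP.ne_zero hP.ne_zero) (fun x _ => by
    rw [Polynomial.eval_mul]; exact mul_self_nonneg _)
  have h2 := (isGaussRule_gauss k).exact (P * P) (by
    rw [Polynomial.natDegree_mul hP.ne_zero hP.ne_zero, hPd]; omega)
  have h3 : ∀ α, P.eval (gaussNode k α) = 0 := fun α => by
    simp only [P, Polynomial.eval_prod]
    exact Finset.prod_eq_zero (Finset.mem_image_of_mem _ (Finset.mem_univ α)) (by simp)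
  change 0 < ∫ x in (-1 : ℝ)..1, (P * P).eval x at h1
  rw [h2] at h1
  simp [h3] at h1

end Gauss

/-! ### The cut intervals partition the period up to a null set -/

section Partition

theorem countable_meshPoints {M : ℕ} {y : ℝ → ℝ} (hy : IsDegreeOneLift y) :
    {x : ℝ | ∃ n : ℤ, y x = (n : ℝ) / M}.Countable := by
  have : {x : ℝ | ∃ n : ℤ, y x = (n : ℝ) / M} = y ⁻¹' (range fun n : ℤ => (n : ℝ) / M) := by
    ext x; simp [eq_comm]
  rw [this]
  exact (countable_range _).preimage_of_injOn hy.strictMono.injective.injOn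

theorem ae_mem_cutSet {M : ℕ} (hM : 0 < M) {y : ℝ → ℝ} (hy : IsDegreeOneLift y) :
    ∀ᵐ x : ℝ, x ∈ cutSet M y ⌊(M : ℝ) * x⌋ ⌊(M : ℝ) * y x⌋ := by
  filter_upwards [(countable_meshPoints (M := M) hy).ae_notMem volume,
    (countable_meshPoints (M := M) isDegreeOneLift_id).ae_notMem volume] with x h1 h2
  exact ⟨mem_meshCell_floor hM fun n hn => h2 ⟨n, hn⟩,
    mem_meshCell_floor hM fun n hn => h1 ⟨n, hn⟩⟩

theorem Ioc_ae_eq_iUnion_cutSet {M : ℕ} (hM : 0 < M) {y : ℝ → ℝ} (hy : IsDegreeOneLift y) :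
    (Ioc (0 : ℝ) 1 : Set ℝ) =ᵐ[volume]
      (⋃ p ∈ Finset.range M ×ˢ cutRange M y, cutSet M y (p.1 : ℤ) p.2 : Set ℝ) := by
  have hM' : (0 : ℝ) < M := by exact_mod_cast hM
  rw [Filter.eventuallyEq_set]
  have hne : ∀ᵐ x : ℝ, x ≠ 1 := by
    simpa using (countable_singleton (1 : ℝ)).ae_notMem (volume : Measure ℝ)
  filter_upwards [ae_mem_cutSet hM hy, hne] with x hx hx1
  simp only [mem_iUnion, Finset.mem_product, Finset.mem_range, exists_prop, Prod.exists]
  constructor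
  · intro h
    have h0 : 0 ≤ ⌊(M : ℝ) * x⌋ := Int.floor_nonneg.2 (mul_nonneg hM'.le h.1.le)
    obtain ⟨i, hi⟩ := Int.eq_ofNat_of_zero_le h0
    have hlt : x < 1 := lt_of_le_of_ne h.2 hx1
    have hiM : i < M := by
      have : ⌊(M : ℝ) * x⌋ < (M : ℤ) := by
        rw [Int.floor_lt]; push_cast; nlinarith
      omega
    rw [hi] at hx
    exact ⟨i, _, ⟨hiM, mem_cutRange hy hiM hx⟩, hx⟩
  · rintro ⟨i, j, ⟨hi, -⟩, h⟩
    exact Ioo_subset_Ioc_self (meshCell_subset_Ioo hi h.1)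

theorem pairwise_disjoint_cutSet {M : ℕ} (hM : 0 < M) (y : ℝ → ℝ) (s : Set (ℕ × ℤ)) :
    s.Pairwise (Function.onFun Disjoint fun p : ℕ × ℤ => cutSet M y (p.1 : ℤ) p.2) := by
  intro p _ q _ hpq
  rw [Function.onFun, Set.disjoint_left]
  intro x hp hq
  apply hpq
  have h1 := (floor_eq_of_mem_meshCell hM hp.1).symm.trans (floor_eq_of_mem_meshCell hM hq.1)
  have h2 := (floor_eq_of_mem_meshCell hM hp.2).symm.trans (floor_eq_of_mem_meshCell hM hq.2)
  exact Prod.ext (by exact_mod_cast h1) h2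

theorem intervalIntegrable_of_cut {M : ℕ} (hM : 0 < M) {y : ℝ → ℝ} (hy : IsDegreeOneLift y)
    {F : ℝ → ℝ} (h : ∀ i j : ℤ, ∃ G : ℝ → ℝ, Continuous G ∧ ∀ x ∈ cutSet M y i j, F x = G x) :
    IntervalIntegrable F volume 0 1 := by
  rw [intervalIntegrable_iff_integrableOn_Ioc_of_le zero_le_one]
  refine IntegrableOn.congr_set_ae ?_ (Ioc_ae_eq_iUnion_cutSet hM hy)
  rw [integrableOn_finset_iUnion]
  rintro ⟨i, j⟩ hp
  obtain ⟨G, hG, hFG⟩ := h i j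
  have hi : i < M := Finset.mem_range.1 (Finset.mem_product.1 hp).1
  refine IntegrableOn.congr_fun ?_ (fun x hx => (hFG x hx).symm) (measurableSet_cutSet hy M i j)
  exact (hG.integrableOn_Icc (a := 0) (b := 1)).mono_set fun x hx =>
    Ioo_subset_Icc_self (meshCell_subset_Ioo hi hx.1)

theorem integral_eq_sum_cutSet {M : ℕ} (hM : 0 < M) {y : ℝ → ℝ} (hy : IsDegreeOneLift y)
    {F : ℝ → ℝ} (hF : IntervalIntegrable F volume 0 1) :
    ∫ x in (0 : ℝ)..1, F x = ∑ i ∈ Finset.range M, ∑ j ∈ cutRange M y,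
      ∫ x in sInf (cutSet M y i j)..sSup (cutSet M y i j), F x := by
  rw [intervalIntegrable_iff_integrableOn_Ioc_of_le zero_le_one] at hF
  have hae := Ioc_ae_eq_iUnion_cutSet hM hy
  rw [intervalIntegral.integral_of_le zero_le_one, setIntegral_congr_set hae,
    integral_biUnion_finset _ (fun p _ => measurableSet_cutSet hy M p.1 p.2)
      (pairwise_disjoint_cutSet hM y _)
      (integrableOn_finset_iUnion.1 (hF.congr_set_ae hae.symm)), Finset.sum_product]
  refine Finset.sum_congr rfl fun i _ => Finset.sum_congr rfl fun j _ => ?_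
  obtain ⟨h1, h2⟩ := cutSet_eq_Ioo hy (M := M) i j
  rw [intervalIntegral.integral_of_le h2, integral_Ioc_eq_integral_Ioo, ← h1]

theorem intervalIntegrable_cutSet {M : ℕ} {y : ℝ → ℝ} (hy : IsDegreeOneLift y)
    {F : ℝ → ℝ} (hF : IntervalIntegrable F volume 0 1) {i : ℕ} (hi : i < M) (j : ℤ) :
    IntervalIntegrable F volume (sInf (cutSet M y i j)) (sSup (cutSet M y i j)) := by
  obtain ⟨h1, h2⟩ := cutSet_eq_Ioo hy (M := M) i j
  rw [intervalIntegrable_iff_integrableOn_Ioo_of_le h2, ← h1]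
  rw [intervalIntegrable_iff_integrableOn_Ioo_of_le zero_le_one] at hF
  exact hF.mono_set fun x hx => meshCell_subset_Ioo hi hx.1

end Partition

/-! ### Positivity, Cauchy–Schwarz and exactness of the cut quadrature -/

section CutQuad

variable {k M : ℕ} {y : ℝ → ℝ}

theorem cutQuad_mono (hy : IsDegreeOneLift y) {g g' : ℝ → ℝ}
    (h : ∀ i j : ℤ, ∀ x ∈ cutSet M y i j, g x ≤ g' x) : cutQuad k M y g ≤ cutQuad k M y g' := by
  rw [cutQuad_eq_sum hy, cutQuad_eq_sum hy]
  refine Finset.sum_le_sum fun i _ => Finset.sum_le_sum fun j _ => ?_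
  obtain ⟨h1, h2⟩ := cutSet_eq_Ioo hy (M := M) i j
  exact gaussOn_mono h2 (h1 ▸ h i j)

theorem cutQuad_add (hy : IsDegreeOneLift y) (g g' : ℝ → ℝ) :
    cutQuad k M y (fun x => g x + g' x) = cutQuad k M y g + cutQuad k M y g' := by
  simp only [cutQuad_eq_sum hy, gaussOn_add, Finset.sum_add_distrib]

theorem cutQuad_const_mul (hy : IsDegreeOneLift y) (t : ℝ) (g : ℝ → ℝ) :
    cutQuad k M y (fun x => t * g x) = t * cutQuad k M y g := by
  simp only [cutQuad_eq_sum hy, gaussOn_const_mul, Finset.mul_sum]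

theorem cutQuad_sub (hy : IsDegreeOneLift y) (g g' : ℝ → ℝ) :
    cutQuad k M y (fun x => g x - g' x) = cutQuad k M y g - cutQuad k M y g' := by
  have h1 := cutQuad_add (k := k) (M := M) hy g (fun x => (-1) * g' x)
  rw [cutQuad_const_mul hy] at h1
  simpa [sub_eq_add_neg] using h1

theorem cutQuad_nonneg (hy : IsDegreeOneLift y) {g : ℝ → ℝ}
    (h : ∀ i j : ℤ, ∀ x ∈ cutSet M y i j, 0 ≤ g x) : 0 ≤ cutQuad k M y g := by
  have h1 := cutQuad_mono (k := k) hy h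
  have h2 := cutQuad_const_mul (k := k) (M := M) hy 0 (fun _ => 0)
  simp only [mul_zero, zero_mul] at h2
  rwa [h2] at h1

/-- Positive weights make the quadrature a positive semidefinite form; this is its discriminant
inequality, valid for arbitrary functions. -/
theorem cutQuad_mul_sq_le (hy : IsDegreeOneLift y) (g φ : ℝ → ℝ) :
    cutQuad k M y (fun x => g x * φ x) ^ 2 ≤
      cutQuad k M y (fun x => g x ^ 2) * cutQuad k M y (fun x => φ x ^ 2) := by
  have h := discrim_le_zero (a := cutQuad k M y (fun x => φ x ^ 2))
    (b := 2 * cutQuad k M y (fun x => g x * φ x)) (c := cutQuad k M y (fun x => g x ^ 2)) (by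
    intro t
    have h0 := cutQuad_nonneg (k := k) (M := M) hy (g := fun x => t * t * φ x ^ 2 + 2 * t * (g x * φ x) + g x ^ 2)
      (fun i j x _ => by nlinarith [sq_nonneg (t * φ x + g x)])
    rw [cutQuad_add hy, cutQuad_add hy, cutQuad_const_mul hy, cutQuad_const_mul hy] at h0
    linarith)
  rw [discrim] at h
  nlinarith

theorem abs_cutQuad_mul_le (hy : IsDegreeOneLift y) (g φ : ℝ → ℝ) :
    |cutQuad k M y (fun x => g x * φ x)| ≤
      Real.sqrt (cutQuad k M y (fun x => g x ^ 2)) *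
        Real.sqrt (cutQuad k M y (fun x => φ x ^ 2)) := by
  rw [← Real.sqrt_mul (cutQuad_nonneg hy fun i j x _ => sq_nonneg _)]
  exact Real.abs_le_sqrt (cutQuad_mul_sq_le hy g φ)

/-- The error of the cut quadrature is controlled by the distance to piecewise polynomials. -/
theorem abs_cutQuad_sub_integral_le (hM : 0 < M) (hy : IsDegreeOneLift y) {F δ : ℝ → ℝ}
    (hF : IntervalIntegrable F volume 0 1) (hδ : IntervalIntegrable δ volume 0 1)
    (h : ∀ i j : ℤ, (cutSet M y i j).Nonempty → ∃ P : Polynomial ℝ, P.natDegree ≤ 2 * k + 1 ∧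
      ∃ d : ℝ, ∀ x ∈ cutSet M y i j, |F x - P.eval x| ≤ d ∧ δ x = d) :
    |cutQuad k M y F - ∫ x in (0 : ℝ)..1, F x| ≤ 2 * ∫ x in (0 : ℝ)..1, δ x := by
  rw [cutQuad_eq_sum hy, integral_eq_sum_cutSet hM hy hF, integral_eq_sum_cutSet hM hy hδ,
    ← Finset.sum_sub_distrib, Finset.mul_sum]
  refine (Finset.abs_sum_le_sum_abs _ _).trans (Finset.sum_le_sum fun i hi => ?_)
  rw [← Finset.sum_sub_distrib, Finset.mul_sum]
  refine (Finset.abs_sum_le_sum_abs _ _).trans (Finset.sum_le_sum fun j _ => ?_)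
  rcases (cutSet M y i j).eq_empty_or_nonempty with he | hne
  · rw [he]; simp [gaussOn]
  obtain ⟨h1, h2⟩ := cutSet_eq_Ioo hy (M := M) i j
  obtain ⟨P, hP, d, hd⟩ := h i j hne
  rw [h1] at hd
  have hint : ∫ x in sInf (cutSet M y i j)..sSup (cutSet M y i j), δ x =
      d * (sSup (cutSet M y i j) - sInf (cutSet M y i j)) := by
    rw [intervalIntegral.integral_of_le h2, integral_Ioc_eq_integral_Ioo,
      setIntegral_congr_fun measurableSet_Ioo (fun x hx => (hd x hx).2)]
    simp [h2, mul_comm]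
  rw [hint]
  exact gaussOn_error_le h2 hP (intervalIntegrable_cutSet hy hF (Finset.mem_range.1 hi) j)
    fun x hx => (hd x hx).1

theorem cutQuad_eq_integral (hM : 0 < M) (hy : IsDegreeOneLift y) {F : ℝ → ℝ}
    (h : ∀ i j : ℤ, ∃ P : Polynomial ℝ, P.natDegree ≤ 2 * k + 1 ∧
      ∀ x ∈ cutSet M y i j, F x = P.eval x) :
    cutQuad k M y F = ∫ x in (0 : ℝ)..1, F x := by
  have hF : IntervalIntegrable F volume 0 1 := intervalIntegrable_of_cut hM hy fun i j => by
    obtain ⟨P, -, hP⟩ := h i j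
    exact ⟨fun x => P.eval x, P.continuous, hP⟩
  have h1 := abs_cutQuad_sub_integral_le (k := k) hM hy (δ := fun _ => 0) hF (by simp) (fun i j _ => by
    obtain ⟨P, hd, hP⟩ := h i j
    exact ⟨P, hd, 0, fun x hx => by simp [hP x hx]⟩)
  simp only [intervalIntegral.integral_zero, mul_zero] at h1
  linarith [abs_nonpos_iff.1 h1]

end CutQuad

/-- The identity creates no new cut, so the estimates for cut quadratures also cover the source
term. -/
theorem meshQuad_eq_cutQuad_id {k M : ℕ} (hM : 0 < M) (g : ℝ → ℝ) :
    meshQuad k M g = cutQuad k M id g := by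
  have hM' : (0 : ℝ) < M := by exact_mod_cast hM
  refine Finset.sum_congr rfl fun i hi => ?_
  rw [finsum_eq_single _ (i : ℤ)]
  · have hlt : ((i : ℝ) / M) < ((i : ℝ) + 1) / M := by gcongr; linarith
    simp only [preimage_id, inter_self, meshCell, Int.cast_natCast]
    rw [csInf_Ioo hlt, csSup_Ioo hlt]
  · intro j hj
    have : meshCell M i ∩ id ⁻¹' meshCell M j = ∅ := by
      rw [preimage_id, ← disjoint_iff_inter_eq_empty, Set.disjoint_left]
      intro x h1 h2
      exact hj ((floor_eq_of_mem_meshCell hM h2).symm.trans (floor_eq_of_mem_meshCell hM h1))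
    rw [this]; simp [gaussOn]

/-! ### Taylor estimates with explicit uniform constants -/

section Taylor

theorem hasDerivAt_iteratedDeriv {n i : ℕ} {g : ℝ → ℝ} (hg : ContDiff ℝ n g) (hi : i < n) (x : ℝ) :
    HasDerivAt (iteratedDeriv i g) (iteratedDeriv (i + 1) g x) x := by
  rw [iteratedDeriv_succ]
  exact (hg.differentiable_iteratedDeriv i (by exact_mod_cast hi)).differentiableAt.hasDerivAt

/-- The derivative of the remainder is the remainder of the derivative, so induction and the mean
value inequality suffice. The factorial in the bound is dropped: only the order matters below. -/
theorem abs_sub_taylor_le (n : ℕ) : ∀ {g : ℝ → ℝ} {K : ℝ}, ContDiff ℝ (n + 1 : ℕ) g →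
    (∀ x, |iteratedDeriv (n + 1) g x| ≤ K) → ∀ x δ : ℝ,
      |g (x + δ) - ∑ i ∈ Finset.range (n + 1), iteratedDeriv i g x / i.factorial * δ ^ i| ≤
        K * |δ| ^ (n + 1) := by
  induction n with
  | zero =>
    intro g K hg hK x δ
    have h := Convex.norm_image_sub_le_of_norm_hasDerivWithin_le (s := univ) (f := g)
      (f' := iteratedDeriv 1 g) (C := K) (x := x) (y := x + δ)
      (fun z _ => by
        have := hasDerivAt_iteratedDeriv (i := 0) hg (by norm_num) z
        rw [iteratedDeriv_zero] at this
        exact this.hasDerivWithinAt)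
      (fun z _ => by simpa using hK z) convex_univ (mem_univ _) (mem_univ _)
    simpa using h
  | succ n ih =>
    intro g K hg hK x δ
    have hK0 : 0 ≤ K := (abs_nonneg _).trans (hK 0)
    have hg' : ContDiff ℝ (n + 1 : ℕ) (deriv g) := by
      have : ContDiff ℝ ((n + 1 : ℕ) + 1) g := by exact_mod_cast hg
      exact (contDiff_succ_iff_deriv.1 this).2.2
    have ih' := ih (K := K) hg' (fun x => by rw [← iteratedDeriv_succ']; exact hK x) x
    let R : ℝ → ℝ := fun s =>
      g (x + s) - ∑ i ∈ Finset.range (n + 1 + 1), iteratedDeriv i g x / i.factorial * s ^ i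
    let R' : ℝ → ℝ := fun s => deriv g (x + s) -
      ∑ i ∈ Finset.range (n + 1), iteratedDeriv i (deriv g) x / i.factorial * s ^ i
    have hR : ∀ s, HasDerivAt R (R' s) s := by
      intro s
      refine HasDerivAt.sub ?_ ?_
      · have h1 := hasDerivAt_iteratedDeriv (i := 0) hg (by omega) (x + s)
        rw [iteratedDeriv_zero, zero_add, iteratedDeriv_one] at h1
        exact h1.comp_const_add x s
      · have h2 : ∀ i ∈ Finset.range (n + 1 + 1), HasDerivAt
            (fun s : ℝ => iteratedDeriv i g x / i.factorial * s ^ i)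
            (iteratedDeriv i g x / i.factorial * (i * s ^ (i - 1))) s := fun i _ =>
          (hasDerivAt_pow i s).const_mul _
        have h3 := HasDerivAt.fun_sum h2
        rw [Finset.sum_range_succ'] at h3
        simp only [Nat.cast_zero, zero_mul, mul_zero, add_zero] at h3
        convert h3 using 1
        refine Finset.sum_congr rfl fun i _ => ?_
        rw [iteratedDeriv_succ', Nat.factorial_succ, Nat.add_sub_cancel]
        push_cast
        have : ((i : ℝ) + 1) ≠ 0 := by positivity
        have : (i.factorial : ℝ) ≠ 0 := by positivity
        field_simp
    have hbound : ∀ s ∈ uIcc 0 δ, ‖R' s‖ ≤ K * |δ| ^ (n + 1) := by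
      intro s hs
      refine (ih' s).trans ?_
      have : |s| ≤ |δ| := by
        have := abs_sub_left_of_mem_uIcc hs
        simpa using this
      gcongr
    have h := Convex.norm_image_sub_le_of_norm_hasDerivWithin_le (s := uIcc 0 δ) (f := R)
      (f' := R') (x := 0) (y := δ) (fun s _ => (hR s).hasDerivWithinAt) hbound
      (convex_uIcc 0 δ) left_mem_uIcc right_mem_uIcc
    have h0 : R 0 = 0 := by
      simp [R, Finset.sum_range_succ']
    rw [h0, sub_zero, sub_zero, Real.norm_eq_abs, Real.norm_eq_abs] at h
    rw [pow_succ, ← mul_assoc]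
    exact h

theorem Polynomial.exists_abs_eval_add_sub_le (Q : Polynomial ℝ) (K : ℝ) : ∃ C : ℝ, 0 ≤ C ∧
    ∀ a e : ℝ, |a| ≤ K → |e| ≤ K →
      |Q.eval (a + e) - Q.eval a - Q.derivative.eval a * e| ≤ C * e ^ 2 := by
  induction Q using Polynomial.induction_on with
  | C a => exact ⟨0, le_rfl, by simp⟩
  | add P Q hP hQ =>
    obtain ⟨C, hC, hP⟩ := hP
    obtain ⟨D, hD, hQ⟩ := hQ
    refine ⟨C + D, by positivity, fun a e ha he => ?_⟩
    have h1 := hP a e ha he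
    have h2 := hQ a e ha he
    rw [Polynomial.derivative_add]
    simp only [Polynomial.eval_add]
    calc _ = |(P.eval (a + e) - P.eval a - P.derivative.eval a * e) +
          (Q.eval (a + e) - Q.eval a - Q.derivative.eval a * e)| := by ring_nf
      _ ≤ _ := (abs_add_le _ _).trans (by linarith)
  | monomial n c ih =>
    obtain ⟨C, hC, ih⟩ := ih
    obtain ⟨B, hB⟩ := (isCompact_Icc (a := -K) (b := K)).exists_bound_of_continuousOn
      (f := fun x => (Polynomial.C c * Polynomial.X ^ n).derivative.eval x)
      (Polynomial.continuous _).continuousOn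
    refine ⟨2 * |K| * C + |B|, by positivity, fun a e ha he => ?_⟩
    have h1 := ih a e ha he
    have h2 := hB a (abs_le.1 ha)
    rw [Real.norm_eq_abs] at h2
    have e1 : (Polynomial.C c * Polynomial.X ^ (n + 1) : Polynomial ℝ) =
        (Polynomial.C c * Polynomial.X ^ n) * Polynomial.X := by ring
    rw [e1]
    set Q := (Polynomial.C c * Polynomial.X ^ n : Polynomial ℝ)
    simp only [Polynomial.derivative_mul (f := Q), Polynomial.derivative_X, Polynomial.eval_mul,
      Polynomial.eval_add, Polynomial.eval_X, mul_one]
    have hK : 0 ≤ K := (abs_nonneg _).trans ha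
    calc _ = |(a + e) * (Q.eval (a + e) - Q.eval a - Q.derivative.eval a * e) +
          Q.derivative.eval a * e ^ 2| := by ring_nf
      _ ≤ |a + e| * |Q.eval (a + e) - Q.eval a - Q.derivative.eval a * e| +
          |Q.derivative.eval a| * e ^ 2 := by
            refine (abs_add_le _ _).trans (le_of_eq ?_)
            rw [abs_mul, abs_mul, abs_of_nonneg (sq_nonneg e)]
      _ ≤ (2 * |K|) * (C * e ^ 2) + |B| * e ^ 2 := by
            have h3 : |a + e| ≤ 2 * |K| := by
              rw [abs_of_nonneg hK]; exact (abs_add_le _ _).trans (by linarith)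
            have h4 := h2.trans (le_abs_self B)
            gcongr
      _ = _ := by ring

end Taylor

/-! ### The discontinuous Galerkin space and the L² norm -/

section DGSpace

variable {k l M : ℕ}

theorem dgSpace_sub {u w : ℝ → ℝ} (hu : u ∈ dgSpace k M) (hw : w ∈ dgSpace k M) :
    (fun x => u x - w x) ∈ dgSpace k M := by
  refine ⟨hu.1.sub hw.1, fun j => ?_⟩
  obtain ⟨P, hP, hPu⟩ := hu.2 j
  obtain ⟨Q, hQ, hQw⟩ := hw.2 j
  exact ⟨P - Q, (Polynomial.natDegree_sub_le _ _).trans (max_le hP hQ), fun x hx => by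
    simp only [hPu x hx, hQw x hx, Polynomial.eval_sub]⟩

theorem dgSpace_mul {u w : ℝ → ℝ} (hu : u ∈ dgSpace k M) (hw : w ∈ dgSpace l M) :
    (fun x => u x * w x) ∈ dgSpace (k + l) M := by
  refine ⟨hu.1.mul hw.1, fun j => ?_⟩
  obtain ⟨P, hP, hPu⟩ := hu.2 j
  obtain ⟨Q, hQ, hQw⟩ := hw.2 j
  exact ⟨P * Q, Polynomial.natDegree_mul_le.trans (add_le_add hP hQ), fun x hx => by
    simp only [hPu x hx, hQw x hx, Polynomial.eval_mul]⟩

theorem dgSpace_sq {u : ℝ → ℝ} (hu : u ∈ dgSpace k M) :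
    (fun x => u x ^ 2) ∈ dgSpace (k + k) M := by
  simpa only [sq] using dgSpace_mul hu hu

/-- Functions which are continuous up to the boundary on each `I_i ∩ y⁻¹ I_j`. -/
def IsCutContinuous (M : ℕ) (y F : ℝ → ℝ) : Prop :=
  ∀ i j : ℤ, ∃ G : ℝ → ℝ, Continuous G ∧ ∀ x ∈ cutSet M y i j, F x = G x

variable {y F G : ℝ → ℝ}

theorem IsCutContinuous.intervalIntegrable (hM : 0 < M) (hy : IsDegreeOneLift y)
    (hF : IsCutContinuous M y F) : IntervalIntegrable F volume 0 1 :=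
  intervalIntegrable_of_cut hM hy hF

theorem Continuous.isCutContinuous (hF : Continuous F) : IsCutContinuous M y F :=
  fun _ _ => ⟨F, hF, fun _ _ => rfl⟩

theorem IsCutContinuous.mul (hF : IsCutContinuous M y F) (hG : IsCutContinuous M y G) :
    IsCutContinuous M y (fun x => F x * G x) := fun i j => by
  obtain ⟨f, hf, hfF⟩ := hF i j
  obtain ⟨g, hg, hgG⟩ := hG i j
  exact ⟨fun x => f x * g x, hf.mul hg, fun x hx => by simp only [hfF x hx, hgG x hx]⟩

theorem IsCutContinuous.add (hF : IsCutContinuous M y F) (hG : IsCutContinuous M y G) :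
    IsCutContinuous M y (fun x => F x + G x) := fun i j => by
  obtain ⟨f, hf, hfF⟩ := hF i j
  obtain ⟨g, hg, hgG⟩ := hG i j
  exact ⟨fun x => f x + g x, hf.add hg, fun x hx => by simp only [hfF x hx, hgG x hx]⟩

theorem IsCutContinuous.sub (hF : IsCutContinuous M y F) (hG : IsCutContinuous M y G) :
    IsCutContinuous M y (fun x => F x - G x) := fun i j => by
  obtain ⟨f, hf, hfF⟩ := hF i j
  obtain ⟨g, hg, hgG⟩ := hG i j
  exact ⟨fun x => f x - g x, hf.sub hg, fun x hx => by simp only [hfF x hx, hgG x hx]⟩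

theorem IsCutContinuous.sq (hF : IsCutContinuous M y F) :
    IsCutContinuous M y (fun x => F x ^ 2) := by
  simpa only [_root_.sq] using hF.mul hF

theorem isCutContinuous_of_dgSpace {u : ℝ → ℝ} (hu : u ∈ dgSpace k M) :
    IsCutContinuous M y u := fun i j => by
  obtain ⟨P, -, hP⟩ := hu.2 i
  exact ⟨fun x => P.eval x, P.continuous, fun x hx => hP x hx.1⟩

theorem isCutContinuous_comp (hy : Continuous y) {u : ℝ → ℝ} (hu : u ∈ dgSpace k M) :
    IsCutContinuous M y (fun x => u (y x)) := fun i j => by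
  obtain ⟨P, -, hP⟩ := hu.2 j
  exact ⟨fun x => P.eval (y x), P.continuous.comp hy, fun x hx => hP _ hx.2⟩

theorem cutQuad_sq_eq (hM : 0 < M) (hy : IsDegreeOneLift y) {φ : ℝ → ℝ} (hφ : φ ∈ dgSpace k M) :
    cutQuad k M y (fun x => φ x ^ 2) = ∫ x in (0 : ℝ)..1, φ x ^ 2 :=
  cutQuad_eq_integral hM hy fun i j => by
    obtain ⟨P, hP, hPu⟩ := (dgSpace_sq hφ).2 i
    exact ⟨P, hP.trans (by omega), fun x hx => hPu x hx.1⟩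

theorem cutQuad_mul_eq (hM : 0 < M) (hy : IsDegreeOneLift y) {u φ : ℝ → ℝ}
    (hu : u ∈ dgSpace k M) (hφ : φ ∈ dgSpace k M) :
    cutQuad k M y (fun x => u x * φ x) = ∫ x in (0 : ℝ)..1, u x * φ x :=
  cutQuad_eq_integral hM hy fun i j => by
    obtain ⟨P, hP, hPu⟩ := (dgSpace_mul hu hφ).2 i
    exact ⟨P, hP.trans (by omega), fun x hx => hPu x hx.1⟩

theorem normL2_nonneg (w : ℝ → ℝ) : 0 ≤ normL2 w := Real.sqrt_nonneg _

theorem sq_normL2 (w : ℝ → ℝ) : normL2 w ^ 2 = ∫ x in (0 : ℝ)..1, w x ^ 2 :=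
  Real.sq_sqrt (intervalIntegral.integral_nonneg zero_le_one fun _ _ => sq_nonneg _)

theorem abs_cutQuad_mul_le_of_bound (hM : 0 < M) (hy : IsDegreeOneLift y) {g φ : ℝ → ℝ} {B : ℝ}
    (hB : 0 ≤ B) (hg : ∀ i j : ℤ, ∀ x ∈ cutSet M y i j, |g x| ≤ B) (hφ : φ ∈ dgSpace k M) :
    |cutQuad k M y (fun x => g x * φ x)| ≤ B * normL2 φ := by
  refine (abs_cutQuad_mul_le hy g φ).trans ?_
  rw [cutQuad_sq_eq hM hy hφ, normL2]
  refine mul_le_mul_of_nonneg_right ?_ (Real.sqrt_nonneg _)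
  have h1 : cutQuad k M y (fun x => g x ^ 2) ≤ cutQuad k M y (fun _ => B ^ 2) :=
    cutQuad_mono hy fun i j x hx => by
      rw [← sq_abs]; exact pow_le_pow_left₀ (abs_nonneg _) (hg i j x hx) 2
  have h2 : cutQuad k M y (fun _ => B ^ 2) = B ^ 2 := by
    rw [cutQuad_eq_integral hM hy fun i j => ⟨Polynomial.C (B ^ 2), by simp, by simp⟩]
    simp
  rw [h2] at h1
  calc _ ≤ Real.sqrt (B ^ 2) := Real.sqrt_le_sqrt h1
    _ = B := Real.sqrt_sq hB

theorem abs_integral_mul_le (hM : 0 < M) (hF : IsCutContinuous M id F)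
    (hG : IsCutContinuous M id G) :
    |∫ x in (0 : ℝ)..1, F x * G x| ≤ normL2 F * normL2 G := by
  have hy := isDegreeOneLift_id
  have i1 := hF.sq.intervalIntegrable hM hy
  have i2 := hG.sq.intervalIntegrable hM hy
  have i3 := (hF.mul hG).intervalIntegrable hM hy
  refine abs_le_of_sq_le_sq ?_ (mul_nonneg (normL2_nonneg _) (normL2_nonneg _))
  rw [mul_pow, sq_normL2, sq_normL2]
  have h := discrim_le_zero (a := ∫ x in (0 : ℝ)..1, G x ^ 2)
    (b := 2 * ∫ x in (0 : ℝ)..1, F x * G x) (c := ∫ x in (0 : ℝ)..1, F x ^ 2) (by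
    intro t
    have h0 : 0 ≤ ∫ x in (0 : ℝ)..1, (t * t * G x ^ 2 + 2 * t * (F x * G x) + F x ^ 2) :=
      intervalIntegral.integral_nonneg zero_le_one fun x _ => by
        nlinarith [sq_nonneg (t * G x + F x)]
    rw [intervalIntegral.integral_add ((i2.const_mul _).add (i3.const_mul _)) i1,
      intervalIntegral.integral_add (i2.const_mul _) (i3.const_mul _),
      intervalIntegral.integral_const_mul, intervalIntegral.integral_const_mul] at h0
    linarith)
  rw [discrim] at h
  nlinarith

theorem normL2_add_le (hM : 0 < M) (hF : IsCutContinuous M id F) (hG : IsCutContinuous M id G) :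
    normL2 (fun x => F x + G x) ≤ normL2 F + normL2 G := by
  have hy := isDegreeOneLift_id
  have i1 := hF.sq.intervalIntegrable hM hy
  have i2 := hG.sq.intervalIntegrable hM hy
  have i3 := (hF.mul hG).intervalIntegrable hM hy
  have h := (abs_le.1 (abs_integral_mul_le hM hF hG)).2
  refine Real.sqrt_le_iff.2 ⟨add_nonneg (normL2_nonneg _) (normL2_nonneg _), ?_⟩
  have e : ∫ x in (0 : ℝ)..1, (F x + G x) ^ 2 =
      (∫ x in (0 : ℝ)..1, F x ^ 2) + 2 * (∫ x in (0 : ℝ)..1, F x * G x) +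
        ∫ x in (0 : ℝ)..1, G x ^ 2 := by
    rw [← intervalIntegral.integral_const_mul, ← intervalIntegral.integral_add i1 (i3.const_mul _),
      ← intervalIntegral.integral_add (i1.add (i3.const_mul _)) i2]
    exact intervalIntegral.integral_congr fun x _ => by ring
  rw [e, ← sq_normL2, ← sq_normL2]
  nlinarith

theorem normL2_le_of_bound (hM : 0 < M) (hF : IsCutContinuous M id F) {B : ℝ} (hB : 0 ≤ B)
    (h : ∀ i j : ℤ, ∀ x ∈ cutSet M id i j, |F x| ≤ B) : normL2 F ≤ B := by
  refine Real.sqrt_le_iff.2 ⟨hB, ?_⟩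
  calc ∫ x in (0 : ℝ)..1, F x ^ 2 ≤ ∫ x in (0 : ℝ)..1, B ^ 2 := by
        refine intervalIntegral.integral_mono_ae zero_le_one
          (hF.sq.intervalIntegrable hM isDegreeOneLift_id) (by simp) ?_
        filter_upwards [ae_mem_cutSet hM isDegreeOneLift_id] with x hx
        rw [← sq_abs]
        exact pow_le_pow_left₀ (abs_nonneg _) (h _ _ x hx) 2
    _ = B ^ 2 := by simp

end DGSpace

/-! ### Change of variables along the feet -/

section ChangeOfVariables

variable {n M : ℕ} {y y' : ℝ → ℝ}

/-- A degree one lift carries a period onto an interval of length one, over which a periodic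
function has the same integral wherever the interval starts. -/
theorem integral_comp_mul_deriv_of_periodic (hy : IsDegreeOneLift y)
    (hd : ∀ x, HasDerivAt y (y' x) x) (hpos : ∀ x, 0 ≤ y' x) {W : ℝ → ℝ}
    (hW : Function.Periodic W 1) :
    ∫ x in (0 : ℝ)..1, W (y x) * y' x = ∫ x in (0 : ℝ)..1, W x := by
  have himg : y '' Ioc 0 1 = Ioc (y 0) (y 1) := by
    apply Subset.antisymm
    · rintro _ ⟨x, hx, rfl⟩
      exact ⟨hy.strictMono hx.1, hy.strictMono.monotone hx.2⟩
    · intro z hz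
      obtain ⟨x, hx, rfl⟩ := intermediate_value_Icc zero_le_one hy.continuous.continuousOn
        (Ioc_subset_Icc_self hz)
      exact ⟨x, ⟨hy.strictMono.lt_iff_lt.1 hz.1, hx.2⟩, rfl⟩
  have h1 := integral_image_eq_integral_abs_deriv_smul (measurableSet_Ioc (a := (0 : ℝ)) (b := 1))
    (fun x _ => (hd x).hasDerivWithinAt) hy.strictMono.injective.injOn W
  have hy1 : y 1 = y 0 + 1 := by simpa using hy.map_add_one 0
  rw [himg, hy1, ← intervalIntegral.integral_of_le (by linarith),
    ← intervalIntegral.integral_of_le zero_le_one, hW.intervalIntegral_add_eq (y 0) 0,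
    zero_add] at h1
  rw [h1]
  refine intervalIntegral.integral_congr fun x _ => ?_
  simp only [abs_of_nonneg (hpos x), smul_eq_mul, mul_comm]

theorem mul_integral_comp_le (hM : 0 < M) (hy : IsDegreeOneLift y)
    (hd : ∀ x, HasDerivAt y (y' x) x) (hc : Continuous y') {m : ℝ} (hm : 0 < m)
    (hge : ∀ x, m ≤ y' x) {w : ℝ → ℝ} (hw : w ∈ dgSpace n M) (hw0 : ∀ x, 0 ≤ w x) :
    m * ∫ x in (0 : ℝ)..1, w (y x) ≤ ∫ x in (0 : ℝ)..1, w x := by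
  rw [← integral_comp_mul_deriv_of_periodic hy hd (fun x => hm.le.trans (hge x)) hw.1,
    ← intervalIntegral.integral_const_mul]
  have hcut : IsCutContinuous M y (fun x => w (y x)) := isCutContinuous_comp hy.continuous hw
  refine intervalIntegral.integral_mono zero_le_one
    ((hcut.intervalIntegrable hM hy).const_mul m)
    ((hcut.mul hc.isCutContinuous).intervalIntegrable hM hy) fun x => ?_
  simp only
  rw [mul_comm]
  exact mul_le_mul_of_nonneg_left (hge x) (hw0 _)

/-- Integrate 1 − y' = −ε c s(y) + O(ε²) against w ∘ y. Having `s` evaluated at y(x) rather than at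
x is what makes the term of order ε transportable: inserting the Jacobian turns the integral of w(y)
s(y) into that of w s, which is the same for all feet, so that averaging over the feet can cancel
it. -/
theorem integral_comp_le (hM : 0 < M) (hy : IsDegreeOneLift y)
    (hd : ∀ x, HasDerivAt y (y' x) x) (hc : Continuous y') {m K ε c : ℝ} (hm : 0 < m)
    (hK : 0 ≤ K) (hε : 0 ≤ ε) (hge : ∀ x, m ≤ y' x) {s : ℝ → ℝ} (hs : Continuous s)
    (hsper : Function.Periodic s 1) (hsK : ∀ x, |s x| ≤ K) (h1 : ∀ x, |y' x - 1| ≤ K * ε)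
    (h2 : ∀ x, |y' x - 1 - ε * c * s (y x)| ≤ K * ε ^ 2)
    {w : ℝ → ℝ} (hw : w ∈ dgSpace n M) (hw0 : ∀ x, 0 ≤ w x) :
    ∫ x in (0 : ℝ)..1, w (y x) ≤ (∫ x in (0 : ℝ)..1, w x) -
      ε * c * (∫ x in (0 : ℝ)..1, w x * s x) +
        ε ^ 2 * ((K + |c| * K ^ 2) / m) * ∫ x in (0 : ℝ)..1, w x := by
  have hpos : ∀ x, 0 ≤ y' x := fun x => hm.le.trans (hge x)
  have cw : IsCutContinuous M y (fun x => w (y x)) := isCutContinuous_comp hy.continuous hw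
  have cy : IsCutContinuous M y y' := hc.isCutContinuous
  have cs : IsCutContinuous M y (fun x => s (y x)) :=
    (hs.comp hy.continuous).isCutContinuous
  have iw := cw.intervalIntegrable hM hy
  have iwy := (cw.mul cy).intervalIntegrable hM hy
  have iws := (cw.mul cs).intervalIntegrable hM hy
  have iwsy := ((cw.mul cs).mul cy).intervalIntegrable hM hy
  have hX := mul_integral_comp_le hM hy hd hc hm hge hw hw0
  have hN := integral_comp_mul_deriv_of_periodic hy hd hpos hw.1
  have hN' := integral_comp_mul_deriv_of_periodic hy hd hpos (hw.1.mul hsper)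
  simp only [Pi.mul_apply] at hN'
  set X := ∫ x in (0 : ℝ)..1, w (y x) with hXdef
  set N := ∫ x in (0 : ℝ)..1, w x
  set Y := ∫ x in (0 : ℝ)..1, w (y x) * s (y x) with hYdef
  have hX0 : 0 ≤ X := intervalIntegral.integral_nonneg zero_le_one fun x _ => hw0 _
  have hA : X - N + ε * c * Y ≤ K * ε ^ 2 * X := by
    rw [← hN, hXdef, hYdef, ← intervalIntegral.integral_const_mul,
      ← intervalIntegral.integral_const_mul, ← intervalIntegral.integral_sub iw iwy,
      ← intervalIntegral.integral_add (iw.sub iwy) (iws.const_mul _)]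
    refine intervalIntegral.integral_mono zero_le_one ((iw.sub iwy).add (iws.const_mul _))
      (iw.const_mul _) fun x => ?_
    have h3 := (abs_le.1 (h2 x)).1
    have h4 := hw0 (y x)
    simp only
    nlinarith
  -- Inserting y' costs one factor ε, and this quantity is itself multiplied by ε c, so the error is
  -- of second order.
  have hB : |Y - ∫ x in (0 : ℝ)..1, w x * s x| ≤ K ^ 2 * ε * X := by
    rw [← hN', hXdef, hYdef, ← intervalIntegral.integral_sub iws iwsy,
      ← intervalIntegral.integral_const_mul]
    refine (intervalIntegral.abs_integral_le_integral_abs zero_le_one).trans ?_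
    refine intervalIntegral.integral_mono zero_le_one (iws.sub iwsy).abs
      (iw.const_mul _) fun x => ?_
    simp only
    calc |w (y x) * s (y x) - w (y x) * s (y x) * y' x|
        = w (y x) * (|s (y x)| * |y' x - 1|) := by
          rw [← abs_of_nonneg (hw0 (y x)), ← abs_mul, ← abs_mul, abs_of_nonneg (hw0 (y x)),
            ← abs_neg]
          ring_nf
      _ ≤ w (y x) * (K * (K * ε)) := by
          have := h1 x; have := hsK (y x); have := hw0 (y x)
          gcongr
      _ = _ := by ring
  have hC : -(ε * c * (Y - ∫ x in (0 : ℝ)..1, w x * s x)) ≤ ε * |c| * (K ^ 2 * ε * X) := by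
    refine (neg_le_abs _).trans ?_
    rw [abs_mul, abs_mul, abs_of_nonneg hε]
    gcongr
  have hX' : X ≤ N / m := by rw [le_div_iff₀ hm]; linarith
  have hD : (K * ε ^ 2 + ε * |c| * (K ^ 2 * ε)) * X ≤
      (K * ε ^ 2 + ε * |c| * (K ^ 2 * ε)) * (N / m) := by gcongr
  have e : ε ^ 2 * ((K + |c| * K ^ 2) / m) * N =
      (K * ε ^ 2 + ε * |c| * (K ^ 2 * ε)) * (N / m) := by
    field_simp
  rw [e]
  nlinarith

end ChangeOfVariables

/-! ### Cell averages, the local majorants of the quadrature error -/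

section CellMean

variable {n M : ℕ}

/-- The mean value of `w` over the mesh cell containing `z`. -/
noncomputable def cellMean (M : ℕ) (w : ℝ → ℝ) (z : ℝ) : ℝ :=
  M * ∫ x in (⌊(M : ℝ) * z⌋ : ℝ) / M..((⌊(M : ℝ) * z⌋ : ℝ) + 1) / M, w x

theorem cellMean_of_mem (hM : 0 < M) (w : ℝ → ℝ) {j : ℤ} {z : ℝ} (hz : z ∈ meshCell M j) :
    cellMean M w z = M * ∫ x in (j : ℝ) / M..((j : ℝ) + 1) / M, w x := by
  rw [cellMean, floor_eq_of_mem_meshCell hM hz]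

theorem cellMean_nonneg {w : ℝ → ℝ} (hw : ∀ x, 0 ≤ w x) (z : ℝ) : 0 ≤ cellMean M w z :=
  mul_nonneg (Nat.cast_nonneg _) (intervalIntegral.integral_nonneg (by gcongr; linarith)
    fun x _ => hw x)

theorem cellMean_mem_dgSpace (hM : 0 < M) {w : ℝ → ℝ} (hw : Function.Periodic w 1) :
    cellMean M w ∈ dgSpace 0 M := by
  have hM' : (0 : ℝ) < M := by exact_mod_cast hM
  refine ⟨fun z => ?_, fun j => ⟨Polynomial.C ((M : ℝ) * ∫ x in (j : ℝ) / M..((j : ℝ) + 1) / M, w x),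
    (Polynomial.natDegree_C _).le, fun x hx => by rw [cellMean_of_mem hM w hx, Polynomial.eval_C]⟩⟩
  have hfl : ⌊(M : ℝ) * (z + 1)⌋ = ⌊(M : ℝ) * z⌋ + M := by
    rw [mul_add, mul_one]; exact_mod_cast Int.floor_add_natCast _ M
  rw [cellMean, cellMean, hfl]
  congr 1
  have e1 : (((⌊(M : ℝ) * z⌋ + M : ℤ) : ℝ)) / M = (⌊(M : ℝ) * z⌋ : ℝ) / M + 1 := by
    push_cast; field_simp
  have e2 : (((⌊(M : ℝ) * z⌋ + M : ℤ) : ℝ) + 1) / M = ((⌊(M : ℝ) * z⌋ : ℝ) + 1) / M + 1 := by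
    push_cast; field_simp; ring
  rw [e1, e2, ← intervalIntegral.integral_comp_add_right]
  simp only [hw _]

theorem integral_eq_sum_cells (hM : 0 < M) {w : ℝ → ℝ} (hw : IntervalIntegrable w volume 0 1) :
    ∫ x in (0 : ℝ)..1, w x = ∑ i ∈ Finset.range M, ∫ x in (i : ℝ) / M..((i : ℝ) + 1) / M, w x := by
  have hM' : (0 : ℝ) < M := by exact_mod_cast hM
  have h := intervalIntegral.sum_integral_adjacent_intervals (μ := volume) (f := w)
    (a := fun i : ℕ => (i : ℝ) / M) (n := M) (fun i hi => by
      refine hw.mono_set ?_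
      have h1 : ((i : ℝ) / M) ≤ ((i + 1 : ℕ) : ℝ) / M := by gcongr; simp
      rw [uIcc_of_le h1, uIcc_of_le zero_le_one]
      refine Icc_subset_Icc (by positivity) ?_
      rw [div_le_one hM']
      exact_mod_cast hi)
  simp only [Nat.cast_zero, zero_div, div_self hM'.ne'] at h
  rw [← h]
  simp

theorem integral_cellMean (hM : 0 < M) {w : ℝ → ℝ} (hw : w ∈ dgSpace n M) :
    ∫ x in (0 : ℝ)..1, cellMean M w x = ∫ x in (0 : ℝ)..1, w x := by
  have hM' : (0 : ℝ) < M := by exact_mod_cast hM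
  have iw := (isCutContinuous_of_dgSpace (y := id) hw).intervalIntegrable hM isDegreeOneLift_id
  have ic := (isCutContinuous_of_dgSpace (y := id) (cellMean_mem_dgSpace hM hw.1)).intervalIntegrable
    hM isDegreeOneLift_id
  rw [integral_eq_sum_cells hM iw, integral_eq_sum_cells hM ic]
  refine Finset.sum_congr rfl fun i _ => ?_
  have hle : (i : ℝ) / M ≤ ((i : ℝ) + 1) / M := by gcongr; linarith
  rw [intervalIntegral.integral_of_le hle, integral_Ioc_eq_integral_Ioo,
    setIntegral_congr_fun (g := fun _ => M * ∫ x in (i : ℝ) / M..((i : ℝ) + 1) / M, w x)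
      measurableSet_Ioo (fun x hx => by
      have := cellMean_of_mem hM w (j := i) (by simpa [meshCell] using hx)
      simpa using this)]
  rw [setIntegral_const, measureReal_def, Real.volume_Ioo, ENNReal.toReal_ofReal (by linarith),
    smul_eq_mul]
  field_simp
  ring

end CellMean

/-! ### Quadrature error for squares of discontinuous functions composed with a foot -/

section QuadratureError

/-- In the reference coordinate 2 M y − (2 j + 1) of the target cell, expand y at the midpoint as an
affine part plus a perturbation e of size κ / M. The linearisation of Q in e has error O(e²),
already O(κ / M²). In the linear term the quadratic part of y may be kept, because Q' has degree one
less than Q and the Gauss rule has one degree to spare over 2k; only the cubic remainder of y is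
discarded, again O(κ / M²). -/
theorem exists_polynomial_approx (k : ℕ) (hk : 1 ≤ k) {Q : Polynomial ℝ}
    (hQ : Q.natDegree ≤ 2 * k) (K : ℝ) (hK : 0 ≤ K) :
    ∃ C : ℝ, 0 ≤ C ∧ ∀ (M : ℕ) (κ a c : ℝ) (y : ℝ → ℝ) (j : ℤ), 0 < M → 0 ≤ κ → κ ≤ K → a < c →
      c - a ≤ 1 / M → ContDiff ℝ 3 y → (∀ x, |deriv y x| ≤ K) →
      (∀ x, |iteratedDeriv 2 y x| ≤ κ) → (∀ x, |iteratedDeriv 3 y x| ≤ κ) →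
      (∀ x ∈ Ioo a c, y x ∈ meshCell M j) →
      ∃ R : Polynomial ℝ, R.natDegree ≤ 2 * k + 1 ∧ ∀ x ∈ Ioo a c,
        |Q.eval (2 * M * y x - (2 * j + 1)) - R.eval x| ≤ C * κ / M ^ 2 := by
  -- The radius covers both arguments: the affine part stays below 1 + 2 K and the perturbation
  -- below 4 κ / M ≤ 4 K.
  obtain ⟨C, hC, hQC⟩ := Q.exists_abs_eval_add_sub_le (1 + 4 * K)
  obtain ⟨B, hB⟩ := (isCompact_Icc (a := -(1 + 4 * K)) (b := 1 + 4 * K)).exists_bound_of_continuousOn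
      (f := fun x => Q.derivative.eval x) (Polynomial.continuous _).continuousOn
  refine ⟨C * 16 * K + 2 * |B|, by positivity, ?_⟩
  intro M κ a c y j hM hκ hκK hac hlen hy h1 h2 h3 hmem
  have hM' : (0 : ℝ) < M := by exact_mod_cast hM
  have hM1 : (1 : ℝ) ≤ M := by exact_mod_cast hM
  set x₀ := (a + c) / 2 with hx₀
  have hx₀mem : x₀ ∈ Ioo a c := ⟨by rw [hx₀]; linarith, by rw [hx₀]; linarith⟩
  set η₀ : ℝ := 2 * M * y x₀ - (2 * j + 1) with hη₀
  have hη₀le : |η₀| ≤ 1 := by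
    obtain ⟨l1, l2⟩ := hmem x₀ hx₀mem
    rw [div_lt_iff₀ hM'] at l1
    rw [lt_div_iff₀ hM'] at l2
    rw [abs_le]; constructor <;> rw [hη₀] <;> nlinarith
  set d1 := deriv y x₀ with hd1
  set d2 := iteratedDeriv 2 y x₀ with hd2
  let T : Polynomial ℝ := Polynomial.X - Polynomial.C x₀
  let A : Polynomial ℝ := Polynomial.C (2 * M * d1) * T + Polynomial.C η₀
  have hT : T.natDegree = 1 := Polynomial.natDegree_X_sub_C x₀
  have hA : A.natDegree ≤ 1 := by
    refine (Polynomial.natDegree_add_le _ _).trans (max_le ?_ (by simp))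
    exact (Polynomial.natDegree_C_mul_le _ _).trans hT.le
  -- The correction has degree at most (2k − 1) + 2 = 2k + 1, the limit of exactness.
  let R : Polynomial ℝ := Q.comp A + Q.derivative.comp A * (Polynomial.C (M * d2) * T ^ 2)
  refine ⟨R, ?_, ?_⟩
  · refine (Polynomial.natDegree_add_le _ _).trans (max_le ?_ ?_)
    · refine Polynomial.natDegree_comp_le.trans ?_
      calc Q.natDegree * A.natDegree ≤ (2 * k) * 1 := Nat.mul_le_mul hQ hA
        _ ≤ _ := by omega
    · refine Polynomial.natDegree_mul_le.trans ?_
      have e1 : (Q.derivative.comp A).natDegree ≤ 2 * k - 1 := by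
        refine Polynomial.natDegree_comp_le.trans ?_
        calc _ ≤ (2 * k - 1) * 1 := Nat.mul_le_mul
              ((Polynomial.natDegree_derivative_le Q).trans (by omega)) hA
          _ = _ := by omega
      have e2 : (Polynomial.C (M * d2) * T ^ 2).natDegree ≤ 2 :=
        (Polynomial.natDegree_C_mul_le _ _).trans (by rw [Polynomial.natDegree_pow, hT])
      omega
  · intro x hx
    set t := x - x₀ with ht
    have htM : |t| ≤ 1 / M := by
      rw [abs_le]; constructor <;> rw [ht] <;> linarith [hx.1, hx.2, hx₀mem.1, hx₀mem.2]
    have ht1 : |t| ≤ 1 := htM.trans (by rw [div_le_one hM']; exact hM1)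
    have htay := abs_sub_taylor_le 2 (g := y) (K := κ) (by exact_mod_cast hy) h3 x₀ t
    simp only [Finset.sum_range_succ, Finset.sum_range_zero, iteratedDeriv_zero, iteratedDeriv_one,
      Nat.factorial] at htay
    rw [← hd1, ← hd2, show x₀ + t = x by rw [ht]; ring] at htay
    set ρ := y x - (y x₀ + d1 * t + d2 / 2 * t ^ 2) with hρ
    have hρle : |ρ| ≤ κ * |t| ^ 3 := by
      convert htay using 2
      rw [hρ]; norm_num
    set a' := η₀ + 2 * M * d1 * t with ha'
    set e := M * d2 * t ^ 2 + 2 * M * ρ with he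
    have hη : 2 * M * y x - (2 * j + 1) = a' + e := by
      rw [ha', he, hρ, hη₀]; ring
    have hAe : A.eval x = a' := by
      simp only [A, T, Polynomial.eval_add, Polynomial.eval_mul, Polynomial.eval_C,
        Polynomial.eval_sub, Polynomial.eval_X]
      rw [ha', ht]; ring
    have hRe : R.eval x = Q.eval a' + Q.derivative.eval a' * (M * d2 * t ^ 2) := by
      simp only [R, Polynomial.eval_add, Polynomial.eval_mul, Polynomial.eval_comp, hAe,
        Polynomial.eval_C, Polynomial.eval_pow, T, Polynomial.eval_sub, Polynomial.eval_X]
      rfl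
    have hMt : M * |t| ≤ 1 := by
      calc M * |t| ≤ M * (1 / M) := by gcongr
        _ = 1 := by field_simp
    have ha'le : |a'| ≤ 1 + 4 * K := by
      rw [ha']
      refine (abs_add_le _ _).trans (add_le_add hη₀le ?_)
      rw [show 2 * (M : ℝ) * d1 * t = 2 * (d1 * (M * t)) by ring, abs_mul, abs_mul, abs_mul,
        abs_of_pos hM', abs_of_pos (by norm_num : (0 : ℝ) < 2)]
      have := h1 x₀
      calc 2 * (|d1| * (M * |t|)) ≤ 2 * (K * 1) := by gcongr
        _ ≤ _ := by linarith
    have hρM : |2 * M * ρ| ≤ 2 * κ / M ^ 2 := by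
      rw [abs_mul, abs_of_pos (by positivity)]
      calc 2 * M * |ρ| ≤ 2 * M * (κ * |t| ^ 3) := by gcongr
        _ = 2 * κ * |t| ^ 2 * (M * |t|) := by ring
        _ ≤ 2 * κ * (1 / M) ^ 2 * 1 := by gcongr
        _ = _ := by field_simp
    have hele : |e| ≤ 4 * κ / M := by
      rw [he]
      refine (abs_add_le _ _).trans ?_
      have e1 : |M * d2 * t ^ 2| ≤ κ / M := by
        rw [abs_mul, abs_mul, abs_of_pos hM', abs_pow]
        have := h2 x₀
        calc M * |d2| * |t| ^ 2 = |d2| * |t| * (M * |t|) := by ring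
          _ ≤ κ * (1 / M) * 1 := by gcongr
          _ = _ := by field_simp
      have e2 : 2 * κ / M ^ 2 ≤ 2 * κ / M := by
        gcongr
        nlinarith
      have e3 : 4 * κ / M = κ / M + 2 * κ / M + κ / M := by ring
      have e4 : 0 ≤ κ / M := by positivity
      linarith
    have hele' : |e| ≤ 1 + 4 * K := by
      refine hele.trans ?_
      rw [div_le_iff₀ hM']
      have : (1 + 4 * K) * 1 ≤ (1 + 4 * K) * M := by gcongr
      linarith
    have hmain := hQC a' e ha'le hele'
    have hB' : |Q.derivative.eval a'| ≤ |B| := by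
      have := hB a' (abs_le.1 ha'le)
      rw [Real.norm_eq_abs] at this
      exact this.trans (le_abs_self B)
    rw [hη, hRe]
    calc |Q.eval (a' + e) - (Q.eval a' + Q.derivative.eval a' * (M * d2 * t ^ 2))|
        = |(Q.eval (a' + e) - Q.eval a' - Q.derivative.eval a' * e) +
            Q.derivative.eval a' * (2 * M * ρ)| := by rw [he]; ring_nf
      _ ≤ C * e ^ 2 + |Q.derivative.eval a'| * |2 * M * ρ| := by
            refine (abs_add_le _ _).trans ?_
            rw [abs_mul (Q.derivative.eval a')]
            linarith
      _ ≤ C * (4 * κ / M) ^ 2 + |B| * (2 * κ / M ^ 2) := by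
            rw [← sq_abs e]
            gcongr
      _ = (C * 16 * κ + 2 * |B|) * κ / M ^ 2 := by field_simp; ring
      _ ≤ _ := by gcongr

end QuadratureError

/-- The square has degree at most 2k, so the rule is exact. It makes the cell mean of u² control the
nodal values of u. -/
theorem cellMean_sq_eq {k M : ℕ} (hM : 0 < M) {u : ℝ → ℝ} {j : ℤ} {P : Polynomial ℝ}
    (hP : P.natDegree ≤ k) (hu : ∀ x ∈ meshCell M j, u x = P.eval x) {z : ℝ}
    (hz : z ∈ meshCell M j) :
    cellMean M (fun x => u x ^ 2) z = ∑ α, gaussWeight k α / 2 *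
      P.eval ((j + 1 / 2) / M + gaussNode k α / (2 * M)) ^ 2 := by
  have hM' : (0 : ℝ) < M := by exact_mod_cast hM
  have hle : (j : ℝ) / M ≤ ((j : ℝ) + 1) / M := by gcongr; linarith
  rw [cellMean_of_mem hM _ hz]
  have h1 : ∫ x in (j : ℝ) / M..((j : ℝ) + 1) / M, u x ^ 2 =
      ∫ x in (j : ℝ) / M..((j : ℝ) + 1) / M, (P * P).eval x := by
    rw [intervalIntegral.integral_of_le hle, intervalIntegral.integral_of_le hle,
      integral_Ioc_eq_integral_Ioo, integral_Ioc_eq_integral_Ioo]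
    exact setIntegral_congr_fun measurableSet_Ioo fun x hx => by
      simp only [hu x hx, Polynomial.eval_mul, sq]
  rw [h1, ← gaussOn_polynomial (k := k) _ _ (Polynomial.natDegree_mul_le.trans (by omega)), gaussOn,
    Finset.mul_sum]
  refine Finset.sum_congr rfl fun α _ => ?_
  have e1 : ((j : ℝ) / M + ((j : ℝ) + 1) / M) / 2 + gaussNode k α * ((((j : ℝ) + 1) / M - j / M) / 2) =
      (j + 1 / 2) / M + gaussNode k α / (2 * M) := by
    field_simp; ring
  rw [e1, Polynomial.eval_mul]
  field_simp
  ring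

theorem eval_eq_sum_lagrange {k : ℕ} {P : Polynomial ℝ} (hP : P.natDegree ≤ k) (x : ℝ) :
    P.eval x = ∑ α, P.eval (gaussNode k α) *
      (Lagrange.basis Finset.univ (gaussNode k) α).eval x := by
  have h := Lagrange.eq_interpolate (s := Finset.univ) (v := gaussNode k)
    (gaussNode_injective k).injOn (f := P) (by
      refine lt_of_le_of_lt Polynomial.degree_le_natDegree ?_
      simp only [Finset.card_univ, Fintype.card_fin]
      exact_mod_cast Nat.lt_succ_of_le hP)
  conv_lhs => rw [h, Lagrange.interpolate_apply, Polynomial.eval_finsetSum]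
  simp

/-- On a cut interval expand u ∘ y in the Lagrange basis of the target cell. The products of basis
polynomials form a finite family independent of mesh and foot, to which `exists_polynomial_approx`
applies with one constant. The squared sum of the nodal values is at most a multiple of the cell
mean of u², so the error is local in the target cell, and a last change of variables sums it to the
full norm. -/
theorem exists_quadrature_error (k : ℕ) (K m : ℝ) (hK : 0 ≤ K) (hm : 0 < m) :
    ∃ C : ℝ, 0 ≤ C ∧ ∀ (M : ℕ) (κ : ℝ) (y u : ℝ → ℝ), 0 < M → 0 ≤ κ → κ ≤ K →
      IsDegreeOneLift y → ContDiff ℝ 1 y → (∀ x, m ≤ deriv y x) → (∀ x, |deriv y x| ≤ K) →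
      (1 ≤ k → ContDiff ℝ 3 y ∧ (∀ x, |iteratedDeriv 2 y x| ≤ κ) ∧
        ∀ x, |iteratedDeriv 3 y x| ≤ κ) →
      u ∈ dgSpace k M →
      |cutQuad k M y (fun x => u (y x) ^ 2) - ∫ x in (0 : ℝ)..1, u (y x) ^ 2| ≤
        C * κ / M ^ 2 * ∫ x in (0 : ℝ)..1, u x ^ 2 := by
  rcases Nat.eq_zero_or_pos k with rfl | hk
  -- For k = 0 the composition is constant on each cut interval and the quadrature is exact; no
  -- higher derivative of the foot is involved.
  · refine ⟨0, le_rfl, fun M κ y u hM _ _ hy _ _ _ _ hu => ?_⟩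
    rw [cutQuad_eq_integral hM hy]
    · simp
    · intro i j
      obtain ⟨P, hP, hPu⟩ := hu.2 j
      obtain ⟨c, rfl⟩ := Polynomial.natDegree_eq_zero.1 (Nat.le_zero.1 hP)
      exact ⟨Polynomial.C (c ^ 2), by simp, fun x hx => by rw [hPu _ hx.2]; simp⟩
  · set ℓ : Fin (k + 1) → Polynomial ℝ := Lagrange.basis Finset.univ (gaussNode k) with hℓ
    have hℓd : ∀ α β, (ℓ α * ℓ β).natDegree ≤ 2 * k := fun α β => by
      have : ∀ α, (ℓ α).natDegree = k := fun α => by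
        rw [hℓ, Lagrange.natDegree_basis (gaussNode_injective k).injOn (Finset.mem_univ α)]; simp
      exact Polynomial.natDegree_mul_le.trans (by rw [this, this]; omega)
    choose c hc0 hc using fun α β => exists_polynomial_approx k hk (hℓd α β) K hK
    set C₀ := ∑ α, ∑ β, c α β with hC₀
    have hcC : ∀ α β, c α β ≤ C₀ := fun α β =>
      (Finset.single_le_sum (f := fun β => c α β) (fun β _ => hc0 α β) (Finset.mem_univ β)).trans
        (Finset.single_le_sum (f := fun α => ∑ β, c α β)
          (fun α _ => Finset.sum_nonneg fun β _ => hc0 α β) (Finset.mem_univ α))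
    have hC₀0 : 0 ≤ C₀ := Finset.sum_nonneg fun α _ => Finset.sum_nonneg fun β _ => hc0 α β
    have hω := (isGaussRule_gauss k).weight_pos
    -- The Cauchy–Schwarz constant between the sum of the |p α| and the Gauss form of the cell mean.
    set W := ∑ α, 2 / gaussWeight k α with hW
    have hW0 : 0 ≤ W := Finset.sum_nonneg fun α _ => by have := hω α; positivity
    refine ⟨2 * (W * C₀ / m), by positivity, ?_⟩
    intro M κ y u hM hκ hκK hy hy1 hge hle hhigh hu
    obtain ⟨hy3, h2, h3⟩ := hhigh hk
    have hM' : (0 : ℝ) < M := by exact_mod_cast hM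
    have hu2 := dgSpace_sq hu
    set D := W * (C₀ * κ / M ^ 2) with hD
    have hD0 : 0 ≤ D := by positivity
    have hcm := cellMean_mem_dgSpace hM hu2.1
    -- The error density: it is constant on each cut interval because y sends that interval into a
    -- single cell.
    have hcut : IsCutContinuous M y (fun x => D * cellMean M (fun x => u x ^ 2) (y x)) :=
      (continuous_const.isCutContinuous).mul (isCutContinuous_comp hy.continuous hcm)
    have hmain := abs_cutQuad_sub_integral_le (k := k) hM hy
      ((isCutContinuous_comp hy.continuous hu2).intervalIntegrable hM hy)
      (hcut.intervalIntegrable hM hy) (fun i j hne => by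
        obtain ⟨P, hP, hPu⟩ := hu.2 j
        obtain ⟨hIoo, -⟩ := cutSet_eq_Ioo hy (M := M) i j
        set a := sInf (cutSet M y i j)
        set c' := sSup (cutSet M y i j)
        rw [hIoo] at hne
        have hac : a < c' := nonempty_Ioo.1 hne
        have hlen : c' - a ≤ 1 / M := by
          have hsub : Ioo a c' ⊆ Ioo ((i : ℝ) / M) (((i : ℝ) + 1) / M) := by
            rw [← hIoo]; exact inter_subset_left
          obtain ⟨s1, s2⟩ := (Ioo_subset_Ioo_iff hac).1 hsub
          have : ((i : ℝ) + 1) / M = i / M + 1 / M := by ring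
          linarith
        have hmem : ∀ x ∈ Ioo a c', y x ∈ meshCell M j := by
          rw [← hIoo]; exact fun x hx => hx.2
        choose R hRd hR using fun α β =>
          hc α β M κ a c' y j hM hκ hκK hac hlen hy3 hle h2 h3 hmem
        let p : Fin (k + 1) → ℝ := fun α => P.eval ((j + 1 / 2) / M + gaussNode k α / (2 * M))
        have hval : ∀ x ∈ Ioo a c', u (y x) = ∑ α, p α * (ℓ α).eval (2 * M * y x - (2 * j + 1)) := by
          intro x hx
          rw [hPu _ (hmem x hx)]
          let A : Polynomial ℝ := Polynomial.C (1 / (2 * M) : ℝ) * Polynomial.X +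
            Polynomial.C (((j : ℝ) + 1 / 2) / M)
          have hA : (P.comp A).natDegree ≤ k := by
            refine Polynomial.natDegree_comp_le.trans ?_
            calc _ ≤ k * 1 := Nat.mul_le_mul hP Polynomial.natDegree_linear_le
              _ = k := mul_one k
          have := eval_eq_sum_lagrange hA (2 * M * y x - (2 * j + 1))
          simp only [A, Polynomial.eval_comp, Polynomial.eval_add, Polynomial.eval_mul,
            Polynomial.eval_C, Polynomial.eval_X] at this
          rw [show 1 / (2 * (M : ℝ)) * (2 * M * y x - (2 * j + 1)) + (j + 1 / 2) / M = y x by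
            field_simp; ring] at this
          rw [this]
          refine Finset.sum_congr rfl fun α _ => ?_
          congr 2
          ring
        have hsum : (∑ α, |p α|) ^ 2 ≤ W * ∑ α, gaussWeight k α / 2 * p α ^ 2 := by
          refine Finset.sum_sq_le_sum_mul_sum_of_sq_le_mul _ (fun α _ => ?_) (fun α _ => ?_)
            (fun α _ => ?_)
          · have := hω α; positivity
          · have := hω α; positivity
          · have := (hω α).ne'
            rw [sq_abs]; field_simp; exact le_rfl
        refine ⟨∑ α, ∑ β, Polynomial.C (p α * p β) * R α β, ?_,
          D * ∑ α, gaussWeight k α / 2 * p α ^ 2, ?_⟩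
        · refine Polynomial.natDegree_sum_le_of_forall_le _ _ fun α _ =>
            Polynomial.natDegree_sum_le_of_forall_le _ _ fun β _ => ?_
          exact (Polynomial.natDegree_C_mul_le _ _).trans (hRd α β)
        · rw [hIoo]
          intro x hx
          refine ⟨?_, by rw [cellMean_sq_eq hM hP hPu (hmem x hx)]⟩
          rw [hval x hx]
          simp only [Polynomial.eval_finsetSum, Polynomial.eval_mul (p := Polynomial.C _),
            Polynomial.eval_C]
          rw [sq, Finset.sum_mul_sum, ← Finset.sum_sub_distrib]
          simp only [← Finset.sum_sub_distrib]
          calc |∑ α, ∑ β, (p α * (ℓ α).eval (2 * M * y x - (2 * j + 1)) *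
                (p β * (ℓ β).eval (2 * M * y x - (2 * j + 1))) - p α * p β * (R α β).eval x)|
              ≤ ∑ α, ∑ β, |p α| * |p β| * (C₀ * κ / M ^ 2) := by
                refine (Finset.abs_sum_le_sum_abs _ _).trans (Finset.sum_le_sum fun α _ =>
                  (Finset.abs_sum_le_sum_abs _ _).trans (Finset.sum_le_sum fun β _ => ?_))
                have h4 := hR α β x hx
                rw [Polynomial.eval_mul] at h4
                have h5 : c α β * κ / M ^ 2 ≤ C₀ * κ / M ^ 2 := by
                  have := hcC α β
                  gcongr
                rw [← abs_mul]
                calc _ = |p α * p β * ((ℓ α).eval (2 * M * y x - (2 * j + 1)) *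
                      (ℓ β).eval (2 * M * y x - (2 * j + 1)) - (R α β).eval x)| := by ring_nf
                  _ ≤ _ := by
                    rw [abs_mul]
                    exact mul_le_mul_of_nonneg_left (h4.trans h5) (abs_nonneg _)
            _ = (∑ α, |p α|) ^ 2 * (C₀ * κ / M ^ 2) := by
                generalize C₀ * κ / (M : ℝ) ^ 2 = z
                rw [sq, Finset.sum_mul_sum]
                simp only [Finset.sum_mul]
            _ ≤ (W * ∑ α, gaussWeight k α / 2 * p α ^ 2) * (C₀ * κ / M ^ 2) := by
                gcongr
            _ = _ := by rw [hD]; ring)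
    refine hmain.trans ?_
    rw [intervalIntegral.integral_const_mul]
    have h5 := mul_integral_comp_le hM hy
      (fun x => (hy1.differentiable (by norm_num) x).hasDerivAt) (hy1.continuous_deriv le_rfl)
      hm hge hcm (cellMean_nonneg fun x => sq_nonneg _)
    rw [integral_cellMean hM hu2, mul_comm, ← le_div_iff₀ hm] at h5
    calc 2 * (D * ∫ x in (0 : ℝ)..1, cellMean M (fun x => u x ^ 2) (y x))
        ≤ 2 * (D * ((∫ x in (0 : ℝ)..1, u x ^ 2) / m)) := by gcongr
      _ = _ := by rw [hD]; field_simp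

/-! ### Stability under the weak CFL condition -/

/-- Bounds on a foot `y = x + ε c ∫ s + O(ε²)` of a characteristic, `ε` being the square root of the
time step: lower bound `m` and upper bounds in terms of `K` for its derivatives. -/
structure FootBounds (k : ℕ) (s : ℝ → ℝ) (c m K ε : ℝ) (y : ℝ → ℝ) : Prop where
  lift : IsDegreeOneLift y
  contDiff : ContDiff ℝ 1 y
  le_deriv : ∀ x, m ≤ deriv y x
  abs_deriv_le : ∀ x, |deriv y x| ≤ K
  abs_deriv_sub_one_le : ∀ x, |deriv y x - 1| ≤ K * ε
  abs_deriv_sub_le : ∀ x, |deriv y x - 1 - ε * c * s (y x)| ≤ K * ε ^ 2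
  high : 1 ≤ k → ContDiff ℝ 3 y ∧ (∀ x, |iteratedDeriv 2 y x| ≤ min K (K * ε)) ∧
    ∀ x, |iteratedDeriv 3 y x| ≤ min K (K * ε)

/-- Stability of the averages of `u²` along the feet of the characteristics, for the cut
quadratures and under the weak CFL condition. -/
theorem exists_stability {ι : Type*} [Fintype ι] (k : ℕ) (K m : ℝ) (hK : 0 ≤ K) (hm : 0 < m)
    (wt c : ι → ℝ) (hwt : ∀ q, 0 ≤ wt q) (hwt1 : ∑ q, wt q = 1) (hc : ∑ q, wt q * c q = 0)
    {s : ℝ → ℝ} (hs : Continuous s) (hsper : Function.Periodic s 1) (hsK : ∀ x, |s x| ≤ K)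
    (lam : ℝ) :
    ∃ L : ℝ, 0 ≤ L ∧ ∀ (M : ℕ) (ε : ℝ) (y : ι → ℝ → ℝ) (u : ℝ → ℝ), 0 < M → 0 ≤ ε →
      (1 / (M : ℝ)) ^ 4 ≤ lam * ε ^ 2 → (∀ q, FootBounds k s (c q) m K ε (y q)) →
      u ∈ dgSpace k M →
      ∑ q, wt q * cutQuad k M (y q) (fun x => u (y q x) ^ 2) ≤
        (1 + L * ε ^ 2) * ∫ x in (0 : ℝ)..1, u x ^ 2 := by
  obtain ⟨C, hC, hquad⟩ := exists_quadrature_error k K m hK hm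
  have hB0 : ∀ q, 0 ≤ (K + |c q| * K ^ 2) / m := fun q => by positivity
  refine ⟨∑ q, wt q * ((K + |c q| * K ^ 2) / m) + C * K * Real.sqrt lam, ?_, ?_⟩
  · have : 0 ≤ ∑ q, wt q * ((K + |c q| * K ^ 2) / m) :=
      Finset.sum_nonneg fun q _ => mul_nonneg (hwt q) (hB0 q)
    positivity
  intro M ε y u hM hε hcfl hy hu
  have hM' : (0 : ℝ) < M := by exact_mod_cast hM
  have hu2 := dgSpace_sq hu
  set N := ∫ x in (0 : ℝ)..1, u x ^ 2 with hN
  have hN0 : 0 ≤ N := intervalIntegral.integral_nonneg zero_le_one fun x _ => sq_nonneg _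
  -- The square root of the CFL condition: Δx² = O(ε). Together with second and third derivatives of
  -- size O(ε), it turns the quadrature error into O(ε²).
  have hcfl' : 1 / (M : ℝ) ^ 2 ≤ Real.sqrt lam * ε := by
    have h1 := Real.sqrt_le_sqrt hcfl
    rw [Real.sqrt_mul' _ (sq_nonneg ε), Real.sqrt_sq hε,
      show (1 / (M : ℝ)) ^ 4 = (1 / (M : ℝ) ^ 2) ^ 2 by ring, Real.sqrt_sq (by positivity)] at h1
    exact h1
  have hq : ∀ q, cutQuad k M (y q) (fun x => u (y q x) ^ 2) ≤ N -
      ε * c q * (∫ x in (0 : ℝ)..1, u x ^ 2 * s x) +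
        ε ^ 2 * ((K + |c q| * K ^ 2) / m) * N + C * K * Real.sqrt lam * ε ^ 2 * N := by
    intro q
    have hF := hy q
    -- The cap `K` keeps the quadrature constant uniform, and the bound K ε supplies the factor ε
    -- which the CFL condition completes.
    have h1 := hquad M (min K (K * ε)) (y q) u hM (le_min hK (by positivity)) (min_le_left _ _)
      hF.lift hF.contDiff hF.le_deriv hF.abs_deriv_le hF.high hu
    have h2 := integral_comp_le hM hF.lift
      (fun x => (hF.contDiff.differentiable (by norm_num) x).hasDerivAt)
      (hF.contDiff.continuous_deriv le_rfl) hm hK hε hF.le_deriv hs hsper hsK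
      hF.abs_deriv_sub_one_le hF.abs_deriv_sub_le hu2 (fun x => sq_nonneg _)
    have h3 : C * min K (K * ε) / M ^ 2 * N ≤ C * K * Real.sqrt lam * ε ^ 2 * N := by
      refine mul_le_mul_of_nonneg_right ?_ hN0
      calc C * min K (K * ε) / M ^ 2 = C * min K (K * ε) * (1 / M ^ 2) := by ring
        _ ≤ C * (K * ε) * (Real.sqrt lam * ε) := by
            gcongr
            exact min_le_right _ _
        _ = _ := by ring
    linarith [(abs_le.1 h1).2]
  calc ∑ q, wt q * cutQuad k M (y q) (fun x => u (y q x) ^ 2)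
      ≤ ∑ q, wt q * (N - ε * c q * (∫ x in (0 : ℝ)..1, u x ^ 2 * s x) +
        ε ^ 2 * ((K + |c q| * K ^ 2) / m) * N + C * K * Real.sqrt lam * ε ^ 2 * N) :=
        Finset.sum_le_sum fun q _ => mul_le_mul_of_nonneg_left (hq q) (hwt q)
    _ = ∑ q, (wt q * (N + C * K * Real.sqrt lam * ε ^ 2 * N) -
          wt q * c q * (ε * ∫ x in (0 : ℝ)..1, u x ^ 2 * s x) +
          wt q * ((K + |c q| * K ^ 2) / m) * (ε ^ 2 * N)) :=
        Finset.sum_congr rfl fun q _ => by ring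
    _ = _ := by
        -- The term of order ε is ∑ wt q c q times an integral that does not depend on q, hence
        -- zero.
        rw [Finset.sum_add_distrib, Finset.sum_sub_distrib, ← Finset.sum_mul, ← Finset.sum_mul,
          ← Finset.sum_mul, hwt1, hc]
        ring

/-! ### Uniform bounds for periodic functions depending on a parameter -/

section Parameters

theorem contDiff_iteratedDeriv_param {n : ℕ} (j : ℕ) : ∀ {m : ℕ} {F : ℝ → ℝ → ℝ},
    ContDiff ℝ n (Function.uncurry F) → j + m ≤ n →
      ContDiff ℝ m (Function.uncurry fun s x => iteratedDeriv j (F s) x) := by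
  induction j with
  | zero =>
    intro m F hF hm
    simp only [iteratedDeriv_zero]
    exact hF.of_le (by exact_mod_cast (by omega : m ≤ n))
  | succ j ih =>
    intro m F hF hm
    have h1 := ih (m := m + 1) hF (by omega)
    have h2 : ContDiff ℝ (m + 1 : ℕ) (Function.uncurry
        fun (p : ℝ × ℝ) (x : ℝ) => iteratedDeriv j (F p.1) x) :=
      h1.comp (contDiff_fst.fst.prodMk contDiff_snd)
    have h3 := (ContDiff.fderiv (n := m) h2 (contDiff_snd (E := ℝ) (F := ℝ)) (by norm_cast)).clm_apply
      (contDiff_const (c := (1 : ℝ)))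
    convert h3 using 1
    funext p
    simp only [Function.uncurry, iteratedDeriv_succ]
    rfl

theorem Function.Periodic.iteratedDeriv {g : ℝ → ℝ} {c : ℝ} (hg : Function.Periodic g c) (j : ℕ) :
    Function.Periodic (iteratedDeriv j g) c := fun x => by
  have h := iteratedDeriv_comp_add_const j g c
  have h2 : (fun z => g (z + c)) = g := funext hg
  rw [h2] at h
  exact (congrFun h x).symm

theorem Function.Periodic.eq_fract {g : ℝ → ℝ} (hg : Function.Periodic g 1) (x : ℝ) :
    g x = g (Int.fract x) := by
  have := hg.sub_int_mul_eq (x := x) ⌊x⌋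
  rw [mul_one] at this
  exact this.symm

theorem exists_bound_of_periodic {G : ℝ → ℝ → ℝ} (hG : Continuous (Function.uncurry G))
    (hper : ∀ s, Function.Periodic (G s) 1) (a c : ℝ) :
    ∃ K : ℝ, 0 ≤ K ∧ ∀ s ∈ Icc a c, ∀ x, |G s x| ≤ K := by
  obtain ⟨K, hK⟩ := ((isCompact_Icc (a := a) (b := c)).prod
    (isCompact_Icc (a := (0 : ℝ)) (b := 1))).exists_bound_of_continuousOn hG.continuousOn
  refine ⟨|K|, abs_nonneg _, fun s hs x => ?_⟩
  rw [(hper s).eq_fract]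
  exact (hK (s, Int.fract x) ⟨hs, Int.fract_nonneg x, (Int.fract_lt_one x).le⟩).trans (le_abs_self K)

theorem exists_lipschitz_of_periodic {G : ℝ → ℝ → ℝ} (hG : ContDiff ℝ 1 (Function.uncurry G))
    (hper : ∀ s, Function.Periodic (G s) 1) (a c : ℝ) :
    ∃ K : ℝ, 0 ≤ K ∧ ∀ s ∈ Icc a c, ∀ t ∈ Icc a c, ∀ x, |G s x - G t x| ≤ K * |s - t| := by
  obtain ⟨K, hK⟩ := LocallyLipschitzOn.exists_lipschitzOnWith_of_compact
    ((isCompact_Icc (a := a) (b := c)).prod (isCompact_Icc (a := (0 : ℝ)) (b := 1)))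
    hG.locallyLipschitz.locallyLipschitzOn
  refine ⟨K, K.2, fun s hs t ht x => ?_⟩
  rw [(hper s).eq_fract, (hper t).eq_fract]
  have hx : Int.fract x ∈ Icc (0 : ℝ) 1 := ⟨Int.fract_nonneg x, (Int.fract_lt_one x).le⟩
  have h := hK.dist_le_mul (s, Int.fract x) ⟨hs, hx⟩ (t, Int.fract x) ⟨ht, hx⟩
  rw [Prod.dist_eq, dist_self, max_eq_left dist_nonneg, Real.dist_eq, Real.dist_eq] at h
  exact h

theorem exists_bound_of_periodic_one {g : ℝ → ℝ} (hg : Continuous g) (hper : Function.Periodic g 1) :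
    ∃ K : ℝ, 0 ≤ K ∧ ∀ x, |g x| ≤ K := by
  obtain ⟨K, hK, h⟩ := exists_bound_of_periodic (G := fun _ => g) (hg.comp continuous_snd)
    (fun _ => hper) 0 0
  exact ⟨K, hK, h 0 ⟨le_rfl, le_rfl⟩⟩

end Parameters

/-! ### Bounds for feet of the form x + ε Z(ε, x) -/

section Feet

theorem FootBounds.mono {k : ℕ} {s y : ℝ → ℝ} {c m K K' ε : ℝ} (h : FootBounds k s c m K ε y)
    (hε : 0 ≤ ε) (hK : K ≤ K') : FootBounds k s c m K' ε y where
  lift := h.lift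
  contDiff := h.contDiff
  le_deriv := h.le_deriv
  abs_deriv_le x := (h.abs_deriv_le x).trans hK
  abs_deriv_sub_one_le x := (h.abs_deriv_sub_one_le x).trans (by gcongr)
  abs_deriv_sub_le x := (h.abs_deriv_sub_le x).trans (by gcongr)
  high hk := by
    obtain ⟨h1, h2, h3⟩ := h.high hk
    have : min K (K * ε) ≤ min K' (K' * ε) := by gcongr
    exact ⟨h1, fun x => (h2 x).trans this, fun x => (h3 x).trans this⟩

theorem isDegreeOneLift_of_deriv_pos {y : ℝ → ℝ} (hc : Continuous y) (hd : ∀ x, 0 < deriv y x)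
    (h1 : ∀ x, y (x + 1) = y x + 1) : IsDegreeOneLift y :=
  ⟨strictMono_of_deriv_pos hd, hc, h1⟩

theorem footBounds_translation (k : ℕ) (c m K ε a : ℝ) (hm : m ≤ 1) (hK : 1 ≤ K) (hε : 0 ≤ ε) :
    FootBounds k (fun _ => 0) c m K ε (fun x => x + a) := by
  have hd : deriv (fun x : ℝ => x + a) = fun _ => 1 := by
    funext x; simp
  have hcd : ContDiff ℝ 3 (fun x : ℝ => x + a) := by fun_prop
  have h2 : ∀ x, iteratedDeriv 2 (fun x : ℝ => x + a) x = 0 := fun x => by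
    rw [iteratedDeriv_succ', hd]; simp
  have h3 : ∀ x, iteratedDeriv 3 (fun x : ℝ => x + a) x = 0 := fun x => by
    rw [iteratedDeriv_succ', hd]; simp [iteratedDeriv_const]
  have h0 : (0 : ℝ) ≤ min K (K * ε) := le_min (by linarith) (by positivity)
  refine ⟨isDegreeOneLift_of_deriv_pos (by fun_prop) (fun x => by rw [hd]; norm_num)
    (fun x => by ring), by fun_prop, fun x => by rw [hd]; exact hm, fun x => ?_, fun x => ?_,
    fun x => ?_, fun _ => ⟨hcd, fun x => by rw [h2]; simpa using h0,
      fun x => by rw [h3]; simpa using h0⟩⟩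
  · rw [hd]; simpa using hK
  · rw [hd]; simp; positivity
  · rw [hd]; simp; positivity

/-- Everything is read off y' = 1 + ε ∂ₓZ(ε, x): passing from ∂ₓZ(ε, x) to ∂ₓZ(0, x) = c s(x) costs
O(ε) by the Lipschitz bound in ε, and so does passing from s(x) to s(y). The higher derivatives of y
are ε times those of Z. Periodicity and a compact range of ε make all constants uniform, and `K`
does not depend on the lower bound `m`. -/
theorem exists_footBounds_of_slope (k : ℕ) {Z : ℝ → ℝ → ℝ}
    (hZ : ContDiff ℝ (2 : ℕ) (Function.uncurry Z))
    (hZ3 : 1 ≤ k → ContDiff ℝ (3 : ℕ) (Function.uncurry Z))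
    (hper : ∀ ε, Function.Periodic (Z ε) 1) {s : ℝ → ℝ} (hs : ContDiff ℝ 1 s)
    (hsper : Function.Periodic s 1) (c : ℝ) (hZ0 : ∀ x, deriv (Z 0) x = c * s x) (E : ℝ) :
    ∃ K : ℝ, 0 ≤ K ∧ ∀ ε ∈ Icc 0 E, ∀ m, 0 < m →
      (∀ x, m ≤ deriv (fun x => x + ε * Z ε x) x) →
      FootBounds k s c m K ε (fun x => x + ε * Z ε x) := by
  have hbd : ∀ j n : ℕ, j ≤ n → ContDiff ℝ n (Function.uncurry Z) →
      ∃ K : ℝ, 0 ≤ K ∧ ∀ ε ∈ Icc 0 E, ∀ x, |iteratedDeriv j (Z ε) x| ≤ K := fun j n hj h =>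
    exists_bound_of_periodic (contDiff_iteratedDeriv_param (m := 0) j h (by omega)).continuous
      (fun ε => (hper ε).iteratedDeriv j) 0 E
  obtain ⟨K₀, hK₀, h0⟩ := hbd 0 2 (by norm_num) hZ
  obtain ⟨K₁, hK₁, h1⟩ := hbd 1 2 (by norm_num) hZ
  obtain ⟨K₂, hK₂, h2⟩ := hbd 2 2 (by norm_num) hZ
  obtain ⟨K₃, hK₃, h3⟩ : ∃ K : ℝ, 0 ≤ K ∧ (1 ≤ k → ∀ ε ∈ Icc 0 E, ∀ x,
      |iteratedDeriv 3 (Z ε) x| ≤ K) := by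
    by_cases hk : 1 ≤ k
    · obtain ⟨K, hK, h⟩ := hbd 3 3 le_rfl (hZ3 hk)
      exact ⟨K, hK, fun _ => h⟩
    · exact ⟨0, le_rfl, fun h => absurd h hk⟩
  obtain ⟨L, hL, hlip⟩ := exists_lipschitz_of_periodic
    (contDiff_iteratedDeriv_param (m := 1) 1 hZ (by norm_num)) (fun ε => (hper ε).iteratedDeriv 1) 0 E
  simp only [iteratedDeriv_one] at hlip h1
  simp only [iteratedDeriv_zero] at h0
  obtain ⟨S, hS, hslip⟩ : ∃ S : ℝ, 0 ≤ S ∧ ∀ x z, |s x - s z| ≤ S * |x - z| := by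
    obtain ⟨S, hS, hb⟩ := exists_bound_of_periodic_one (hs.continuous_deriv le_rfl)
      (by simpa using hsper.iteratedDeriv 1)
    refine ⟨S, hS, fun x z => ?_⟩
    have := Convex.norm_image_sub_le_of_norm_deriv_le (s := univ) (f := s) (C := S) (x := z) (y := x)
      (fun x _ => hs.differentiable (by norm_num) x) (fun x _ => hb x) convex_univ
      (mem_univ _) (mem_univ _)
    simpa using this
  refine ⟨(1 + |E|) * (1 + K₀ + K₁ + K₂ + K₃) + L + |c| * S * K₀, by positivity, ?_⟩
  intro ε hε m hm hge
  set K := (1 + |E|) * (1 + K₀ + K₁ + K₂ + K₃) + L + |c| * S * K₀ with hK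
  have hε0 := hε.1
  have hE0 : 0 ≤ E := hε.1.trans hε.2
  rw [abs_of_nonneg hE0] at hK
  have hsum : 0 ≤ K₀ + K₁ + K₂ + K₃ := by positivity
  have hcS : 0 ≤ |c| * S * K₀ := by positivity
  have hEs : 0 ≤ E * (K₀ + K₁ + K₂ + K₃) := by positivity
  have hKge : 1 + K₀ + K₁ + K₂ + K₃ ≤ K := by
    rw [hK]; nlinarith
  have hKE : ∀ B, 0 ≤ B → B ≤ K₀ + K₁ + K₂ + K₃ → 1 + ε * B ≤ K := fun B hB hBK => by
    have : ε * B ≤ E * (K₀ + K₁ + K₂ + K₃) := mul_le_mul hε.2 hBK hB hE0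
    rw [hK]; nlinarith
  have hZε : ContDiff ℝ (2 : ℕ) (Z ε) := hZ.comp (contDiff_const.prodMk contDiff_id)
  have hZd : Differentiable ℝ (Z ε) := hZε.differentiable (by norm_num)
  have hderiv : deriv (fun x => x + ε * Z ε x) = fun x => 1 + ε * deriv (Z ε) x := by
    funext x
    exact ((hasDerivAt_id x).add ((hZd x).hasDerivAt.const_mul ε)).deriv
  have hcd : ContDiff ℝ (2 : ℕ) (fun x => x + ε * Z ε x) := contDiff_id.add (contDiff_const.mul hZε)
  have hiter : ∀ n : ℕ, 1 ≤ n → ContDiff ℝ (n + 1 : ℕ) (Z ε) → ∀ x,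
      iteratedDeriv (n + 1) (fun x => x + ε * Z ε x) x = ε * iteratedDeriv (n + 1) (Z ε) x := by
    intro n hn hZn x
    have hZn' : ContDiff ℝ n (deriv (Z ε)) := by
      have : ContDiff ℝ (n + 1) (Z ε) := by exact_mod_cast hZn
      exact (contDiff_succ_iff_deriv.1 this).2.2
    rw [iteratedDeriv_succ', hderiv, iteratedDeriv_const_add (by omega),
      iteratedDeriv_const_mul_field, ← iteratedDeriv_succ']
  have hmin : ∀ B, 0 ≤ B → B ≤ K₀ + K₁ + K₂ + K₃ → ∀ z, |z| ≤ B → |ε * z| ≤ min K (K * ε) := by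
    intro B hB hBK z hz
    rw [abs_mul, abs_of_nonneg hε0]
    refine le_min ?_ ?_
    · have := hKE B hB hBK
      have : ε * |z| ≤ ε * B := by gcongr
      linarith
    · rw [mul_comm]
      have : |z| ≤ K := by linarith
      gcongr
  refine ⟨isDegreeOneLift_of_deriv_pos hcd.continuous (fun x => hm.trans_le (hge x))
    (fun x => by rw [hper ε]; ring), hcd.of_le (by norm_num), hge, fun x => ?_, fun x => ?_,
    fun x => ?_, fun hk => ⟨?_, fun x => ?_, fun x => ?_⟩⟩
  · rw [hderiv]
    have h := h1 ε hε x
    calc |1 + ε * deriv (Z ε) x| ≤ 1 + ε * |deriv (Z ε) x| := by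
          refine (abs_add_le _ _).trans ?_
          rw [abs_mul, abs_one, abs_of_nonneg hε0]
      _ ≤ 1 + ε * K₁ := by gcongr
      _ ≤ K := hKE K₁ hK₁ (by linarith)
  · rw [hderiv, add_sub_cancel_left]
    exact (hmin K₁ hK₁ (by linarith) _ (h1 ε hε x)).trans (min_le_right _ _)
  · rw [hderiv, add_sub_cancel_left]
    have e1 : ε * deriv (Z ε) x - ε * c * s (x + ε * Z ε x) =
        ε * (deriv (Z ε) x - deriv (Z 0) x) + ε * c * (s x - s (x + ε * Z ε x)) := by
      rw [hZ0]; ring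
    have e2 := hlip ε hε 0 ⟨le_rfl, hE0⟩ x
    have e3 := hslip x (x + ε * Z ε x)
    rw [sub_zero, abs_of_nonneg hε0] at e2
    rw [sub_add_cancel_left, abs_neg, abs_mul, abs_of_nonneg hε0] at e3
    have e4 := h0 ε hε x
    rw [e1]
    refine (abs_add_le _ _).trans ?_
    rw [abs_mul, abs_mul, abs_mul, abs_of_nonneg hε0]
    calc ε * |deriv (Z ε) x - deriv (Z 0) x| + ε * |c| * |s x - s (x + ε * Z ε x)|
        ≤ ε * (L * ε) + ε * |c| * (S * (ε * K₀)) := by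
          gcongr
          exact e3.trans (by gcongr)
      _ = (L + |c| * S * K₀) * ε ^ 2 := by ring
      _ ≤ K * ε ^ 2 := by
          gcongr
          rw [hK]
          nlinarith
  · have hZ3ε : ContDiff ℝ (3 : ℕ) (Z ε) := (hZ3 hk).comp (contDiff_const.prodMk contDiff_id)
    exact contDiff_id.add (contDiff_const.mul hZ3ε)
  · rw [hiter 1 le_rfl hZε]
    exact hmin K₂ hK₂ (by linarith) _ (h2 ε hε x)
  · rw [hiter 2 (by norm_num) ((hZ3 hk).comp (contDiff_const.prodMk contDiff_id))]
    exact hmin K₃ hK₃ (by linarith) _ (h3 hk ε hε x)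

end Feet

/-! ### The Euler and Platen feet -/

section ConcreteFeet

/-- The feet `y^q_h` of the characteristics of SLDG-`p`. -/
noncomputable def foot (p : ℕ) (b σ : ℝ → ℝ) (h q : ℝ) : ℝ → ℝ :=
  if p = 1 then eulerFoot b σ h q else platenFoot b σ h q

/-- The values `q = -1, 0, 1`. -/
def footIndex : Fin 3 → ℝ := ![-1, 0, 1]

/-- The weights `α_q`, `q = -1, 0, 1`. -/
noncomputable def footWeight (p : ℕ) : Fin 3 → ℝ :=
  if p = 1 then ![1 / 2, 0, 1 / 2] else ![1 / 6, 2 / 3, 1 / 6]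

/-- The coefficient of `σ √h` in `y^q_h`. -/
noncomputable def footCoeff (p : ℕ) (q : ℝ) : ℝ := if p = 1 then q else Real.sqrt 3 * q

/-- The function `Z` such that `y^q_h = x + √h Z(√h, x)`. -/
noncomputable def eulerSlope (b σ : ℝ → ℝ) (q ε x : ℝ) : ℝ := b x * ε + q * σ x

/-- The function `Z` such that `y^q_h = x + √h Z(√h, x)`. -/
noncomputable def platenSlope (b σ : ℝ → ℝ) (q ε x : ℝ) : ℝ :=
  1 / 2 * (b (x + ε * eulerSlope b σ (Real.sqrt 3 * q) ε x) + b x) * ε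
    + 1 / 4 * ((σ (x + ε * eulerSlope b σ 1 ε x) + σ (x + ε * eulerSlope b σ (-1) ε x) + 2 * σ x)
          * Real.sqrt 3 * q
        + (σ (x + ε * eulerSlope b σ 1 ε x) - σ (x + ε * eulerSlope b σ (-1) ε x)) * (3 * q ^ 2 - 1))

/-- The function `Z` such that `y^q_h = x + √h Z(√h, x)`. -/
noncomputable def footSlope (p : ℕ) (b σ : ℝ → ℝ) (q : ℝ) : ℝ → ℝ → ℝ :=
  if p = 1 then eulerSlope b σ q else platenSlope b σ q

variable {p : ℕ} {b σ : ℝ → ℝ}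

theorem eulerFoot_eq {h : ℝ} (hh : 0 ≤ h) (q x : ℝ) :
    eulerFoot b σ h q x = x + Real.sqrt h * eulerSlope b σ q (Real.sqrt h) x := by
  rw [eulerFoot, eulerSlope]
  linear_combination (-(b x)) * Real.mul_self_sqrt hh

theorem foot_eq {h : ℝ} (hh : 0 ≤ h) (q : ℝ) :
    foot p b σ h q = fun x => x + Real.sqrt h * footSlope p b σ q (Real.sqrt h) x := by
  funext x
  rw [foot, footSlope]
  split_ifs
  · exact eulerFoot_eq hh q x
  · rw [platenFoot, platenSlope]
    simp only [eulerFoot_eq hh]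
    linear_combination (-(1 / 2 * (b (x + Real.sqrt h *
      eulerSlope b σ (Real.sqrt 3 * q) (Real.sqrt h) x) + b x))) * Real.mul_self_sqrt hh

theorem contDiff_footSlope {n : ℕ} (hb : ContDiff ℝ n b) (hσ : ContDiff ℝ n σ) (q : ℝ) :
    ContDiff ℝ n (Function.uncurry (footSlope p b σ q)) := by
  rw [footSlope]
  split_ifs
  · unfold Function.uncurry eulerSlope
    fun_prop
  · unfold Function.uncurry platenSlope eulerSlope
    fun_prop

theorem eulerSlope_periodic (hb : Function.Periodic b 1) (hσ : Function.Periodic σ 1) (q ε : ℝ) :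
    Function.Periodic (eulerSlope b σ q ε) 1 := fun x => by
  rw [eulerSlope, eulerSlope, hb, hσ]

theorem footSlope_periodic (hb : Function.Periodic b 1) (hσ : Function.Periodic σ 1) (q ε : ℝ) :
    Function.Periodic (footSlope p b σ q ε) 1 := fun x => by
  rw [footSlope]
  split_ifs
  · exact eulerSlope_periodic hb hσ q ε x
  · simp only [platenSlope, eulerSlope_periodic hb hσ _ _ x, hb x, hσ x, add_right_comm x 1,
      hb _, hσ _]

theorem footSlope_zero (q : ℝ) : footSlope p b σ q 0 = fun x => footCoeff p q * σ x := by
  funext x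
  rw [footSlope, footCoeff]
  split_ifs
  · simp [eulerSlope]
  · simp only [platenSlope, zero_mul, add_zero]
    ring

theorem footWeight_nonneg (p : ℕ) (i : Fin 3) : 0 ≤ footWeight p i := by
  rw [footWeight]
  split_ifs <;> fin_cases i <;> norm_num

theorem sum_footWeight (p : ℕ) : ∑ i, footWeight p i = 1 := by
  rw [footWeight]
  split_ifs <;> simp [Fin.sum_univ_three] <;> norm_num

theorem sum_footWeight_mul_footCoeff (p : ℕ) :
    ∑ i, footWeight p i * footCoeff p (footIndex i) = 0 := by
  rw [footWeight]
  split_ifs with h <;> simp [Fin.sum_univ_three, footCoeff, footIndex, h]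

/-- The Euler scheme is given a third foot of weight zero, so that both schemes are averages over
the same three indices. -/
theorem sldgForm_eq_sum (k M : ℕ) (h : ℝ) (u φ : ℝ → ℝ) :
    sldgForm p k M b σ h u φ = ∑ i, footWeight p i *
      cutQuad k M (foot p b σ h (footIndex i))
        (fun x => u (foot p b σ h (footIndex i) x) * φ x) := by
  rw [sldgForm]
  by_cases hp : p = 1 <;>
    simp [hp, Fin.sum_univ_three, foot, footWeight, footIndex]

theorem hasDerivAt_eulerFoot (hb : Differentiable ℝ b) (hσ : Differentiable ℝ σ) (h q x : ℝ) :
    HasDerivAt (eulerFoot b σ h q) (1 + deriv b x * h + q * deriv σ x * Real.sqrt h) x :=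
  ((hasDerivAt_id x).add ((hb x).hasDerivAt.mul_const h)).add
    (((hσ x).hasDerivAt.const_mul q).mul_const _)

theorem le_deriv_eulerFoot (hb : Differentiable ℝ b) (hσ : Differentiable ℝ σ) {θ h : ℝ}
    (hstep : StepCondition 1 b σ θ h) (i : Fin 3) (x : ℝ) :
    1 - θ ≤ deriv (eulerFoot b σ h (footIndex i)) x := by
  rw [(hasDerivAt_eulerFoot hb hσ h _ x).deriv]
  rw [StepCondition, if_pos rfl] at hstep
  obtain ⟨h1, h2⟩ := hstep x
  rw [abs_le] at h1 h2
  fin_cases i <;> simp [footIndex] <;> linarith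

/-- The Greek variables stand for values of h b', the s's for values of √h σ', and r for √3. Once
β', s₁ and s₂ take their worst values, the first expression is affine in β and in s₀ with
nonnegative coefficients; inserting −B and −S leaves at least 1 − B − 2 S plus nonnegative products.
The first conclusion serves q = ±1, the second q = 0. -/
theorem platen_deriv_lower_bound {r B S θ β β' s₀ s₁ s₂ : ℝ} (hr0 : 1 ≤ r) (hr : r ≤ 2)
    (hBS : B + 3 * S ≤ θ) (hθ : θ < 1) (hβ : |β| ≤ B) (hβ' : |β'| ≤ B) (h0 : |s₀| ≤ S)
    (h1 : |s₁| ≤ S) (h2 : |s₂| ≤ S) :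
    1 - θ ≤ 1 + 1 / 2 * (β' * (1 + β + r * s₀) + β) +
      1 / 4 * (s₁ * (1 + β + s₀) * (r + 2) + s₂ * (1 + β - s₀) * (r - 2) + 2 * r * s₀) ∧
    1 - θ ≤ 1 + 1 / 2 * (β' * (1 + β) + β) -
      1 / 4 * (s₁ * (1 + β + s₀) - s₂ * (1 + β - s₀)) := by
  have hB : 0 ≤ B := (abs_nonneg _).trans hβ
  have hS : 0 ≤ S := (abs_nonneg _).trans h0
  rw [abs_le] at hβ hβ' h0 h1 h2
  have hP : 0 ≤ 1 + β + r * s₀ := by nlinarith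
  have hP1 : 0 ≤ 1 + β + s₀ := by linarith
  have hP2 : 0 ≤ 1 + β - s₀ := by linarith
  have hP0 : 0 ≤ 1 + β := by linarith
  constructor
  · have e1 : -B * (1 + β + r * s₀) ≤ β' * (1 + β + r * s₀) :=
      mul_le_mul_of_nonneg_right hβ'.1 hP
    have e2 : -S * ((1 + β + s₀) * (r + 2)) ≤ s₁ * ((1 + β + s₀) * (r + 2)) :=
      mul_le_mul_of_nonneg_right h1.1 (mul_nonneg hP1 (by linarith))
    have e3 : s₂ * ((1 + β - s₀) * (2 - r)) ≤ S * ((1 + β - s₀) * (2 - r)) :=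
      mul_le_mul_of_nonneg_right h2.2 (mul_nonneg hP2 (by linarith))
    have e4 : -B * (1 / 2 - B / 2 - S) ≤ β * (1 / 2 - B / 2 - S) :=
      mul_le_mul_of_nonneg_right hβ.1 (by linarith)
    have e5 : -S * (r * (1 - B - S)) ≤ s₀ * (r * (1 - B - S)) :=
      mul_le_mul_of_nonneg_right h0.1 (mul_nonneg (by linarith) (by linarith))
    have e6 : S * (r * (1 - B - S)) ≤ S * (2 * 1) := by
      refine mul_le_mul_of_nonneg_left ?_ hS
      exact mul_le_mul hr (by linarith) (by linarith) (by norm_num)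
    nlinarith [mul_nonneg hB hS, mul_nonneg hB hB]
  · have e1 : -B * (1 + β) ≤ β' * (1 + β) := mul_le_mul_of_nonneg_right hβ'.1 hP0
    have e2 : s₁ * (1 + β + s₀) ≤ S * (1 + β + s₀) := mul_le_mul_of_nonneg_right h1.2 hP1
    have e3 : -S * (1 + β - s₀) ≤ s₂ * (1 + β - s₀) := mul_le_mul_of_nonneg_right h2.1 hP2
    have e4 : -B * (1 / 2 - B / 2 - S / 2) ≤ β * (1 / 2 - B / 2 - S / 2) :=
      mul_le_mul_of_nonneg_right hβ.1 (by linarith)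
    nlinarith [mul_nonneg hB hS, mul_nonneg hB hB]

theorem hasDerivAt_platenFoot (hb : Differentiable ℝ b) (hσ : Differentiable ℝ σ) (h q x : ℝ) :
    HasDerivAt (platenFoot b σ h q)
      (1 + 1 / 2 * (deriv b (eulerFoot b σ h (Real.sqrt 3 * q) x) *
            (1 + deriv b x * h + Real.sqrt 3 * q * deriv σ x * Real.sqrt h) + deriv b x) * h
        + 1 / 4 * ((deriv σ (eulerFoot b σ h 1 x) * (1 + deriv b x * h + 1 * deriv σ x * Real.sqrt h)
            + deriv σ (eulerFoot b σ h (-1) x) * (1 + deriv b x * h + -1 * deriv σ x * Real.sqrt h)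
            + 2 * deriv σ x) * Real.sqrt 3 * q
          + (deriv σ (eulerFoot b σ h 1 x) * (1 + deriv b x * h + 1 * deriv σ x * Real.sqrt h)
            - deriv σ (eulerFoot b σ h (-1) x) * (1 + deriv b x * h + -1 * deriv σ x * Real.sqrt h))
            * (3 * q ^ 2 - 1)) * Real.sqrt h) x := by
  have hbc := ((hb _).hasDerivAt).comp x (hasDerivAt_eulerFoot hb hσ h (Real.sqrt 3 * q) x)
  have h1 := ((hσ _).hasDerivAt).comp x (hasDerivAt_eulerFoot hb hσ h 1 x)
  have h2 := ((hσ _).hasDerivAt).comp x (hasDerivAt_eulerFoot hb hσ h (-1) x)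
  exact ((hasDerivAt_id x).add (((hbc.add (hb x).hasDerivAt).const_mul (1 / 2)).mul_const h)).add
    ((((((h1.add h2).add ((hσ x).hasDerivAt.const_mul 2)).mul_const (Real.sqrt 3)).mul_const q).add
      ((h1.sub h2).mul_const (3 * q ^ 2 - 1))).const_mul (1 / 4) |>.mul_const _)

theorem le_deriv_platenFoot (hb : Differentiable ℝ b) (hσ : Differentiable ℝ σ) {θ h : ℝ}
    (hθ : θ < 1) (hh : 0 ≤ h) (hstep : StepCondition 2 b σ θ h) (i : Fin 3) (x : ℝ) :
    1 - θ ≤ deriv (platenFoot b σ h (footIndex i)) x := by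
  rw [(hasDerivAt_platenFoot hb hσ h _ x).deriv]
  rw [StepCondition, if_neg (by norm_num)] at hstep
  set r := Real.sqrt 3 with hr
  have hr1 : 1 ≤ r := Real.one_le_sqrt.2 (by norm_num)
  have hr2 : r ≤ 2 := Real.sqrt_le_iff.2 ⟨by norm_num, by norm_num⟩
  set ε := Real.sqrt h
  have hε : 0 ≤ ε := Real.sqrt_nonneg h
  -- The step condition takes b' and σ' at independent points, so it holds at the points realising
  -- the two maxima.
  have key : ∀ z₁ z₂ z₃ : ℝ, ∃ B S, B + 3 * S ≤ θ ∧ |h * deriv b x| ≤ B ∧ |h * deriv b z₁| ≤ B ∧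
      |ε * deriv σ x| ≤ S ∧ |ε * deriv σ z₂| ≤ S ∧ |ε * deriv σ z₃| ≤ S := by
    intro z₁ z₂ z₃
    refine ⟨max |h * deriv b x| |h * deriv b z₁|,
      max |ε * deriv σ x| (max |ε * deriv σ z₂| |ε * deriv σ z₃|), ?_, le_max_left _ _,
      le_max_right _ _, le_max_left _ _, le_max_of_le_right (le_max_left _ _),
      le_max_of_le_right (le_max_right _ _)⟩
    have hs : ∀ x z, |h * deriv b x| + 3 * |ε * deriv σ z| ≤ θ := fun x z => by
      rw [abs_mul, abs_mul, abs_of_nonneg hh, abs_of_nonneg hε, ← mul_assoc]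
      exact hstep x z
    rcases max_choice |h * deriv b x| |h * deriv b z₁| with h1 | h1 <;>
    rcases max_choice |ε * deriv σ z₂| |ε * deriv σ z₃| with h2 | h2 <;> rw [h1, h2]
    · rcases max_choice |ε * deriv σ x| |ε * deriv σ z₂| with h3 | h3 <;> rw [h3] <;> exact hs _ _
    · rcases max_choice |ε * deriv σ x| |ε * deriv σ z₃| with h3 | h3 <;> rw [h3] <;> exact hs _ _
    · rcases max_choice |ε * deriv σ x| |ε * deriv σ z₂| with h3 | h3 <;> rw [h3] <;> exact hs _ _
    · rcases max_choice |ε * deriv σ x| |ε * deriv σ z₃| with h3 | h3 <;> rw [h3] <;> exact hs _ _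
  obtain ⟨B, S, hBS, hβ, hβ', h0, h1, h2⟩ := key (eulerFoot b σ h (r * footIndex i) x)
    (eulerFoot b σ h 1 x) (eulerFoot b σ h (-1) x)
  fin_cases i
  · simp only [footIndex, Fin.zero_eta, Matrix.cons_val_zero] at hβ' ⊢
    -- Changing q into −q amounts to reversing the sign of σ' and exchanging the two inner feet.
    rw [← abs_neg] at h0 h1 h2
    refine (platen_deriv_lower_bound hr1 hr2 hBS hθ hβ hβ' h0 h2 h1).1.trans (le_of_eq ?_)
    ring
  · simp only [footIndex, Fin.mk_one, Matrix.cons_val_one, Matrix.cons_val_zero] at hβ' ⊢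
    refine (platen_deriv_lower_bound hr1 hr2 hBS hθ hβ hβ' h0 h1 h2).2.trans (le_of_eq ?_)
    ring
  · simp only [footIndex, Fin.reduceFinMk, Matrix.cons_val] at hβ' ⊢
    refine (platen_deriv_lower_bound hr1 hr2 hBS hθ hβ hβ' h0 h1 h2).1.trans (le_of_eq ?_)
    ring

theorem le_deriv_foot (hp : p = 1 ∨ p = 2) (hb : Differentiable ℝ b) (hσ : Differentiable ℝ σ)
    {θ h : ℝ} (hθ : θ < 1) (hh : 0 ≤ h) (hstep : StepCondition p b σ θ h) (i : Fin 3) (x : ℝ) :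
    1 - θ ≤ deriv (foot p b σ h (footIndex i)) x := by
  rcases hp with rfl | rfl
  · exact le_deriv_eulerFoot hb hσ hstep i x
  · exact le_deriv_platenFoot hb hσ hθ hh hstep i x

/-- For the Euler scheme the two signs are averaged, which separates b' from σ'. The purpose is to
bound h itself as soon as some derivative is nonzero. -/
theorem StepCondition.bounds {θ h : ℝ} (hθ : θ < 1) (hh : 0 ≤ h)
    (hstep : StepCondition p b σ θ h) (x : ℝ) :
    h * |deriv b x| ≤ 1 ∧ Real.sqrt h * |deriv σ x| ≤ 1 ∧ 0 ≤ θ := by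
  rw [StepCondition] at hstep
  have hε := Real.sqrt_nonneg h
  split_ifs at hstep
  · obtain ⟨h1, h2⟩ := hstep x
    have h3 : 0 ≤ θ := (abs_nonneg _).trans h1
    rw [abs_le] at h1 h2
    have e1 : h * |deriv b x| = |h * deriv b x| := by rw [abs_mul, abs_of_nonneg hh]
    have e2 : Real.sqrt h * |deriv σ x| = |Real.sqrt h * deriv σ x| := by
      rw [abs_mul, abs_of_nonneg hε]
    rw [e1, e2]
    refine ⟨abs_le.2 ⟨?_, ?_⟩, abs_le.2 ⟨?_, ?_⟩, h3⟩ <;> linarith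
  · have h1 := hstep x x
    have h2 : 0 ≤ h * |deriv b x| := by positivity
    have h3 : 0 ≤ Real.sqrt h * |deriv σ x| := by positivity
    exact ⟨by linarith, by linarith, by linarith⟩

theorem foot_of_const (b₀ σ₀ h q : ℝ) :
    ∃ a, foot p (fun _ => b₀) (fun _ => σ₀) h q = fun x => x + a := by
  rw [foot]
  split_ifs
  · exact ⟨b₀ * h + q * σ₀ * Real.sqrt h, by funext x; rw [eulerFoot]; ring⟩
  · exact ⟨1 / 2 * (b₀ + b₀) * h + 1 / 4 * ((σ₀ + σ₀ + 2 * σ₀) * Real.sqrt 3 * q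
      + (σ₀ - σ₀) * (3 * q ^ 2 - 1)) * Real.sqrt h, by funext x; rw [platenFoot]; ring⟩

/-- The feet of the characteristics satisfy uniform bounds under the step condition. -/
theorem exists_footBounds (k p : ℕ) (hp : p = 1 ∨ p = 2) (hb_per : Function.Periodic b 1)
    (hσ_per : Function.Periodic σ 1) (hb : ContDiff ℝ (max (2 * k + 2) (2 * p) : ℕ) b)
    (hσ : ContDiff ℝ (max (2 * k + 2) (2 * p) : ℕ) σ) {θ : ℝ} (hθ : θ < 1) :
    ∃ K : ℝ, 0 ≤ K ∧ (∀ x, |deriv σ x| ≤ K) ∧ ∀ h, 0 ≤ h → StepCondition p b σ θ h → ∀ i : Fin 3,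
      FootBounds k (deriv σ) (footCoeff p (footIndex i)) (1 - θ) K (Real.sqrt h)
        (foot p b σ h (footIndex i)) := by
  have hn2 : 2 ≤ max (2 * k + 2) (2 * p) := le_max_of_le_left (by omega)
  have hb2 : ContDiff ℝ (2 : ℕ) b := hb.of_le (by exact_mod_cast hn2)
  have hσ2 : ContDiff ℝ (2 : ℕ) σ := hσ.of_le (by exact_mod_cast hn2)
  have hbd : Differentiable ℝ b := hb2.differentiable (by norm_num)
  have hσd : Differentiable ℝ σ := hσ2.differentiable (by norm_num)
  have hσ' : ContDiff ℝ 1 (deriv σ) := by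
    have : ContDiff ℝ (1 + 1) σ := by exact_mod_cast hσ2
    exact (contDiff_succ_iff_deriv.1 this).2.2
  have hσ'per : Function.Periodic (deriv σ) 1 := by simpa using hσ_per.iteratedDeriv 1
  obtain ⟨K₀, hK₀, hK₀b⟩ := exists_bound_of_periodic_one hσ'.continuous hσ'per
  by_cases hconst : (∀ x, deriv b x = 0) ∧ ∀ x, deriv σ x = 0
  -- For constant coefficients the step condition leaves h unbounded, but the feet are then
  -- translations and K = 1 works for every h.
  · obtain ⟨b₀, rfl⟩ : ∃ b₀, b = fun _ => b₀ :=
      ⟨b 0, funext fun x => is_const_of_deriv_eq_zero hbd hconst.1 x 0⟩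
    obtain ⟨σ₀, rfl⟩ : ∃ σ₀, σ = fun _ => σ₀ :=
      ⟨σ 0, funext fun x => is_const_of_deriv_eq_zero hσd hconst.2 x 0⟩
    refine ⟨1, zero_le_one, fun x => by simp, fun h hh hstep i => ?_⟩
    obtain ⟨a, ha⟩ := foot_of_const (p := p) b₀ σ₀ h (footIndex i)
    rw [ha, show deriv (fun _ : ℝ => σ₀) = fun _ => 0 by funext x; simp]
    exact footBounds_translation k _ _ _ _ a (by linarith [(hstep.bounds hθ hh 0).2.2]) le_rfl
      (Real.sqrt_nonneg h)
  -- A nonzero derivative at one point confines √h to a compact interval fixed by the coefficients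
  -- alone, which is why the stability constant does not involve T.
  · obtain ⟨E, hE⟩ : ∃ E, ∀ h, 0 ≤ h → StepCondition p b σ θ h → Real.sqrt h ≤ E := by
      rw [not_and_or] at hconst
      push Not at hconst
      rcases hconst with ⟨x, hx⟩ | ⟨x, hx⟩
      · refine ⟨Real.sqrt (1 / |deriv b x|), fun h hh hstep => Real.sqrt_le_sqrt ?_⟩
        rw [le_div_iff₀ (abs_pos.2 hx)]
        exact (hstep.bounds hθ hh x).1
      · refine ⟨1 / |deriv σ x|, fun h hh hstep => ?_⟩
        rw [le_div_iff₀ (abs_pos.2 hx)]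
        exact (hstep.bounds hθ hh x).2.1
    choose K hK hKb using fun i : Fin 3 => exists_footBounds_of_slope k
      (contDiff_footSlope (p := p) hb2 hσ2 (footIndex i))
      (fun hk => contDiff_footSlope (hb.of_le (by
        exact_mod_cast (le_max_of_le_left (by omega) : 3 ≤ max (2 * k + 2) (2 * p))))
        (hσ.of_le (by
        exact_mod_cast (le_max_of_le_left (by omega) : 3 ≤ max (2 * k + 2) (2 * p)))) _)
      (footSlope_periodic hb_per hσ_per _) hσ' hσ'per (footCoeff p (footIndex i))
      (fun x => by rw [footSlope_zero]; simp) E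
    have hsum : 0 ≤ ∑ i, K i := Finset.sum_nonneg fun i _ => hK i
    refine ⟨K₀ + ∑ i, K i, by positivity, fun x => by linarith [hK₀b x], fun h hh hstep i => ?_⟩
    have hF := hKb i (Real.sqrt h) ⟨Real.sqrt_nonneg h, hE h hh hstep⟩ (1 - θ) (by linarith)
      (fun x => by rw [← foot_eq hh]; exact le_deriv_foot hp hbd hσd hθ hh hstep i x)
    rw [← foot_eq hh] at hF
    refine hF.mono (Real.sqrt_nonneg h) ?_
    have := Finset.single_le_sum (fun i _ => hK i) (Finset.mem_univ i)
    linarith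

end ConcreteFeet

/-! ### Calculus of uniformly smooth families -/

section UniformBounds

variable {ι κ : Type*} {n : ℕ}

/-- A family of `C^n` functions whose derivatives of order at most `n` are uniformly bounded. -/
def UniformCn (n : ℕ) (g : ι → ℝ → ℝ) : Prop :=
  (∀ ω, ContDiff ℝ n (g ω)) ∧ ∃ K : ℝ, 0 ≤ K ∧ ∀ i ≤ n, ∀ ω x, |iteratedDeriv i (g ω) x| ≤ K

theorem UniformCn.of_le {m : ℕ} {g : ι → ℝ → ℝ} (hg : UniformCn n g) (hm : m ≤ n) :
    UniformCn m g := by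
  obtain ⟨h1, K, hK, h2⟩ := hg
  exact ⟨fun ω => (h1 ω).of_le (by exact_mod_cast hm), K, hK, fun i hi => h2 i (hi.trans hm)⟩

theorem UniformCn.reindex {g : ι → ℝ → ℝ} (hg : UniformCn n g) (e : κ → ι) :
    UniformCn n (fun ω => g (e ω)) := by
  obtain ⟨h1, K, hK, h2⟩ := hg
  exact ⟨fun ω => h1 _, K, hK, fun i hi ω => h2 i hi _⟩

theorem uniformCn_zero_iff {g : ι → ℝ → ℝ} :
    UniformCn 0 g ↔ (∀ ω, Continuous (g ω)) ∧ ∃ K : ℝ, 0 ≤ K ∧ ∀ ω x, |g ω x| ≤ K := by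
  simp [UniformCn, contDiff_zero]

theorem uniformCn_succ_iff {g : ι → ℝ → ℝ} :
    UniformCn (n + 1) g ↔ (∀ ω, Differentiable ℝ (g ω)) ∧ UniformCn 0 g ∧
      UniformCn n (fun ω => deriv (g ω)) := by
  constructor
  · intro h
    refine ⟨fun ω => (h.1 ω).differentiable (by norm_cast), h.of_le (Nat.zero_le _), ?_, ?_⟩
    · intro ω
      have : ContDiff ℝ (n + 1) (g ω) := by exact_mod_cast h.1 ω
      exact (contDiff_succ_iff_deriv.1 this).2.2
    · obtain ⟨-, K, hK, h2⟩ := h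
      refine ⟨K, hK, fun i hi ω x => ?_⟩
      rw [← iteratedDeriv_succ']
      exact h2 (i + 1) (by omega) ω x
  · rintro ⟨hd, ⟨-, K₀, hK₀, h0⟩, h1, K, hK, h2⟩
    refine ⟨fun ω => ?_, max K₀ K, le_max_of_le_left hK₀, fun i hi ω x => ?_⟩
    · have : ContDiff ℝ (n + 1) (g ω) :=
        contDiff_succ_iff_deriv.2 ⟨hd ω, by simp, h1 ω⟩
      exact_mod_cast this
    · rcases i with _ | i
      · exact (h0 0 le_rfl ω x).trans (le_max_left _ _)
      · rw [iteratedDeriv_succ']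
        exact (h2 i (by omega) ω x).trans (le_max_right _ _)

theorem UniformCn.add {f g : ι → ℝ → ℝ} (hf : UniformCn n f) (hg : UniformCn n g) :
    UniformCn n (fun ω x => f ω x + g ω x) := by
  obtain ⟨f1, K, hK, f2⟩ := hf
  obtain ⟨g1, L, hL, g2⟩ := hg
  refine ⟨fun ω => (f1 ω).add (g1 ω), K + L, by positivity, fun i hi ω x => ?_⟩
  rw [iteratedDeriv_fun_add ((f1 ω).of_le (by exact_mod_cast hi)).contDiffAt
    ((g1 ω).of_le (by exact_mod_cast hi)).contDiffAt]
  exact (abs_add_le _ _).trans (add_le_add (f2 i hi ω x) (g2 i hi ω x))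

theorem UniformCn.mul : ∀ {n : ℕ} {f g : ι → ℝ → ℝ}, UniformCn n f → UniformCn n g →
    UniformCn n (fun ω x => f ω x * g ω x) := by
  have h0 : ∀ {f g : ι → ℝ → ℝ}, UniformCn 0 f → UniformCn 0 g →
      UniformCn 0 (fun ω x => f ω x * g ω x) := by
    intro f g hf hg
    rw [uniformCn_zero_iff] at *
    obtain ⟨f1, K, hK, f2⟩ := hf
    obtain ⟨g1, L, hL, g2⟩ := hg
    refine ⟨fun ω => (f1 ω).mul (g1 ω), K * L, by positivity, fun ω x => ?_⟩
    rw [abs_mul]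
    exact mul_le_mul (f2 ω x) (g2 ω x) (abs_nonneg _) hK
  intro n
  induction n with
  | zero => exact h0
  | succ n ih =>
    intro f g hf hg
    have hf' := uniformCn_succ_iff.1 hf
    have hg' := uniformCn_succ_iff.1 hg
    refine uniformCn_succ_iff.2 ⟨fun ω => (hf'.1 ω).mul (hg'.1 ω), h0 hf'.2.1 hg'.2.1, ?_⟩
    have h1 := (ih hf'.2.2 (hg.of_le (Nat.le_succ n))).add (ih (hf.of_le (Nat.le_succ n)) hg'.2.2)
    convert h1 using 3 with ω x
    exact deriv_fun_mul (hf'.1 ω x) (hg'.1 ω x)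

theorem uniformCn_const {c : ι → ℝ} {C : ℝ} (hc : ∀ ω, |c ω| ≤ C) :
    UniformCn n (fun ω (_ : ℝ) => c ω) := by
  refine ⟨fun ω => contDiff_const, |C|, abs_nonneg _, fun i _ ω x => ?_⟩
  rw [iteratedDeriv_const]
  split_ifs
  · exact (hc ω).trans (le_abs_self C)
  · simp

theorem UniformCn.const_mul {f : ι → ℝ → ℝ} (hf : UniformCn n f) (c : ℝ) :
    UniformCn n (fun ω x => c * f ω x) :=
  (uniformCn_const (fun _ => le_refl |c|)).mul hf

theorem UniformCn.sub {f g : ι → ℝ → ℝ} (hf : UniformCn n f) (hg : UniformCn n g) :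
    UniformCn n (fun ω x => f ω x - g ω x) := by
  have := hf.add (hg.const_mul (-1))
  simpa [sub_eq_add_neg] using this

/-- Only the derivative of the inner family has to be bounded: feet are unbounded functions on the
line, but their derivatives are not. -/
theorem UniformCn.comp : ∀ {n : ℕ} {g y : ι → ℝ → ℝ}, UniformCn n g →
    (∀ ω, Differentiable ℝ (y ω)) → UniformCn n (fun ω => deriv (y ω)) →
    UniformCn n (fun ω x => g ω (y ω x)) := by
  have h0 : ∀ {g y : ι → ℝ → ℝ}, UniformCn 0 g → (∀ ω, Differentiable ℝ (y ω)) →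
      UniformCn 0 (fun ω x => g ω (y ω x)) := by
    intro g y hg hy
    rw [uniformCn_zero_iff] at *
    obtain ⟨g1, K, hK, g2⟩ := hg
    exact ⟨fun ω => (g1 ω).comp (hy ω).continuous, K, hK, fun ω x => g2 ω _⟩
  intro n
  induction n with
  | zero => exact fun hg hy _ => h0 hg hy
  | succ n ih =>
    intro g y hg hy hy'
    have hg' := uniformCn_succ_iff.1 hg
    refine uniformCn_succ_iff.2 ⟨fun ω => (hg'.1 ω).comp (hy ω), h0 hg'.2.1 hy, ?_⟩
    have h1 := (ih hg'.2.2 hy (hy'.of_le (Nat.le_succ n))).mul (hy'.of_le (Nat.le_succ n))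
    convert h1 using 3 with ω x
    exact deriv_comp x (hg'.1 ω (y ω x)) (hy ω x)

theorem UniformCn.deriv {g : ι → ℝ → ℝ} (hg : UniformCn (n + 1) g) :
    UniformCn n (fun ω => deriv (g ω)) := (uniformCn_succ_iff.1 hg).2.2

theorem UniformCn.generator {b σ : ℝ → ℝ} {r : ℝ} {g : ι → ℝ → ℝ}
    (hb : UniformCn n fun _ : ι => b) (hσ : UniformCn n fun _ : ι => σ)
    (hg : UniformCn (n + 2) g) : UniformCn n (fun ω => generator b σ r (g ω)) := by
  have h1 := UniformCn.deriv (n := n + 1) hg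
  have h2 := h1.deriv
  have h := (((hσ.mul hσ).const_mul (1 / 2)).mul h2).add
    ((hb.mul (h1.of_le (Nat.le_succ n))) |>.sub ((hg.of_le (by omega)).const_mul r))
  convert h using 3 with ω x
  rw [_root_.generator, iteratedDeriv_succ, iteratedDeriv_one]
  ring

theorem uniformCn_of_periodic {F : ℝ → ℝ → ℝ} (hF : ContDiff ℝ n (Function.uncurry F))
    (hper : ∀ s, Function.Periodic (F s) 1) (a c : ℝ) :
    UniformCn n (fun s : Icc a c => F s) := by
  choose K hK hb using fun i : Fin (n + 1) => exists_bound_of_periodic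
    (contDiff_iteratedDeriv_param (m := 0) (i : ℕ) hF (by omega)).continuous
    (fun s => (hper s).iteratedDeriv i) a c
  refine ⟨fun s => hF.comp (contDiff_const.prodMk contDiff_id), ∑ i, K i,
    Finset.sum_nonneg fun i _ => hK i, fun i hi s x => (hb ⟨i, by omega⟩ s s.2 x).trans ?_⟩
  exact Finset.single_le_sum (fun i _ => hK i) (Finset.mem_univ _)

theorem uniformCn_of_periodic_one {g : ℝ → ℝ} (hg : ContDiff ℝ n g)
    (hper : Function.Periodic g 1) : UniformCn n (fun _ : ι => g) :=
  (uniformCn_of_periodic (F := fun _ => g) (hg.comp contDiff_snd) (fun _ => hper) 0 0).reindex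
    (fun _ => ⟨0, le_rfl, le_rfl⟩)

theorem contDiff_deriv_fst {m : ℕ} {F : ℝ → ℝ → ℝ} (hF : ContDiff ℝ n (Function.uncurry F))
    (hm : m + 1 ≤ n) :
    ContDiff ℝ m (Function.uncurry fun s x => _root_.deriv (fun s' => F s' x) s) := by
  have h1 : ContDiff ℝ n (Function.uncurry fun x s => F s x) :=
    hF.comp (contDiff_snd.prodMk contDiff_fst)
  have h2 := contDiff_iteratedDeriv_param (m := m) 1 h1 (by omega)
  simp only [iteratedDeriv_one] at h2
  exact h2.comp (contDiff_snd.prodMk contDiff_fst)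

end UniformBounds

/-! ### Spatial derivatives of functions known only through their time derivative -/

section TimeDerivative

theorem abs_sub_le_of_hasDerivAt {φ φ' : ℝ → ℝ} {t s K : ℝ} (hts : t < s)
    (hc : ContinuousOn φ (Icc t s)) (hd : ∀ τ ∈ Ioo t s, HasDerivAt φ (φ' τ) τ)
    (hK : ∀ τ ∈ Ioo t s, |φ' τ| ≤ K) : |φ s - φ t| ≤ K * (s - t) := by
  obtain ⟨τ, hτ, h⟩ := exists_hasDerivAt_eq_slope φ φ' hts hc hd
  have hpos : 0 < s - t := by linarith
  rw [eq_div_iff hpos.ne'] at h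
  rw [← h, abs_mul, abs_of_pos hpos]
  have := hK τ hτ
  gcongr

/-- Differentiating the evolution in x would require mixed derivatives that are not assumed to
exist. Instead, a difference quotient in x satisfies the same hypotheses, with j spatial derivatives
of G replaced by j + 1 through the mean value inequality; induction gives the bound for the
quotient, and the increment then tends to zero at the two fixed times only. -/
theorem abs_iteratedDeriv_sub_le_of_time_deriv (j : ℕ) : ∀ {v G : ℝ → ℝ → ℝ} {t s K : ℝ}, t < s →
    (∀ x, ContinuousOn (fun τ => v τ x) (Icc t s)) →
    (∀ τ ∈ Ioo t s, ∀ x, HasDerivAt (fun τ => v τ x) (G τ x) τ) →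
    ContDiff ℝ j (v t) → ContDiff ℝ j (v s) → (∀ τ ∈ Ioo t s, ContDiff ℝ j (G τ)) →
    (∀ τ ∈ Ioo t s, ∀ x, |iteratedDeriv j (G τ) x| ≤ K) →
    ∀ x, |iteratedDeriv j (v s) x - iteratedDeriv j (v t) x| ≤ K * (s - t) := by
  induction j with
  | zero =>
    intro v G t s K hts hc hd _ _ _ hK x
    simp only [iteratedDeriv_zero] at hK ⊢
    exact abs_sub_le_of_hasDerivAt hts (hc x) (fun τ hτ => hd τ hτ x) (fun τ hτ => hK τ hτ x)
  | succ j ih =>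
    intro v G t s K hts hc hd hvt hvs hG hK x
    let D : ℝ → (ℝ → ℝ) → ℝ → ℝ := fun e g x => (g (x + e) - g x) / e
    have hD : ∀ (e : ℝ) (g : ℝ → ℝ), ContDiff ℝ j g → ContDiff ℝ j (D e g) := fun e g hg =>
      ((hg.comp (contDiff_id.add contDiff_const)).sub hg).div_const e
    have hDi : ∀ (e : ℝ) (g : ℝ → ℝ), ContDiff ℝ j g → ∀ x,
        iteratedDeriv j (D e g) x = (iteratedDeriv j g (x + e) - iteratedDeriv j g x) / e := by
      intro e g hg x
      have h1 : D e g = fun x => e⁻¹ * ((fun x => g (x + e)) x - g x) := by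
        funext x; simp only [D]; ring
      have h2 : ContDiff ℝ j (fun x => g (x + e)) := hg.comp (contDiff_id.add contDiff_const)
      rw [h1, iteratedDeriv_const_mul_field, iteratedDeriv_fun_sub h2.contDiffAt hg.contDiffAt,
        iteratedDeriv_comp_add_const]
      ring
    have hle : ((j : ℕ) : WithTop ℕ∞) ≤ ((j + 1 : ℕ) : WithTop ℕ∞) := by
      exact_mod_cast Nat.le_succ j
    have hstep : ∀ e : ℝ, e ≠ 0 →
        |(iteratedDeriv j (v s) (x + e) - iteratedDeriv j (v s) x) / e -
          (iteratedDeriv j (v t) (x + e) - iteratedDeriv j (v t) x) / e| ≤ K * (s - t) := by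
      intro e he
      have h := ih (v := fun τ => D e (v τ)) (G := fun τ => D e (G τ)) (K := K) hts
        (fun x => ((hc (x + e)).sub (hc x)).div_const e)
        (fun τ hτ x => ((hd τ hτ (x + e)).sub (hd τ hτ x)).div_const e)
        (hD e _ (hvt.of_le hle)) (hD e _ (hvs.of_le hle))
        (fun τ hτ => hD e _ ((hG τ hτ).of_le hle))
        (fun τ hτ x => by
          rw [hDi e _ ((hG τ hτ).of_le hle), abs_div, div_le_iff₀ (abs_pos.2 he)]
          have h3 := Convex.norm_image_sub_le_of_norm_hasDerivWithin_le (s := univ)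
            (f := iteratedDeriv j (G τ)) (f' := iteratedDeriv (j + 1) (G τ)) (C := K) (x := x)
            (y := x + e) (fun z _ => (hasDerivAt_iteratedDeriv (hG τ hτ)
              (Nat.lt_succ_self j) z).hasDerivWithinAt)
            (fun z _ => hK τ hτ z) convex_univ (mem_univ _) (mem_univ _)
          simpa using h3) x
      rwa [hDi e _ (hvt.of_le hle), hDi e _ (hvs.of_le hle)] at h
    have hlim : ∀ g : ℝ → ℝ, ContDiff ℝ (j + 1 : ℕ) g → Filter.Tendsto
        (fun e => (iteratedDeriv j g (x + e) - iteratedDeriv j g x) / e) (nhdsWithin 0 {0}ᶜ)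
        (nhds (iteratedDeriv (j + 1) g x)) := by
      intro g hg
      have := (hasDerivAt_iteratedDeriv hg (Nat.lt_succ_self j) x).tendsto_slope_zero
      simpa [div_eq_inv_mul] using this
    refine le_of_tendsto ((hlim _ hvs).sub (hlim _ hvt)).abs ?_
    filter_upwards [self_mem_nhdsWithin] with e he
    exact hstep e he

/-- By Rolle, a derivative of a periodic function vanishes somewhere in the period, so over unit
distance it is controlled by the next one. -/
theorem abs_iteratedDeriv_le_of_periodic {j : ℕ} {w : ℝ → ℝ} {B : ℝ} (hw : ContDiff ℝ (j + 2 : ℕ) w)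
    (hper : Function.Periodic w 1) (hB : ∀ x, |iteratedDeriv (j + 2) w x| ≤ B) (x : ℝ) :
    |iteratedDeriv (j + 1) w x| ≤ B := by
  have hd : ∀ x, HasDerivAt (iteratedDeriv j w) (iteratedDeriv (j + 1) w x) x :=
    hasDerivAt_iteratedDeriv hw (by omega)
  obtain ⟨c, hc, hc0⟩ := exists_hasDerivAt_eq_zero (f := iteratedDeriv j w) zero_lt_one
    (fun x _ => (hd x).continuousAt.continuousWithinAt)
    (by simpa using ((hper.iteratedDeriv j) 0).symm) (fun x _ => hd x)
  rw [(hper.iteratedDeriv (j + 1)).eq_fract]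
  have h := Convex.norm_image_sub_le_of_norm_hasDerivWithin_le (s := univ)
    (f := iteratedDeriv (j + 1) w) (f' := iteratedDeriv (j + 2) w) (C := B) (x := c)
    (y := Int.fract x) (fun z _ => (hasDerivAt_iteratedDeriv hw (by omega) z).hasDerivWithinAt)
    (fun z _ => hB z) convex_univ (mem_univ _) (mem_univ _)
  rw [hc0, sub_zero, Real.norm_eq_abs, Real.norm_eq_abs] at h
  have h2 : |Int.fract x - c| ≤ 1 := by
    rw [abs_le]
    constructor <;> linarith [Int.fract_nonneg x, Int.fract_lt_one x, hc.1, hc.2]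
  calc _ ≤ B * |Int.fract x - c| := h
    _ ≤ B * 1 := by
      have : 0 ≤ B := (abs_nonneg _).trans (hB 0)
      gcongr
    _ = B := mul_one B

end TimeDerivative

/-! ### Time regularity of the solution, drawn from the equation -/

section Solution

variable {p : ℕ} {b σ : ℝ → ℝ} {r T : ℝ} {f v : ℝ → ℝ → ℝ}

/-- The hypothesis bounds the top derivative only: the intermediate ones follow by descending with
periodicity, and v itself by compactness. -/
theorem uniformCn_solution {q : ℕ} (hper : ∀ t ∈ Icc (0 : ℝ) T, Function.Periodic (v t) 1)
    (hc : ContinuousOn (Function.uncurry v) (Icc (0 : ℝ) T ×ˢ univ))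
    (hv : HasBoundedXDeriv q T v) : UniformCn q (fun t : Icc (0 : ℝ) T => v t) := by
  obtain ⟨hcd, B, hB⟩ := hv
  obtain ⟨K, hK⟩ := ((isCompact_Icc (a := (0 : ℝ)) (b := T)).prod
    (isCompact_Icc (a := (0 : ℝ)) (b := 1))).exists_bound_of_continuousOn
      (hc.mono (prod_mono_right (subset_univ _)))
  have hderiv : ∀ d i : ℕ, 1 ≤ i → i + d = q → ∀ t ∈ Icc (0 : ℝ) T, ∀ x,
      |iteratedDeriv i (v t) x| ≤ B := by
    intro d
    induction d with
    | zero => intro i _ hi t ht x; rw [show i = q by omega]; exact hB t ht x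
    | succ d ih =>
      intro i hi hid t ht x
      obtain ⟨j, rfl⟩ := Nat.exists_eq_add_of_le' hi
      exact abs_iteratedDeriv_le_of_periodic
        ((hcd t ht).of_le (by exact_mod_cast (by omega : j + 2 ≤ q))) (hper t ht)
        (ih (j + 2) (by omega) (by omega) t ht) x
  refine ⟨fun t => hcd t t.2, max |K| |B|, le_max_of_le_left (abs_nonneg K), fun i hi t x => ?_⟩
  rcases i with _ | i
  · rw [iteratedDeriv_zero]
    beta_reduce
    rw [(hper t t.2).eq_fract]
    exact ((hK (t, Int.fract x) ⟨t.2, Int.fract_nonneg x, (Int.fract_lt_one x).le⟩).trans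
      (le_abs_self K)).trans (le_max_left _ _)
  · exact ((hderiv (q - (i + 1)) (i + 1) (by omega) (by omega) t t.2 x).trans
      (le_abs_self B)).trans (le_max_right _ _)

/-- Pairs of times `t < s` in `[0, T]`. -/
abbrev TimePair (T : ℝ) : Type := {ω : ℝ × ℝ // 0 ≤ ω.1 ∧ ω.1 < ω.2 ∧ ω.2 ≤ T}

/-- Difference quotients in time. -/
noncomputable def diffQuot (T : ℝ) (v : ℝ → ℝ → ℝ) (ω : TimePair T) (x : ℝ) : ℝ :=
  (ω.1.2 - ω.1.1)⁻¹ * (v ω.1.2 x - v ω.1.1 x)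

theorem iteratedDeriv_diffQuot {m i : ℕ} (hv : ∀ t ∈ Icc (0 : ℝ) T, ContDiff ℝ m (v t))
    (hi : i ≤ m) (ω : TimePair T) (x : ℝ) :
    iteratedDeriv i (diffQuot T v ω) x = (ω.1.2 - ω.1.1)⁻¹ *
      (iteratedDeriv i (v ω.1.2) x - iteratedDeriv i (v ω.1.1) x) := by
  obtain ⟨⟨t, s⟩, ht, hts, hs⟩ := ω
  have hle : ((i : ℕ) : WithTop ℕ∞) ≤ (m : ℕ) := by exact_mod_cast hi
  unfold diffQuot
  rw [iteratedDeriv_const_mul_field, iteratedDeriv_fun_sub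
    ((hv s ⟨by linarith, hs⟩).of_le hle).contDiffAt
    ((hv t ⟨ht, by linarith⟩).of_le hle).contDiffAt]

/-- Lipschitz dependence on time becomes a uniform bound for a family, so that the calculus of such
families, and the generator in particular, applies to it. -/
theorem uniformCn_diffQuot_iff {m : ℕ} (hv : ∀ t ∈ Icc (0 : ℝ) T, ContDiff ℝ m (v t)) :
    UniformCn m (diffQuot T v) ↔ ∃ K : ℝ, 0 ≤ K ∧ ∀ i ≤ m, ∀ t s, 0 ≤ t → t < s → s ≤ T → ∀ x,
      |iteratedDeriv i (v s) x - iteratedDeriv i (v t) x| ≤ K * (s - t) := by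
  constructor
  · rintro ⟨-, K, hK, h⟩
    refine ⟨K, hK, fun i hi t s ht hts hs x => ?_⟩
    have h1 := h i hi ⟨(t, s), ht, hts, hs⟩ x
    have hpos : 0 < s - t := by linarith
    rwa [iteratedDeriv_diffQuot hv hi, abs_mul, abs_inv, abs_of_pos hpos,
      inv_mul_le_iff₀ hpos, mul_comm] at h1
  · rintro ⟨K, hK, h⟩
    refine ⟨fun ω => ?_, K, hK, fun i hi ω x => ?_⟩
    · obtain ⟨⟨t, s⟩, ht, hts, hs⟩ := ω
      exact contDiff_const.mul ((hv s ⟨by dsimp only at *; linarith, hs⟩).sub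
        (hv t ⟨ht, by dsimp only at *; linarith⟩))
    · rw [iteratedDeriv_diffQuot hv hi]
      obtain ⟨⟨t, s⟩, ht, hts, hs⟩ := ω
      dsimp only at *
      have hpos : 0 < s - t := by linarith
      rw [abs_mul, abs_inv, abs_of_pos hpos, inv_mul_le_iff₀ hpos, mul_comm]
      exact h i hi t s ht hts hs x

theorem uniformCn_diffQuot_of_contDiff {m : ℕ} (hf : ContDiff ℝ (m + 1 : ℕ) (Function.uncurry f))
    (hper : ∀ t, Function.Periodic (f t) 1) : UniformCn m (diffQuot T f) := by
  have hft : ∀ t, ContDiff ℝ (m + 1 : ℕ) (f t) := fun t => hf.comp (contDiff_const.prodMk contDiff_id)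
  rw [uniformCn_diffQuot_iff fun t _ => (hft t).of_le (by exact_mod_cast Nat.le_succ m)]
  choose L hL hlip using fun i : Fin (m + 1) => exists_lipschitz_of_periodic
    (contDiff_iteratedDeriv_param (m := 1) (i : ℕ) hf (by omega))
    (fun s => (hper s).iteratedDeriv i) 0 T
  refine ⟨∑ i, L i, Finset.sum_nonneg fun i _ => hL i, fun i hi t s ht hts hs x => ?_⟩
  have h := hlip ⟨i, by omega⟩ s ⟨by linarith, hs⟩ t ⟨ht, by linarith⟩ x
  rw [abs_of_pos (by linarith : 0 < s - t)] at h
  refine h.trans (mul_le_mul_of_nonneg_right ?_ (by linarith))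
  exact Finset.single_le_sum (fun i _ => hL i) (Finset.mem_univ _)

/-- The time derivative of the solution, `A v + f`. -/
noncomputable def timeDeriv (b σ : ℝ → ℝ) (r : ℝ) (f v : ℝ → ℝ → ℝ) (t x : ℝ) : ℝ :=
  generator b σ r (v t) x + f t x

/-- The second time derivative of the solution, `A (A v + f) + f_t`. -/
noncomputable def timeDeriv₂ (b σ : ℝ → ℝ) (r : ℝ) (f v : ℝ → ℝ → ℝ) (t x : ℝ) : ℝ :=
  generator b σ r (timeDeriv b σ r f v t) x + deriv (fun s => f s x) t

theorem generator_const_mul_sub {c : ℝ} {w z : ℝ → ℝ} (hw : ContDiff ℝ (2 : ℕ) w)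
    (hz : ContDiff ℝ (2 : ℕ) z) (x : ℝ) :
    generator b σ r (fun x => c * (w x - z x)) x =
      c * (generator b σ r w x - generator b σ r z x) := by
  have h1 : iteratedDeriv 1 (fun x => c * (w x - z x)) x =
      c * (iteratedDeriv 1 w x - iteratedDeriv 1 z x) := by
    rw [iteratedDeriv_const_mul_field, iteratedDeriv_fun_sub
      (hw.of_le (by norm_num)).contDiffAt (hz.of_le (by norm_num)).contDiffAt]
  have h2 : iteratedDeriv 2 (fun x => c * (w x - z x)) x =
      c * (iteratedDeriv 2 w x - iteratedDeriv 2 z x) := by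
    rw [iteratedDeriv_const_mul_field, iteratedDeriv_fun_sub hw.contDiffAt hz.contDiffAt]
  simp only [iteratedDeriv_one] at h1
  simp only [generator]
  rw [h1, h2]
  ring

theorem IsPeriodicSolution.continuousOn_time (hsol : IsPeriodicSolution b σ r f T v) {t s : ℝ}
    (ht : 0 ≤ t) (hs : s ≤ T) (x : ℝ) : ContinuousOn (fun τ => v τ x) (Icc t s) :=
  hsol.continuousOn.comp (f := fun τ : ℝ => (τ, x)) (by fun_prop) fun τ hτ =>
    ⟨⟨ht.trans hτ.1, hτ.2.trans hs⟩, mem_univ _⟩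

theorem IsPeriodicSolution.hasDerivAt (hsol : IsPeriodicSolution b σ r f T v) {t s : ℝ}
    (ht : 0 ≤ t) (hs : s ≤ T) (x : ℝ) {τ : ℝ} (hτ : τ ∈ Ioo t s) :
    HasDerivAt (fun τ => v τ x) (timeDeriv b σ r f v τ x) τ :=
  hsol.pde τ ⟨ht.trans_lt hτ.1, hτ.2.trans_le hs⟩ x

/-- Regular data and a regular classical solution on `[0, T]`. -/
structure IsRegularSolution (p : ℕ) (b σ : ℝ → ℝ) (r T : ℝ) (f v : ℝ → ℝ → ℝ) : Prop where
  contDiff_b : ContDiff ℝ (2 * p : ℕ) b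
  contDiff_σ : ContDiff ℝ (2 * p : ℕ) σ
  periodic_b : Function.Periodic b 1
  periodic_σ : Function.Periodic σ 1
  contDiff_f : ContDiff ℝ (2 * p : ℕ) (Function.uncurry f)
  periodic_f : ∀ t, Function.Periodic (f t) 1
  solution : IsPeriodicSolution b σ r f T v
  uniformCn : UniformCn (2 * p + 2) (fun t : Icc (0 : ℝ) T => v t)

namespace IsRegularSolution

theorem contDiff_v (H : IsRegularSolution p b σ r T f v) :
    ∀ t ∈ Icc (0 : ℝ) T, ContDiff ℝ (2 * p + 2 : ℕ) (v t) := fun t ht => H.uniformCn.1 ⟨t, ht⟩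

theorem uniformCn_timeDeriv (H : IsRegularSolution p b σ r T f v) :
    UniformCn (2 * p) (fun t : Icc (0 : ℝ) T => timeDeriv b σ r f v t) :=
  (UniformCn.generator (uniformCn_of_periodic_one H.contDiff_b H.periodic_b)
    (uniformCn_of_periodic_one H.contDiff_σ H.periodic_σ) H.uniformCn).add
    (uniformCn_of_periodic H.contDiff_f H.periodic_f 0 T)

theorem contDiff_timeDeriv (H : IsRegularSolution p b σ r T f v) :
    ∀ t ∈ Icc (0 : ℝ) T, ContDiff ℝ (2 * p : ℕ) (timeDeriv b σ r f v t) :=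
  fun t ht => H.uniformCn_timeDeriv.1 ⟨t, ht⟩

theorem uniformCn_diffQuot (H : IsRegularSolution p b σ r T f v) :
    UniformCn (2 * p) (diffQuot T v) := by
  rw [uniformCn_diffQuot_iff fun t ht => (H.contDiff_v t ht).of_le (by norm_cast; omega)]
  obtain ⟨hG, K, hK, hb⟩ := H.uniformCn_timeDeriv
  refine ⟨K, hK, fun i hi t s ht hts hs => ?_⟩
  have hle : ((i : ℕ) : WithTop ℕ∞) ≤ (2 * p : ℕ) := by exact_mod_cast hi
  have hle' : ((i : ℕ) : WithTop ℕ∞) ≤ (2 * p + 2 : ℕ) := by norm_cast; omega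
  exact abs_iteratedDeriv_sub_le_of_time_deriv i hts
    (fun x => H.solution.continuousOn_time ht hs x)
    (fun τ hτ x => H.solution.hasDerivAt ht hs x hτ)
    ((H.contDiff_v t ⟨ht, by linarith⟩).of_le hle') ((H.contDiff_v s ⟨by linarith, hs⟩).of_le hle')
    (fun τ hτ => (H.contDiff_timeDeriv τ ⟨by linarith [hτ.1], by linarith [hτ.2]⟩).of_le hle)
    (fun τ hτ x => hb i hi ⟨τ, by linarith [hτ.1], by linarith [hτ.2]⟩ x)

/-- By linearity, the difference quotient of A v + f is A applied to that of v, plus that of f. The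
generator consumes two spatial derivatives. -/
theorem uniformCn_diffQuot_timeDeriv (H : IsRegularSolution p b σ r T f v) {m : ℕ}
    (hm : m + 2 = 2 * p) : UniformCn m (diffQuot T (timeDeriv b σ r f v)) := by
  have h1 : UniformCn (m + 2) (diffQuot T v) := hm ▸ H.uniformCn_diffQuot
  have hle : ((m : ℕ) : WithTop ℕ∞) ≤ (2 * p : ℕ) := by norm_cast; omega
  have h2 := (UniformCn.generator (r := r)
    (uniformCn_of_periodic_one (H.contDiff_b.of_le hle) H.periodic_b)
    (uniformCn_of_periodic_one (H.contDiff_σ.of_le hle) H.periodic_σ) h1).add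
    (uniformCn_diffQuot_of_contDiff (T := T)
      (H.contDiff_f.of_le (by norm_cast; omega)) H.periodic_f)
  convert h2 using 3 with ω x
  have hle2 : ((2 : ℕ) : WithTop ℕ∞) ≤ (2 * p + 2 : ℕ) := by norm_cast; omega
  obtain ⟨⟨t, s⟩, ht, hts, hs⟩ := ω
  dsimp only at ht hts hs
  have h3 := generator_const_mul_sub (b := b) (σ := σ) (r := r) (c := (s - t)⁻¹)
    ((H.contDiff_v s ⟨by linarith, hs⟩).of_le hle2) ((H.contDiff_v t ⟨ht, by linarith⟩).of_le hle2) x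
  simp only [diffQuot, timeDeriv]
  change _ = generator b σ r (fun x => (s - t)⁻¹ * (v s x - v t x)) x + _
  rw [h3]
  ring

/-- Subtract from v(τ) its tangent at t: what remains has time derivative G(τ) − G(t), which is O(s
− t). Since G is defined by the right-hand side of the equation, the expansion is available at t = 0
too, where v need not be differentiable in time. -/
theorem exists_first_order (H : IsRegularSolution p b σ r T f v) {m : ℕ} (hm : m + 2 = 2 * p) :
    ∃ K : ℝ, 0 ≤ K ∧ ∀ i ≤ m, ∀ t s, 0 ≤ t → t < s → s ≤ T → ∀ x,
      |iteratedDeriv i (v s) x - iteratedDeriv i (v t) x -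
        (s - t) * iteratedDeriv i (timeDeriv b σ r f v t) x| ≤ K * (s - t) ^ 2 := by
  set G := timeDeriv b σ r f v with hG
  have hlem : ((m : ℕ) : WithTop ℕ∞) ≤ (2 * p : ℕ) := by norm_cast; omega
  obtain ⟨K, hK, hlip⟩ := (uniformCn_diffQuot_iff
    fun t ht => (H.contDiff_timeDeriv t ht).of_le hlem).1 (H.uniformCn_diffQuot_timeDeriv hm)
  refine ⟨K, hK, fun i hi t s ht hts hs x => ?_⟩
  have hle : ((i : ℕ) : WithTop ℕ∞) ≤ (2 * p : ℕ) := by norm_cast; omega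
  have hle' : ((i : ℕ) : WithTop ℕ∞) ≤ (2 * p + 2 : ℕ) := by norm_cast; omega
  have hGc : ∀ τ ∈ Icc (0 : ℝ) T, ContDiff ℝ i (G τ) := fun τ hτ =>
    (H.contDiff_timeDeriv τ hτ).of_le hle
  have hvc : ∀ τ ∈ Icc (0 : ℝ) T, ContDiff ℝ i (v τ) := fun τ hτ => (H.contDiff_v τ hτ).of_le hle'
  have htm : t ∈ Icc (0 : ℝ) T := ⟨ht, by linarith⟩
  have hsm : s ∈ Icc (0 : ℝ) T := ⟨by linarith, hs⟩
  have hw : ∀ τ ∈ Icc (0 : ℝ) T, ContDiff ℝ i (fun x => v τ x - (τ - t) * G t x) := fun τ hτ =>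
    (hvc τ hτ).sub (contDiff_const.mul (hGc t htm))
  have hwi : ∀ τ ∈ Icc (0 : ℝ) T, ∀ x, iteratedDeriv i (fun x => v τ x - (τ - t) * G t x) x =
      iteratedDeriv i (v τ) x - (τ - t) * iteratedDeriv i (G t) x := fun τ hτ x => by
    have h1 : ContDiff ℝ i (fun x => (τ - t) * G t x) := contDiff_const.mul (hGc t htm)
    rw [iteratedDeriv_fun_sub (hvc τ hτ).contDiffAt h1.contDiffAt, iteratedDeriv_const_mul_field]
  have h := abs_iteratedDeriv_sub_le_of_time_deriv i (v := fun τ x => v τ x - (τ - t) * G t x)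
    (G := fun τ x => G τ x - G t x) (K := K * (s - t)) hts
    (fun x => (H.solution.continuousOn_time ht hs x).sub (by fun_prop))
    (fun τ hτ x => by
      have h1 := (H.solution.hasDerivAt ht hs x hτ).sub
        (((hasDerivAt_id τ).sub_const t).mul_const (G t x))
      rw [one_mul] at h1
      exact h1)
    (hw t htm) (hw s hsm)
    (fun τ hτ => (hGc τ ⟨by linarith [hτ.1], by linarith [hτ.2]⟩).sub (hGc t htm))
    (fun τ hτ x => by
      have hτm : τ ∈ Icc (0 : ℝ) T := ⟨by linarith [hτ.1], by linarith [hτ.2]⟩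
      rw [iteratedDeriv_fun_sub (hGc τ hτm).contDiffAt (hGc t htm).contDiffAt]
      refine (hlip i hi t τ ht hτ.1 hτm.2 x).trans ?_
      have := hτ.2
      gcongr) x
  rw [hwi s hsm, hwi t htm] at h
  refine (le_of_eq (congrArg abs ?_)).trans (h.trans (le_of_eq ?_)) <;> ring

/-- The first order expansions of v, v_x and v_xx enter A linearly and give one for v_t = A v + f,
which is then integrated once in time. -/
theorem exists_second_order (H : IsRegularSolution 2 b σ r T f v) :
    ∃ K : ℝ, 0 ≤ K ∧ ∀ t s, 0 ≤ t → t < s → s ≤ T → ∀ x,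
      |v s x - v t x - (s - t) * timeDeriv b σ r f v t x -
        (s - t) ^ 2 / 2 * timeDeriv₂ b σ r f v t x| ≤ K * (s - t) ^ 3 := by
  obtain ⟨K, hK, h1⟩ := H.exists_first_order (m := 2) rfl
  obtain ⟨B, hB, hbB⟩ := exists_bound_of_periodic_one H.contDiff_b.continuous H.periodic_b
  obtain ⟨S, hS, hσS⟩ := exists_bound_of_periodic_one H.contDiff_σ.continuous H.periodic_σ
  have hft := contDiff_deriv_fst (m := 1) H.contDiff_f (by norm_num)
  obtain ⟨L, hL, hlip⟩ := exists_lipschitz_of_periodic hft (fun s x => by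
    simp only [H.periodic_f _ x]) 0 T
  have hfd : ∀ x τ, HasDerivAt (fun s => f s x) (deriv (fun s => f s x) τ) τ := fun x τ => by
    have : ContDiff ℝ (2 * 2 : ℕ) (fun s => f s x) :=
      H.contDiff_f.comp (contDiff_id.prodMk contDiff_const)
    exact (this.differentiable (by norm_num) τ).hasDerivAt
  have hf2 : ∀ t s, 0 ≤ t → t < s → s ≤ T → ∀ x,
      |f s x - f t x - (s - t) * deriv (fun s => f s x) t| ≤ L * (s - t) ^ 2 := by
    intro t s ht hts hs x
    have h := abs_sub_le_of_hasDerivAt (φ := fun τ => f τ x - (τ - t) * deriv (fun s => f s x) t)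
      (φ' := fun τ => deriv (fun s => f s x) τ - deriv (fun s => f s x) t) (K := L * (s - t)) hts
      (fun τ _ => ((hfd x τ).continuousAt.sub (by fun_prop)).continuousWithinAt)
      (fun τ _ => by
        have := (hfd x τ).sub (((hasDerivAt_id τ).sub_const t).mul_const (deriv (fun s => f s x) t))
        rw [one_mul] at this
        exact this)
      (fun τ hτ => by
        have := hlip τ ⟨by linarith [hτ.1], by linarith [hτ.2]⟩ t ⟨ht, by linarith⟩ x
        rw [abs_of_pos (by linarith [hτ.1] : 0 < τ - t)] at this
        refine this.trans ?_
        have := hτ.2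
        gcongr)
    refine (le_of_eq (congrArg abs ?_)).trans (h.trans (le_of_eq ?_)) <;> ring
  have hG2 : ∀ t s, 0 ≤ t → t < s → s ≤ T → ∀ x,
      |timeDeriv b σ r f v s x - timeDeriv b σ r f v t x - (s - t) * timeDeriv₂ b σ r f v t x| ≤
        (S ^ 2 / 2 * K + B * K + |r| * K + L) * (s - t) ^ 2 := by
    intro t s ht hts hs x
    have e0 := h1 0 (by norm_num) t s ht hts hs x
    have e1 := h1 1 (by norm_num) t s ht hts hs x
    have e2 := h1 2 (by norm_num) t s ht hts hs x
    have e3 := hf2 t s ht hts hs x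
    simp only [iteratedDeriv_zero, iteratedDeriv_one] at e0 e1
    set D0 := v s x - v t x - (s - t) * timeDeriv b σ r f v t x
    set D1 := deriv (v s) x - deriv (v t) x - (s - t) * deriv (timeDeriv b σ r f v t) x
    set D2 := iteratedDeriv 2 (v s) x - iteratedDeriv 2 (v t) x -
      (s - t) * iteratedDeriv 2 (timeDeriv b σ r f v t) x
    set D3 := f s x - f t x - (s - t) * deriv (fun s => f s x) t
    have e : timeDeriv b σ r f v s x - timeDeriv b σ r f v t x -
        (s - t) * timeDeriv₂ b σ r f v t x = σ x ^ 2 / 2 * D2 + b x * D1 + -r * D0 + D3 := by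
      simp only [D0, D1, D2, D3]
      rw [timeDeriv₂]
      simp only [generator]
      rw [show timeDeriv b σ r f v s x = generator b σ r (v s) x + f s x from rfl,
        show timeDeriv b σ r f v t x = generator b σ r (v t) x + f t x from rfl]
      simp only [generator]
      ring
    rw [e]
    have a2 : |σ x ^ 2 / 2 * D2| ≤ S ^ 2 / 2 * (K * (s - t) ^ 2) := by
      rw [abs_mul, abs_div, abs_pow, abs_two]
      have := hσS x
      gcongr
    have a1 : |b x * D1| ≤ B * (K * (s - t) ^ 2) := by
      rw [abs_mul]; have := hbB x; gcongr
    have a0 : |-r * D0| ≤ |r| * (K * (s - t) ^ 2) := by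
      rw [abs_mul, abs_neg]; gcongr
    calc _ ≤ |σ x ^ 2 / 2 * D2| + |b x * D1| + |-r * D0| + |D3| :=
          (abs_add_le _ _).trans (add_le_add ((abs_add_le _ _).trans
            (add_le_add (abs_add_le _ _) le_rfl)) le_rfl)
      _ ≤ _ := by linarith
  refine ⟨S ^ 2 / 2 * K + B * K + |r| * K + L, by positivity, fun t s ht hts hs x => ?_⟩
  have h := abs_sub_le_of_hasDerivAt
    (φ := fun τ => v τ x - (τ - t) * timeDeriv b σ r f v t x -
      (τ - t) ^ 2 / 2 * timeDeriv₂ b σ r f v t x)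
    (φ' := fun τ => timeDeriv b σ r f v τ x - timeDeriv b σ r f v t x -
      (τ - t) * timeDeriv₂ b σ r f v t x)
    (K := (S ^ 2 / 2 * K + B * K + |r| * K + L) * (s - t) ^ 2) hts
    (((H.solution.continuousOn_time ht hs x).sub (by fun_prop)).sub (by fun_prop))
    (fun τ hτ => by
      have h2 := ((H.solution.hasDerivAt ht hs x hτ).sub
        (((hasDerivAt_id τ).sub_const t).mul_const (timeDeriv b σ r f v t x))).sub
        (((((hasDerivAt_id τ).sub_const t).pow 2).div_const 2).mul_const
          (timeDeriv₂ b σ r f v t x))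
      refine h2.congr_deriv ?_
      simp only [id]
      push_cast
      ring)
    (fun τ hτ => by
      refine (hG2 t τ ht hτ.1 (hτ.2.le.trans hs) x).trans ?_
      have := hτ.2
      have := hτ.1
      have : 0 ≤ τ - t := by linarith
      gcongr)
  refine (le_of_eq (congrArg abs ?_)).trans (h.trans (le_of_eq ?_)) <;> ring

end IsRegularSolution

end Solution

/-! ### Calculus of uniform orders in ε -/

section Order

variable {α : Type*} {E : ℝ} {n m : ℕ} {F G : ℝ → α → ℝ}

/-- `F ε a = O(ε^n)`, uniformly in `0 ≤ ε ≤ E` and in the parameter `a`. -/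
def IsOrder (E : ℝ) (n : ℕ) (F : ℝ → α → ℝ) : Prop :=
  ∃ K : ℝ, 0 ≤ K ∧ ∀ ε ∈ Icc 0 E, ∀ a, |F ε a| ≤ K * ε ^ n

namespace IsOrder

theorem congr (hF : IsOrder E n F) (h : ∀ ε a, G ε a = F ε a) : IsOrder E n G := by
  obtain ⟨K, hK, hF⟩ := hF
  exact ⟨K, hK, fun ε hε a => by rw [h]; exact hF ε hε a⟩

theorem add (hF : IsOrder E n F) (hG : IsOrder E n G) : IsOrder E n (fun ε a => F ε a + G ε a) := by
  obtain ⟨K, hK, hF⟩ := hF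
  obtain ⟨L, hL, hG⟩ := hG
  refine ⟨K + L, by positivity, fun ε hε a => (abs_add_le _ _).trans ?_⟩
  rw [add_mul]
  exact add_le_add (hF ε hε a) (hG ε hε a)

theorem mul' (hF : IsOrder E n F) (hG : IsOrder E m G) :
    IsOrder E (n + m) (fun ε a => F ε a * G ε a) := by
  obtain ⟨K, hK, hF⟩ := hF
  obtain ⟨L, hL, hG⟩ := hG
  refine ⟨K * L, by positivity, fun ε hε a => ?_⟩
  rw [abs_mul]
  have h0 := hε.1
  calc _ ≤ (K * ε ^ n) * (L * ε ^ m) :=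
        mul_le_mul (hF ε hε a) (hG ε hε a) (abs_nonneg _) (by positivity)
    _ = _ := by ring

theorem of_le (hF : IsOrder E m F) (h : n ≤ m) : IsOrder E n F := by
  obtain ⟨K, hK, hF⟩ := hF
  refine ⟨K * |E| ^ (m - n), by positivity, fun ε hε a => (hF ε hε a).trans ?_⟩
  have h0 := hε.1
  have h1 : ε ≤ |E| := hε.2.trans (le_abs_self E)
  calc K * ε ^ m = K * (ε ^ (m - n) * ε ^ n) := by rw [← pow_add, Nat.sub_add_cancel h]
    _ ≤ K * (|E| ^ (m - n) * ε ^ n) := by gcongr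
    _ = _ := by ring

theorem of_bound {f : α → ℝ} {K : ℝ} (h : ∀ a, |f a| ≤ K) : IsOrder E 0 (fun _ a => f a) :=
  ⟨|K|, abs_nonneg _, fun ε _ a => by simpa using (h a).trans (le_abs_self K)⟩

theorem const (c : ℝ) : IsOrder E 0 (fun _ (_ : α) => c) := of_bound (fun _ => le_refl |c|)

theorem eps : IsOrder E 1 (fun ε (_ : α) => ε) :=
  ⟨1, zero_le_one, fun ε hε a => by rw [abs_of_nonneg hε.1]; simp⟩

theorem eps₀ : IsOrder E 0 (fun ε (_ : α) => ε) := eps.of_le zero_le_one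

theorem mul (hF : IsOrder E 0 F) (hG : IsOrder E 0 G) : IsOrder E 0 (fun ε a => F ε a * G ε a) :=
  hF.mul' hG

theorem const_mul (c : ℝ) (hF : IsOrder E n F) : IsOrder E n (fun ε a => c * F ε a) := by
  simpa using (const c).mul' hF

theorem bdd_mul (hG : IsOrder E 0 G) (hF : IsOrder E n F) : IsOrder E n (fun ε a => G ε a * F ε a) := by
  simpa using hG.mul' hF

theorem div_const (hF : IsOrder E n F) (c : ℝ) : IsOrder E n (fun ε a => F ε a / c) :=
  (hF.const_mul c⁻¹).congr fun ε a => by ring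

theorem sub (hF : IsOrder E n F) (hG : IsOrder E n G) : IsOrder E n (fun ε a => F ε a - G ε a) :=
  (hF.add (hG.const_mul (-1))).congr fun ε a => by ring

theorem pow' (hF : IsOrder E n F) (m : ℕ) : IsOrder E (n * m) (fun ε a => F ε a ^ m) := by
  induction m with
  | zero => simpa using const (α := α) (E := E) 1
  | succ m ih =>
    rw [Nat.mul_succ]
    exact (ih.mul' hF).congr fun ε a => by ring

theorem pow (hF : IsOrder E 0 F) (m : ℕ) : IsOrder E 0 (fun ε a => F ε a ^ m) := by
  simpa using hF.pow' m

theorem eps_mul (n : ℕ) (hF : IsOrder E 0 F) : IsOrder E n (fun ε a => ε ^ n * F ε a) := by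
  simpa using (eps.pow' n).mul' hF

/-- Telescoping: each further factor F or G brings one more ε, so an approximation of an increment
improves when it is raised to a power. -/
theorem pow_sub_pow {l : ℕ} (hF : IsOrder E 1 F) (hG : IsOrder E 1 G)
    (h : IsOrder E (l + 1) (fun ε a => F ε a - G ε a)) (m : ℕ) :
    IsOrder E (l + m) (fun ε a => F ε a ^ m - G ε a ^ m) := by
  induction m with
  | zero => exact ((const 0).eps_mul l).congr fun ε a => by simp
  | succ m ih =>
    have h1 := ((hF.pow' m).mul' h).of_le (n := l + (m + 1)) (by omega)
    have h2 := (ih.mul' hG).of_le (n := l + (m + 1)) (by omega)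
    exact (h1.add h2).congr fun ε a => by ring

end IsOrder

theorem UniformCn.isOrder {ι : Type*} {g : ι → ℝ → ℝ} (hg : UniformCn n g) {i : ℕ} (hi : i ≤ n) :
    IsOrder E 0 (fun _ (a : ι × ℝ) => iteratedDeriv i (g a.1) a.2) := by
  obtain ⟨-, K, -, h⟩ := hg
  exact IsOrder.of_bound fun a => h i hi a.1 a.2

theorem UniformCn.isOrder_taylor {ι : Type*} {g : ι → ℝ → ℝ} (hg : UniformCn (n + 1) g)
    {δ : ℝ → ι × ℝ → ℝ} (hδ : IsOrder E m δ) :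
    IsOrder E (m * (n + 1)) (fun ε a => g a.1 (a.2 + δ ε a) -
      ∑ i ∈ Finset.range (n + 1), iteratedDeriv i (g a.1) a.2 / i.factorial * δ ε a ^ i) := by
  obtain ⟨hc, K, hK, h⟩ := hg
  obtain ⟨L, hL, hδ⟩ := hδ
  refine ⟨K * L ^ (n + 1), by positivity, fun ε hε a => ?_⟩
  refine (abs_sub_taylor_le n (hc a.1) (fun x => h (n + 1) le_rfl a.1 x) a.2 (δ ε a)).trans ?_
  calc K * |δ ε a| ^ (n + 1) ≤ K * (L * ε ^ m) ^ (n + 1) := by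
        have := hδ ε hε a
        gcongr
    _ = _ := by rw [mul_pow, ← pow_mul, mul_assoc]

end Order

/-! ### Moments of the Platen increments -/

section Moments

variable {α : Type*} {E : ℝ}

/-- The increments `D₁`, `D₂` at q = ±1 are modelled by ± r ε U + ε² W with U = σ₀ + ε² u and W = z
+ ε² w, and `D₃` by ε² (b₀ − σ₀ σ₁ / 2). The identity separates the errors of these models from an
explicit ε⁶ remainder. In the average of the two signs the odd powers of r cancel, and r² = 3 gives
the Gaussian normalisation. The identities for the higher moments follow the same pattern, with `D₃`
left as it is. -/
theorem platen_second_moment_identity {r ε b₀ b₁ σ₀ σ₁ σ₂ u w z D₁ D₂ D₃ : ℝ} (hr : r ^ 2 = 3)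
    (hu : u = σ₀ * b₁ / 2 + (2 * b₀ * σ₁ + σ₀ ^ 2 * σ₂) / 4) (hz : z = b₀ + σ₀ * σ₁) :
    1 / 6 * D₁ ^ 2 + 1 / 6 * D₂ ^ 2 + 2 / 3 * D₃ ^ 2 -
      (ε ^ 2 * σ₀ ^ 2 + ε ^ 4 * (b₀ ^ 2 + σ₀ ^ 2 * σ₁ ^ 2 / 2 + σ₀ ^ 2 * b₁ +
        b₀ * σ₀ * σ₁ + σ₀ ^ 3 * σ₂ / 2)) =
    1 / 6 * (D₁ ^ 2 - (r * ε * (σ₀ + ε ^ 2 * u) + ε ^ 2 * (z + ε ^ 2 * w)) ^ 2) +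
        1 / 6 * (D₂ ^ 2 - (-(r * ε * (σ₀ + ε ^ 2 * u)) + ε ^ 2 * (z + ε ^ 2 * w)) ^ 2) +
      2 / 3 * ((D₃ - ε ^ 2 * (b₀ - σ₀ * σ₁ / 2)) * (D₃ + ε ^ 2 * (b₀ - σ₀ * σ₁ / 2))) +
      ε ^ 6 * (u ^ 2 + (2 * (z * w) + ε ^ 2 * w ^ 2) / 3) := by
  linear_combination (1 / 3 * ε ^ 2 * (σ₀ + ε ^ 2 * u) ^ 2) * hr + 2 * ε ^ 4 * σ₀ * hu +
    (ε ^ 4 / 3 * (z + b₀ + σ₀ * σ₁)) * hz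

theorem platen_third_moment_identity {r ε σ₀ u w z D₁ D₂ D₃ : ℝ} (hr : r ^ 2 = 3) :
    1 / 6 * D₁ ^ 3 + 1 / 6 * D₂ ^ 3 + 2 / 3 * D₃ ^ 3 - 3 * ε ^ 4 * (σ₀ ^ 2 * z) =
    1 / 6 * (D₁ ^ 3 - (r * ε * (σ₀ + ε ^ 2 * u) + ε ^ 2 * (z + ε ^ 2 * w)) ^ 3) +
        1 / 6 * (D₂ ^ 3 - (-(r * ε * (σ₀ + ε ^ 2 * u)) + ε ^ 2 * (z + ε ^ 2 * w)) ^ 3) +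
      2 / 3 * D₃ ^ 3 +
      ε ^ 6 * (3 * ((2 * (σ₀ * u) + ε ^ 2 * u ^ 2) * (z + ε ^ 2 * w) + σ₀ ^ 2 * w) +
        (z + ε ^ 2 * w) ^ 3 / 3) := by
  obtain ⟨W, hW⟩ : ∃ W, W = z + ε ^ 2 * w := ⟨_, rfl⟩
  obtain ⟨U, hU⟩ : ∃ U, U = σ₀ + ε ^ 2 * u := ⟨_, rfl⟩
  rw [← hU, ← hW]
  have hU2 : U ^ 2 = σ₀ ^ 2 + ε ^ 2 * (2 * (σ₀ * u) + ε ^ 2 * u ^ 2) := by rw [hU]; ring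
  linear_combination (ε ^ 4 * U ^ 2 * W) * hr + 3 * ε ^ 4 * W * hU2 + 3 * ε ^ 4 * σ₀ ^ 2 * hW

theorem platen_fourth_moment_identity {r ε σ₀ u U W D₁ D₂ D₃ : ℝ} (hr : r ^ 2 = 3)
    (hU : U = σ₀ + ε ^ 2 * u) :
    1 / 6 * D₁ ^ 4 + 1 / 6 * D₂ ^ 4 + 2 / 3 * D₃ ^ 4 - 3 * ε ^ 4 * σ₀ ^ 4 =
    1 / 6 * (D₁ ^ 4 - (r * ε * U + ε ^ 2 * W) ^ 4) +
        1 / 6 * (D₂ ^ 4 - (-(r * ε * U) + ε ^ 2 * W) ^ 4) + 2 / 3 * D₃ ^ 4 +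
      ε ^ 6 * (3 * ((2 * (σ₀ * u) + ε ^ 2 * u ^ 2) * (U ^ 2 + σ₀ ^ 2)) +
        6 * (U ^ 2 * W ^ 2) + ε ^ 2 * W ^ 4 / 3) := by
  have hU2 : ε ^ 2 * (2 * (σ₀ * u) + ε ^ 2 * u ^ 2) = U ^ 2 - σ₀ ^ 2 := by rw [hU]; ring
  have hP : (r * ε * U) ^ 2 = 3 * (ε * U) ^ 2 := by rw [mul_pow, mul_pow, hr]; ring
  generalize r * ε * U = P at hP
  linear_combination ((P ^ 2 + 3 * (ε * U) ^ 2) / 3 + 2 * (ε ^ 2 * W) ^ 2) * hP -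
    3 * ε ^ 4 * (U ^ 2 + σ₀ ^ 2) * hU2

theorem platen_fifth_moment_identity {r ε U W D₁ D₂ D₃ : ℝ} (hr : r ^ 2 = 3) :
    1 / 6 * D₁ ^ 5 + 1 / 6 * D₂ ^ 5 + 2 / 3 * D₃ ^ 5 =
    1 / 6 * (D₁ ^ 5 - (r * ε * U + ε ^ 2 * W) ^ 5) +
        1 / 6 * (D₂ ^ 5 - (-(r * ε * U) + ε ^ 2 * W) ^ 5) + 2 / 3 * D₃ ^ 5 +
      ε ^ 6 * (15 * (U ^ 4 * W) + 10 * (ε ^ 2 * (U ^ 2 * W ^ 3)) + ε ^ 4 * W ^ 5 / 3) := by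
  have hP : (r * ε * U) ^ 2 = 3 * (ε * U) ^ 2 := by rw [mul_pow, mul_pow, hr]; ring
  generalize r * ε * U = P at hP
  linear_combination (5 / 3 * (ε ^ 2 * W) * (P ^ 2 + 3 * (ε * U) ^ 2) +
    10 / 3 * (ε ^ 2 * W) ^ 3) * hP

/-- The targets are the coefficients that Taylor's formula for g needs in order to produce ε² A g +
ε⁴ A² g / 2. Subscripts denote derivatives at x; `bp`, `bm`, `bz`, `sp`, `sm` are the values of b
and σ at the inner Euler feet, known through their Taylor polynomials. -/
theorem platen_moments {r : ℝ} (hr : r ^ 2 = 3) {b₀ b₁ b₂ b₃ σ₀ σ₁ σ₂ σ₃ : α → ℝ}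
    (hb₀ : IsOrder E 0 fun _ => b₀) (hb₁ : IsOrder E 0 fun _ => b₁) (hb₂ : IsOrder E 0 fun _ => b₂)
    (hb₃ : IsOrder E 0 fun _ => b₃) (hσ₀ : IsOrder E 0 fun _ => σ₀) (hσ₁ : IsOrder E 0 fun _ => σ₁)
    (hσ₂ : IsOrder E 0 fun _ => σ₂) (hσ₃ : IsOrder E 0 fun _ => σ₃)
    {bp bm bz sp sm δp δm δz : ℝ → α → ℝ}
    (hbp : IsOrder E 4 fun ε a => bp ε a - (b₀ a + b₁ a * (r * ε * σ₀ a + ε ^ 2 * b₀ a) +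
      b₂ a / 2 * (r * ε * σ₀ a + ε ^ 2 * b₀ a) ^ 2 + b₃ a / 6 * (r * ε * σ₀ a + ε ^ 2 * b₀ a) ^ 3))
    (hbm : IsOrder E 4 fun ε a => bm ε a - (b₀ a + b₁ a * (-r * ε * σ₀ a + ε ^ 2 * b₀ a) +
      b₂ a / 2 * (-r * ε * σ₀ a + ε ^ 2 * b₀ a) ^ 2 + b₃ a / 6 * (-r * ε * σ₀ a + ε ^ 2 * b₀ a) ^ 3))
    (hbz : IsOrder E 4 fun ε a => bz ε a - (b₀ a + b₁ a * (ε ^ 2 * b₀ a)))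
    (hsp : IsOrder E 4 fun ε a => sp ε a - (σ₀ a + σ₁ a * (ε * σ₀ a + ε ^ 2 * b₀ a) +
      σ₂ a / 2 * (ε * σ₀ a + ε ^ 2 * b₀ a) ^ 2 + σ₃ a / 6 * (ε * σ₀ a + ε ^ 2 * b₀ a) ^ 3))
    (hsm : IsOrder E 4 fun ε a => sm ε a - (σ₀ a + σ₁ a * (-ε * σ₀ a + ε ^ 2 * b₀ a) +
      σ₂ a / 2 * (-ε * σ₀ a + ε ^ 2 * b₀ a) ^ 2 + σ₃ a / 6 * (-ε * σ₀ a + ε ^ 2 * b₀ a) ^ 3))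
    (hδp : ∀ ε a, δp ε a = 1 / 2 * (bp ε a + b₀ a) * ε ^ 2 +
      1 / 4 * ((sp ε a + sm ε a + 2 * σ₀ a) * r + (sp ε a - sm ε a) * 2) * ε)
    (hδm : ∀ ε a, δm ε a = 1 / 2 * (bm ε a + b₀ a) * ε ^ 2 +
      1 / 4 * (-((sp ε a + sm ε a + 2 * σ₀ a) * r) + (sp ε a - sm ε a) * 2) * ε)
    (hδz : ∀ ε a, δz ε a = 1 / 2 * (bz ε a + b₀ a) * ε ^ 2 - 1 / 4 * (sp ε a - sm ε a) * ε) :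
    (IsOrder E 1 δp ∧ IsOrder E 1 δm ∧ IsOrder E 1 δz) ∧
    (IsOrder E 6 fun ε a => 1 / 6 * δp ε a + 1 / 6 * δm ε a + 2 / 3 * δz ε a -
      (ε ^ 2 * b₀ a + ε ^ 4 / 2 * (b₀ a * b₁ a + σ₀ a ^ 2 * b₂ a / 2))) ∧
    (IsOrder E 6 fun ε a => 1 / 6 * δp ε a ^ 2 + 1 / 6 * δm ε a ^ 2 + 2 / 3 * δz ε a ^ 2 -
      (ε ^ 2 * σ₀ a ^ 2 + ε ^ 4 * (b₀ a ^ 2 + σ₀ a ^ 2 * σ₁ a ^ 2 / 2 + σ₀ a ^ 2 * b₁ a +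
        b₀ a * σ₀ a * σ₁ a + σ₀ a ^ 3 * σ₂ a / 2))) ∧
    (IsOrder E 6 fun ε a => 1 / 6 * δp ε a ^ 3 + 1 / 6 * δm ε a ^ 3 + 2 / 3 * δz ε a ^ 3 -
      3 * ε ^ 4 * (σ₀ a ^ 2 * (b₀ a + σ₀ a * σ₁ a))) ∧
    (IsOrder E 6 fun ε a => 1 / 6 * δp ε a ^ 4 + 1 / 6 * δm ε a ^ 4 + 2 / 3 * δz ε a ^ 4 -
      3 * ε ^ 4 * σ₀ a ^ 4) ∧
    (IsOrder E 6 fun ε a => 1 / 6 * δp ε a ^ 5 + 1 / 6 * δm ε a ^ 5 + 2 / 3 * δz ε a ^ 5) := by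
  have hr3 : r ^ 3 = 3 * r := by rw [pow_succ, hr]
  have hr4 : r ^ 4 = 9 := by rw [show r ^ 4 = (r ^ 2) ^ 2 by ring, hr]; norm_num
  have he := IsOrder.eps₀ (α := α) (E := E)
  have hrO := IsOrder.const (α := α) (E := E) r
  set s₂ : α → ℝ := fun a => 2 * b₀ a * σ₁ a + σ₀ a ^ 2 * σ₂ a with hs₂
  set d₃ : α → ℝ := fun a => 2 * σ₀ a * b₀ a * σ₂ a + σ₀ a ^ 3 * σ₃ a / 3 with hd₃
  set B₂ : α → ℝ := fun a => b₀ a * b₁ a + 3 / 2 * σ₀ a ^ 2 * b₂ a with hB₂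
  have hs₂O : IsOrder E 0 fun _ => s₂ :=
    (((hb₀.const_mul 2).mul hσ₁).add ((hσ₀.pow 2).mul hσ₂))
  have hd₃O : IsOrder E 0 fun _ => d₃ :=
    ((((hσ₀.const_mul 2).mul hb₀).mul hσ₂).add (((hσ₀.pow 3).mul hσ₃).div_const 3))
  have hB₂O : IsOrder E 0 fun _ => B₂ :=
    ((hb₀.mul hb₁).add (((hσ₀.pow 2).const_mul (3 / 2)).mul hb₂))
  have hcub : IsOrder E 0 fun ε a => (r * σ₀ a + ε * b₀ a) ^ 3 := ((hσ₀.const_mul r).add (he.mul hb₀)).pow 3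
  have hcub' : IsOrder E 0 fun ε a => (-r * σ₀ a + ε * b₀ a) ^ 3 :=
    ((hσ₀.const_mul (-r)).add (he.mul hb₀)).pow 3
  have hbp' : IsOrder E 3 fun ε a => bp ε a - (b₀ a + r * ε * σ₀ a * b₁ a + ε ^ 2 * B₂ a) := by
    have hbr : IsOrder E 0 fun ε a => b₂ a / 2 * (2 * r * σ₀ a * b₀ a + ε * b₀ a ^ 2) +
        b₃ a / 6 * (r * σ₀ a + ε * b₀ a) ^ 3 :=
      ((hb₂.div_const 2).mul (((hσ₀.const_mul (2 * r)).mul hb₀).add (he.mul (hb₀.pow 2)))).add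
        ((hb₃.div_const 6).mul hcub)
    refine ((hbp.of_le (by norm_num)).add (hbr.eps_mul 3)).congr fun ε a => ?_
    simp only [hB₂]
    linear_combination (b₂ a / 2 * ε ^ 2 * σ₀ a ^ 2) * hr
  have hbm' : IsOrder E 3 fun ε a => bm ε a - (b₀ a - r * ε * σ₀ a * b₁ a + ε ^ 2 * B₂ a) := by
    have hbr : IsOrder E 0 fun ε a => b₂ a / 2 * ((-2 * r) * σ₀ a * b₀ a + ε * b₀ a ^ 2) +
        b₃ a / 6 * (-r * σ₀ a + ε * b₀ a) ^ 3 :=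
      ((hb₂.div_const 2).mul (((hσ₀.const_mul (-2 * r)).mul hb₀).add (he.mul (hb₀.pow 2)))).add
        ((hb₃.div_const 6).mul hcub')
    refine ((hbm.of_le (by norm_num)).add (hbr.eps_mul 3)).congr fun ε a => ?_
    simp only [hB₂]
    linear_combination (b₂ a / 2 * ε ^ 2 * σ₀ a ^ 2) * hr
  -- One order better than `hbp'` and `hbm'` separately, as the ε³ terms are odd in r. The first
  -- moment needs this.
  have hbsum : IsOrder E 4 fun ε a => bp ε a + bm ε a - (2 * b₀ a + 2 * ε ^ 2 * B₂ a) := by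
    have hbr : IsOrder E 0 fun ε a => b₂ a * b₀ a ^ 2 +
        b₃ a / 6 * (2 * (ε ^ 2 * b₀ a ^ 3) + 18 * (σ₀ a ^ 2 * b₀ a)) :=
      (hb₂.mul (hb₀.pow 2)).add ((hb₃.div_const 6).mul
        ((((he.pow 2).mul (hb₀.pow 3)).const_mul 2).add (((hσ₀.pow 2).mul hb₀).const_mul 18)))
    refine ((hbp.add hbm).add (hbr.eps_mul 4)).congr fun ε a => ?_
    simp only [hB₂]
    linear_combination (b₂ a * ε ^ 2 * σ₀ a ^ 2 + b₃ a * ε ^ 4 * σ₀ a ^ 2 * b₀ a) * hr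
  have hs : IsOrder E 4 fun ε a => sp ε a + sm ε a + 2 * σ₀ a - (4 * σ₀ a + ε ^ 2 * s₂ a) := by
    have hbr : IsOrder E 0 fun ε a => σ₂ a * b₀ a ^ 2 +
        σ₃ a / 6 * (2 * (ε ^ 2 * b₀ a ^ 3) + 6 * (σ₀ a ^ 2 * b₀ a)) :=
      (hσ₂.mul (hb₀.pow 2)).add ((hσ₃.div_const 6).mul
        ((((he.pow 2).mul (hb₀.pow 3)).const_mul 2).add (((hσ₀.pow 2).mul hb₀).const_mul 6)))
    refine ((hsp.add hsm).add (hbr.eps_mul 4)).congr fun ε a => ?_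
    simp only [hs₂]
    ring
  have hd : IsOrder E 4 fun ε a => sp ε a - sm ε a - (2 * ε * σ₀ a * σ₁ a + ε ^ 3 * d₃ a) := by
    have hbr : IsOrder E 0 fun ε a => ε * (σ₃ a * σ₀ a * b₀ a ^ 2) :=
      he.mul ((hσ₃.mul hσ₀).mul (hb₀.pow 2))
    refine ((hsp.sub hsm).add (hbr.eps_mul 4)).congr fun ε a => ?_
    simp only [hd₃]
    ring
  set u₂ : α → ℝ := fun a => σ₀ a * b₁ a / 2 + s₂ a / 4 with hu₂
  set w₀ : α → ℝ := fun a => b₀ a + σ₀ a * σ₁ a with hw₀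
  set w₂ : α → ℝ := fun a => (B₂ a + d₃ a) / 2 with hw₂
  set V : α → ℝ := fun a => b₀ a - σ₀ a * σ₁ a / 2 with hV
  set U : ℝ → α → ℝ := fun ε a => σ₀ a + ε ^ 2 * u₂ a with hU
  set W : ℝ → α → ℝ := fun ε a => w₀ a + ε ^ 2 * w₂ a with hW
  have hu₂O : IsOrder E 0 fun _ => u₂ := ((hσ₀.mul hb₁).div_const 2).add (hs₂O.div_const 4)
  have hw₀O : IsOrder E 0 fun _ => w₀ := hb₀.add (hσ₀.mul hσ₁)
  have hw₂O : IsOrder E 0 fun _ => w₂ := (hB₂O.add hd₃O).div_const 2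
  have hVO : IsOrder E 0 fun _ => V := hb₀.sub ((hσ₀.mul hσ₁).div_const 2)
  have hUO : IsOrder E 0 U := hσ₀.add ((he.pow 2).mul hu₂O)
  have hWO : IsOrder E 0 W := hw₀O.add ((he.pow 2).mul hw₂O)
  have hPp : IsOrder E 1 fun ε a => r * ε * U ε a + ε ^ 2 * W ε a :=
    (((hUO.const_mul r).add (he.mul hWO)).eps_mul 1).congr fun ε a => by ring
  have hPm : IsOrder E 1 fun ε a => -(r * ε * U ε a) + ε ^ 2 * W ε a :=
    (((hUO.const_mul (-r)).add (he.mul hWO)).eps_mul 1).congr fun ε a => by ring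
  have hDp : IsOrder E 5 fun ε a => δp ε a - (r * ε * U ε a + ε ^ 2 * W ε a) := by
    refine (((((IsOrder.eps (α := α)).pow' 2).mul' hbp').const_mul (1 / 2)).add
      ((((IsOrder.eps (α := α)).mul' hs).const_mul (r / 4)).add
        (((IsOrder.eps (α := α)).mul' hd).const_mul (1 / 2)))).congr fun ε a => ?_
    rw [hδp]
    simp only [hU, hW, hu₂, hw₀, hw₂]
    ring
  have hDm : IsOrder E 5 fun ε a => δm ε a - (-(r * ε * U ε a) + ε ^ 2 * W ε a) := by
    refine (((((IsOrder.eps (α := α)).pow' 2).mul' hbm').const_mul (1 / 2)).add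
      ((((IsOrder.eps (α := α)).mul' hs).const_mul (-r / 4)).add
        (((IsOrder.eps (α := α)).mul' hd).const_mul (1 / 2)))).congr fun ε a => ?_
    rw [hδm]
    simp only [hU, hW, hu₂, hw₀, hw₂]
    ring
  have hDz : IsOrder E 4 fun ε a => δz ε a - ε ^ 2 * V a := by
    have hbr : IsOrder E 0 fun _ a => b₀ a * b₁ a / 2 - d₃ a / 4 :=
      ((hb₀.mul hb₁).div_const 2).sub (hd₃O.div_const 4)
    refine ((((((IsOrder.eps (α := α)).pow' 2).mul' hbz).const_mul (1 / 2)).of_le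
      (by norm_num)).add (((((IsOrder.eps (α := α)).mul' hd).const_mul (-1 / 4)).of_le
        (by norm_num)).add (hbr.eps_mul 4))).congr fun ε a => ?_
    rw [hδz]
    simp only [hV]
    ring
  have hV2 : IsOrder E 2 fun ε a => ε ^ 2 * V a := hVO.eps_mul 2
  have hδpO : IsOrder E 1 δp := ((hDp.of_le (by norm_num)).add hPp).congr fun ε a => by ring
  have hδmO : IsOrder E 1 δm := ((hDm.of_le (by norm_num)).add hPm).congr fun ε a => by ring
  have hδzO : IsOrder E 2 δz := ((hDz.of_le (by norm_num)).add hV2).congr fun ε a => by ring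
  -- The models are accurate to O(ε⁵), so powers k ≥ 2 are accurate to O(ε^(4 + k)). The first power
  -- falls short and is treated separately.
  have hpow : ∀ k, 2 ≤ k → IsOrder E 6 fun ε a =>
      1 / 6 * (δp ε a ^ k - (r * ε * U ε a + ε ^ 2 * W ε a) ^ k) +
      1 / 6 * (δm ε a ^ k - (-(r * ε * U ε a) + ε ^ 2 * W ε a) ^ k) := fun k hk =>
    (((hδpO.pow_sub_pow (l := 4) hPp hDp k).of_le (by omega)).const_mul (1 / 6)).add
      (((hδmO.pow_sub_pow (l := 4) hPm hDm k).of_le (by omega)).const_mul (1 / 6))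
  have hzpow : ∀ k, 3 ≤ k → IsOrder E 6 fun ε a => 2 / 3 * δz ε a ^ k := fun k hk =>
    ((hδzO.pow' k).of_le (by omega)).const_mul (2 / 3)
  have hX : IsOrder E 0 fun ε a => 2 * (σ₀ a * u₂ a) + ε ^ 2 * u₂ a ^ 2 :=
    ((hσ₀.mul hu₂O).const_mul 2).add ((he.pow 2).mul (hu₂O.pow 2))
  refine ⟨⟨hδpO, hδmO, hδzO.of_le (by norm_num)⟩, ?_, ?_, ?_, ?_, ?_⟩
  -- In the mean the contributions of σ cancel exactly: 1/6 from the outer feet against 2/3 · 1/4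
  -- from the middle one. Only ε² times values of b is left.
  · refine ((((IsOrder.eps (α := α)).pow' 2).mul' ((hbsum.const_mul (1 / 12)).add
      (hbz.const_mul (1 / 3))))).congr fun ε a => ?_
    rw [hδp, hδm, hδz]
    simp only [hB₂]
    ring
  · have hz2 : IsOrder E 6 fun ε a => 2 / 3 * ((δz ε a - ε ^ 2 * V a) * (δz ε a + ε ^ 2 * V a)) :=
      ((hDz.mul' (hδzO.add hV2))).const_mul (2 / 3)
    have hbr : IsOrder E 0 fun ε a => u₂ a ^ 2 + (2 * (w₀ a * w₂ a) + ε ^ 2 * w₂ a ^ 2) / 3 :=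
      (hu₂O.pow 2).add ((((hw₀O.mul hw₂O).const_mul 2).add
        ((he.pow 2).mul (hw₂O.pow 2))).div_const 3)
    refine (((hpow 2 le_rfl).add hz2).add (hbr.eps_mul 6)).congr fun ε a => ?_
    have e : u₂ a = σ₀ a * b₁ a / 2 + (2 * b₀ a * σ₁ a + σ₀ a ^ 2 * σ₂ a) / 4 := rfl
    have e1 : U ε a = σ₀ a + ε ^ 2 * u₂ a := rfl
    have e2 : W ε a = w₀ a + ε ^ 2 * w₂ a := rfl
    have e3 : V a = b₀ a - σ₀ a * σ₁ a / 2 := rfl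
    have e4 : w₀ a = b₀ a + σ₀ a * σ₁ a := rfl
    rw [e1, e2, e3]
    generalize u₂ a = u at e
    generalize w₂ a = w
    generalize w₀ a = z at e4
    generalize δp ε a = D₁
    generalize δm ε a = D₂
    generalize δz ε a = D₃
    exact platen_second_moment_identity hr e e4
  · have hbr : IsOrder E 0 fun ε a => 3 * ((2 * (σ₀ a * u₂ a) + ε ^ 2 * u₂ a ^ 2) * W ε a +
        σ₀ a ^ 2 * w₂ a) + W ε a ^ 3 / 3 :=
      (((hX.mul hWO).add ((hσ₀.pow 2).mul hw₂O)).const_mul 3).add ((hWO.pow 3).div_const 3)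
    refine (((hpow 3 (by norm_num)).add (hzpow 3 le_rfl)).add (hbr.eps_mul 6)).congr fun ε a => ?_
    exact platen_third_moment_identity hr
  · have hbr : IsOrder E 0 fun ε a => 3 * ((2 * (σ₀ a * u₂ a) + ε ^ 2 * u₂ a ^ 2) *
        (U ε a ^ 2 + σ₀ a ^ 2)) + 6 * (U ε a ^ 2 * W ε a ^ 2) + ε ^ 2 * W ε a ^ 4 / 3 :=
      (((hX.mul ((hUO.pow 2).add (hσ₀.pow 2))).const_mul 3).add
        (((hUO.pow 2).mul (hWO.pow 2)).const_mul 6)).add (((he.pow 2).mul (hWO.pow 4)).div_const 3)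
    refine (((hpow 4 (by norm_num)).add (hzpow 4 (by norm_num))).add
      (hbr.eps_mul 6)).congr fun ε a => ?_
    exact platen_fourth_moment_identity hr rfl
  · have hbr : IsOrder E 0 fun ε a => 15 * (U ε a ^ 4 * W ε a) + 10 * (ε ^ 2 * (U ε a ^ 2 * W ε a ^ 3)) +
        ε ^ 4 * W ε a ^ 5 / 3 :=
      ((((hUO.pow 4).mul hWO).const_mul 15).add
        (((he.pow 2).mul ((hUO.pow 2).mul (hWO.pow 3))).const_mul 10)).add
          (((he.pow 4).mul (hWO.pow 5)).div_const 3)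
    refine (((hpow 5 (by norm_num)).add (hzpow 5 (by norm_num))).add
      (hbr.eps_mul 6)).congr fun ε a => ?_
    exact platen_fifth_moment_identity hr

end Moments

/-! ### Expansion of the averages over the feet -/

section Expansion

variable {ι : Type*} {b σ : ℝ → ℝ} {E : ℝ}

theorem isOrder_of_periodic {n i : ℕ} (hb : ContDiff ℝ n b) (hper : Function.Periodic b 1)
    (hi : i ≤ n) : IsOrder E 0 fun _ (a : ι × ℝ) => iteratedDeriv i b a.2 :=
  (uniformCn_of_periodic_one (ι := ι) hb hper).isOrder hi

theorem isOrder_eulerSlope {n : ℕ} (hb : ContDiff ℝ n b) (hσ : ContDiff ℝ n σ)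
    (hb_per : Function.Periodic b 1) (hσ_per : Function.Periodic σ 1) (q : ℝ) :
    IsOrder E 1 fun ε (a : ι × ℝ) => ε * eulerSlope b σ q ε a.2 := by
  have h1 := isOrder_of_periodic (ι := ι) (E := E) hb hb_per (Nat.zero_le _)
  have h2 := isOrder_of_periodic (ι := ι) (E := E) hσ hσ_per (Nat.zero_le _)
  refine (((h1.mul IsOrder.eps₀).add (h2.const_mul q)).eps_mul 1).congr fun ε a => ?_
  simp only [eulerSlope, iteratedDeriv_zero]
  ring

/-- The zero order term of the generator is switched off here and below (r = 0); the exponential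
factor reinstates it later. -/
theorem isOrder_euler_expansion (hb : ContDiff ℝ (2 : ℕ) b) (hσ : ContDiff ℝ (2 : ℕ) σ)
    (hb_per : Function.Periodic b 1) (hσ_per : Function.Periodic σ 1) {g : ι → ℝ → ℝ}
    (hg : UniformCn 4 g) :
    IsOrder E 4 fun ε (a : ι × ℝ) => ∑ i, footWeight 1 i *
        g a.1 (a.2 + ε * footSlope 1 b σ (footIndex i) ε a.2) -
      (g a.1 a.2 + ε ^ 2 * generator b σ 0 (g a.1) a.2) := by
  have hb0 := isOrder_of_periodic (ι := ι) (E := E) hb hb_per (Nat.zero_le _)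
  have hσ0 := isOrder_of_periodic (ι := ι) (E := E) hσ hσ_per (Nat.zero_le _)
  have h2 := hg.isOrder (E := E) (i := 2) (by norm_num)
  have h3 := hg.isOrder (E := E) (i := 3) (by norm_num)
  have tp := hg.isOrder_taylor (n := 3) (isOrder_eulerSlope (E := E) hb hσ hb_per hσ_per 1)
  have tm := hg.isOrder_taylor (n := 3) (isOrder_eulerSlope (E := E) hb hσ hb_per hσ_per (-1))
  have hR := (((hb0.pow 2).div_const 2).mul h2).add
    ((((((IsOrder.eps₀ (α := ι × ℝ) (E := E)).pow 2).mul (hb0.pow 3)).add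
      ((hb0.mul (hσ0.pow 2)).const_mul 3)).div_const 6).mul h3)
  refine (((tp.const_mul (1 / 2)).add (tm.const_mul (1 / 2))).add (hR.eps_mul 4)).congr
    fun ε a => ?_
  simp only [Fin.sum_univ_three, footWeight, footIndex, footSlope, if_true, Matrix.cons_val,
    Finset.sum_range_succ, Finset.sum_range_zero, generator, ← iteratedDeriv_one,
    iteratedDeriv_zero, eulerSlope, Nat.factorial]
  push_cast
  ring

theorem hasDerivAt_generator_zero {g : ℝ → ℝ} (hb : ContDiff ℝ (2 : ℕ) b) (hσ : ContDiff ℝ (2 : ℕ) σ)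
    (hg : ContDiff ℝ (4 : ℕ) g) (x : ℝ) : HasDerivAt (generator b σ 0 g)
      (σ x * deriv σ x * iteratedDeriv 2 g x + σ x ^ 2 / 2 * iteratedDeriv 3 g x +
        deriv b x * iteratedDeriv 1 g x + b x * iteratedDeriv 2 g x) x := by
  have hbd := (hb.differentiable (by norm_num) x).hasDerivAt
  have hσd := (hσ.differentiable (by norm_num) x).hasDerivAt
  have h1 := hasDerivAt_iteratedDeriv hg (i := 1) (by norm_num) x
  have h2 := hasDerivAt_iteratedDeriv hg (i := 2) (by norm_num) x
  have h := (((hσd.pow 2).div_const 2).mul h2).add (hbd.mul h1)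
  have e : generator b σ 0 g = ((fun x => (σ ^ 2) x / 2) * iteratedDeriv 2 g) +
      b * iteratedDeriv 1 g := by
    funext x
    simp [generator, iteratedDeriv_one]
  rw [e]
  refine h.congr_deriv ?_
  simp only [Pi.pow_apply]
  push_cast
  ring

theorem generator_generator {g : ℝ → ℝ} (hb : ContDiff ℝ (2 : ℕ) b) (hσ : ContDiff ℝ (2 : ℕ) σ)
    (hg : ContDiff ℝ (4 : ℕ) g) (x : ℝ) : generator b σ 0 (generator b σ 0 g) x =
      σ x ^ 2 / 2 * (((iteratedDeriv 1 σ x) ^ 2 + σ x * iteratedDeriv 2 σ x) * iteratedDeriv 2 g x +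
        2 * σ x * iteratedDeriv 1 σ x * iteratedDeriv 3 g x + σ x ^ 2 / 2 * iteratedDeriv 4 g x +
        iteratedDeriv 2 b x * iteratedDeriv 1 g x + 2 * iteratedDeriv 1 b x * iteratedDeriv 2 g x +
        b x * iteratedDeriv 3 g x) +
      b x * (σ x * iteratedDeriv 1 σ x * iteratedDeriv 2 g x + σ x ^ 2 / 2 * iteratedDeriv 3 g x +
        iteratedDeriv 1 b x * iteratedDeriv 1 g x + b x * iteratedDeriv 2 g x) := by
  have hd := hasDerivAt_generator_zero hb hσ hg
  have e1 : deriv (generator b σ 0 g) = fun x =>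
      σ x * iteratedDeriv 1 σ x * iteratedDeriv 2 g x + σ x ^ 2 / 2 * iteratedDeriv 3 g x +
        iteratedDeriv 1 b x * iteratedDeriv 1 g x + b x * iteratedDeriv 2 g x :=
    funext fun x => by simpa only [iteratedDeriv_one] using (hd x).deriv
  have e2 : iteratedDeriv 2 (generator b σ 0 g) x =
      ((iteratedDeriv 1 σ x) ^ 2 + σ x * iteratedDeriv 2 σ x) * iteratedDeriv 2 g x +
        2 * σ x * iteratedDeriv 1 σ x * iteratedDeriv 3 g x + σ x ^ 2 / 2 * iteratedDeriv 4 g x +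
        iteratedDeriv 2 b x * iteratedDeriv 1 g x + 2 * iteratedDeriv 1 b x * iteratedDeriv 2 g x +
        b x * iteratedDeriv 3 g x := by
    rw [iteratedDeriv_succ, iteratedDeriv_one, e1]
    have b0 := hasDerivAt_iteratedDeriv hb (i := 0) (by norm_num) x
    have b1 := hasDerivAt_iteratedDeriv hb (i := 1) (by norm_num) x
    have s0 := hasDerivAt_iteratedDeriv hσ (i := 0) (by norm_num) x
    have s1 := hasDerivAt_iteratedDeriv hσ (i := 1) (by norm_num) x
    have g1 := hasDerivAt_iteratedDeriv hg (i := 1) (by norm_num) x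
    have g2 := hasDerivAt_iteratedDeriv hg (i := 2) (by norm_num) x
    have g3 := hasDerivAt_iteratedDeriv hg (i := 3) (by norm_num) x
    simp only [iteratedDeriv_zero] at b0 s0
    have h := ((((s0.mul s1).mul g2).add (((s0.pow 2).div_const 2).mul g3)).add (b1.mul g1)).add
      (b0.mul g2)
    refine (h.congr_deriv ?_).deriv
    simp only [Pi.pow_apply, Pi.mul_apply]
    push_cast
    ring
  rw [generator, e2, e1]
  ring

/-- Taylor's formula of degree 5 makes the average a combination of derivatives of g weighted by the
moments of the increments; replacing these by their targets gives A g and, after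
`generator_generator`, A² g. -/
theorem isOrder_platen_expansion (hb : ContDiff ℝ (4 : ℕ) b) (hσ : ContDiff ℝ (4 : ℕ) σ)
    (hb_per : Function.Periodic b 1) (hσ_per : Function.Periodic σ 1) {g : ι → ℝ → ℝ}
    (hg : UniformCn 6 g) :
    IsOrder E 6 fun ε (a : ι × ℝ) => ∑ i, footWeight 2 i *
        g a.1 (a.2 + ε * footSlope 2 b σ (footIndex i) ε a.2) -
      (g a.1 a.2 + ε ^ 2 * generator b σ 0 (g a.1) a.2 +
        ε ^ 4 / 2 * generator b σ 0 (generator b σ 0 (g a.1)) a.2) := by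
  have hbi : ∀ i ≤ 4, IsOrder E 0 fun _ (a : ι × ℝ) => iteratedDeriv i b a.2 :=
    fun i hi => isOrder_of_periodic hb hb_per hi
  have hσi : ∀ i ≤ 4, IsOrder E 0 fun _ (a : ι × ℝ) => iteratedDeriv i σ a.2 :=
    fun i hi => isOrder_of_periodic hσ hσ_per hi
  have hbU := uniformCn_of_periodic_one (ι := ι) hb hb_per
  have hσU := uniformCn_of_periodic_one (ι := ι) hσ hσ_per
  have hδ := fun q => isOrder_eulerSlope (ι := ι) (E := E) hb hσ hb_per hσ_per q
  have hδ0 : IsOrder E 2 fun ε (a : ι × ℝ) => ε * eulerSlope b σ 0 ε a.2 :=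
    ((hbi 0 (by norm_num)).eps_mul 2).congr fun ε a => by
      simp only [eulerSlope, iteratedDeriv_zero]; ring
  obtain ⟨r, hr⟩ : ∃ r, r = Real.sqrt 3 := ⟨_, rfl⟩
  have hr2 : r ^ 2 = 3 := by rw [hr]; exact Real.sq_sqrt (by norm_num)
  obtain ⟨⟨hp, hm, hz⟩, m1, m2, m3, m4, m5⟩ := platen_moments (E := E) hr2
    (hbi 0 (by norm_num)) (hbi 1 (by norm_num)) (hbi 2 (by norm_num)) (hbi 3 (by norm_num))
    (hσi 0 (by norm_num)) (hσi 1 (by norm_num)) (hσi 2 (by norm_num)) (hσi 3 (by norm_num))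
    (bp := fun ε a => b (a.2 + ε * eulerSlope b σ r ε a.2))
    (bm := fun ε a => b (a.2 + ε * eulerSlope b σ (-r) ε a.2))
    (bz := fun ε a => b (a.2 + ε * eulerSlope b σ 0 ε a.2))
    (sp := fun ε a => σ (a.2 + ε * eulerSlope b σ 1 ε a.2))
    (sm := fun ε a => σ (a.2 + ε * eulerSlope b σ (-1) ε a.2))
    (δp := fun ε a => ε * footSlope 2 b σ 1 ε a.2) (δm := fun ε a => ε * footSlope 2 b σ (-1) ε a.2)
    (δz := fun ε a => ε * footSlope 2 b σ 0 ε a.2)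
    ((hbU.isOrder_taylor (n := 3) (hδ r)).congr fun ε a => by
      simp only [Finset.sum_range_succ, Finset.sum_range_zero, iteratedDeriv_zero, eulerSlope,
        Nat.factorial]
      push_cast
      ring)
    ((hbU.isOrder_taylor (n := 3) (hδ (-r))).congr fun ε a => by
      simp only [Finset.sum_range_succ, Finset.sum_range_zero, iteratedDeriv_zero, eulerSlope,
        Nat.factorial]
      push_cast
      ring)
    (((hbU.of_le (m := 2) (by norm_num)).isOrder_taylor (n := 1) hδ0).congr fun ε a => by
      simp only [Finset.sum_range_succ, Finset.sum_range_zero, iteratedDeriv_zero, eulerSlope,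
        Nat.factorial]
      push_cast
      ring)
    ((hσU.isOrder_taylor (n := 3) (hδ 1)).congr fun ε a => by
      simp only [Finset.sum_range_succ, Finset.sum_range_zero, iteratedDeriv_zero, eulerSlope,
        Nat.factorial]
      push_cast
      ring)
    ((hσU.isOrder_taylor (n := 3) (hδ (-1))).congr fun ε a => by
      simp only [Finset.sum_range_succ, Finset.sum_range_zero, iteratedDeriv_zero, eulerSlope,
        Nat.factorial]
      push_cast
      ring)
    (fun ε a => by
      simp only [footSlope, platenSlope, ← hr, iteratedDeriv_zero, mul_one,
        if_neg (by norm_num : (2 : ℕ) ≠ 1)]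
      ring)
    (fun ε a => by
      simp only [footSlope, platenSlope, ← hr, iteratedDeriv_zero, mul_neg, mul_one,
        if_neg (by norm_num : (2 : ℕ) ≠ 1)]
      ring)
    (fun ε a => by
      simp only [footSlope, platenSlope, ← hr, iteratedDeriv_zero, mul_zero,
        if_neg (by norm_num : (2 : ℕ) ≠ 1)]
      ring)
  have hgi : ∀ i ≤ 6, IsOrder E 0 fun _ (a : ι × ℝ) => iteratedDeriv i (g a.1) a.2 :=
    fun i hi => hg.isOrder hi
  have tp := hg.isOrder_taylor (n := 5) hp
  have tm := hg.isOrder_taylor (n := 5) hm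
  have tz := hg.isOrder_taylor (n := 5) hz
  have k1 := (hgi 1 (by norm_num)).bdd_mul m1
  have k2 := ((hgi 2 (by norm_num)).div_const 2).bdd_mul m2
  have k3 := ((hgi 3 (by norm_num)).div_const 6).bdd_mul m3
  have k4 := ((hgi 4 (by norm_num)).div_const 24).bdd_mul m4
  have k5 := ((hgi 5 (by norm_num)).div_const 120).bdd_mul m5
  refine (((((((tp.const_mul (1 / 6)).add (tm.const_mul (1 / 6))).add (tz.const_mul (2 / 3))).add
    k1).add k2).add (k3.add (k4.add k5)))).congr fun ε a => ?_
  have hle : ((2 : ℕ) : WithTop ℕ∞) ≤ (4 : ℕ) := by norm_num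
  rw [generator_generator (hb.of_le hle) (hσ.of_le hle)
    ((hg.1 a.1).of_le (by norm_num : ((4 : ℕ) : WithTop ℕ∞) ≤ (6 : ℕ))) a.2]
  simp only [Fin.sum_univ_three, footWeight, footIndex, if_neg (by norm_num : (2 : ℕ) ≠ 1),
    Matrix.cons_val, Finset.sum_range_succ, Finset.sum_range_zero, generator, ← iteratedDeriv_one,
    iteratedDeriv_zero, Nat.factorial]
  generalize ε * footSlope 2 b σ 1 ε a.2 = D₁
  generalize ε * footSlope 2 b σ (-1) ε a.2 = D₂
  generalize ε * footSlope 2 b σ 0 ε a.2 = D₃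
  push_cast
  ring

end Expansion

/-! ### Local error in time -/

section PointwiseConsistency

variable {p : ℕ} {b σ : ℝ → ℝ} {r T E : ℝ} {f v : ℝ → ℝ → ℝ}

theorem isOrder_exp {α : Type*} (r : ℝ) (n : ℕ) : IsOrder E (2 * n) fun ε (_ : α) =>
    Real.exp (-r * ε ^ 2) - ∑ m ∈ Finset.range n, (-r * ε ^ 2) ^ m / m.factorial := by
  refine ⟨|r| ^ n * Real.exp (|r| * E ^ 2), by positivity, fun ε hε _ => ?_⟩
  have h := Complex.norm_exp_sub_sum_le_norm_mul_exp ((-r * ε ^ 2 : ℝ) : ℂ) n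
  have e : (Complex.exp ((-r * ε ^ 2 : ℝ) : ℂ) -
      ∑ m ∈ Finset.range n, ((-r * ε ^ 2 : ℝ) : ℂ) ^ m / m.factorial) =
      ((Real.exp (-r * ε ^ 2) - ∑ m ∈ Finset.range n, (-r * ε ^ 2) ^ m / m.factorial : ℝ) : ℂ) := by
    push_cast
    rfl
  rw [e, Complex.norm_real, Complex.norm_real, Real.norm_eq_abs, Real.norm_eq_abs] at h
  have hx : |-r * ε ^ 2| = |r| * ε ^ 2 := by rw [abs_mul, abs_neg, abs_sq]
  rw [hx] at h
  have h0 := hε.1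
  have h1 := hε.2
  calc _ ≤ (|r| * ε ^ 2) ^ n * Real.exp (|r| * ε ^ 2) := h
    _ ≤ (|r| * ε ^ 2) ^ n * Real.exp (|r| * E ^ 2) := by gcongr
    _ = _ := by rw [mul_pow, ← pow_mul]; ring

theorem generator_eq_zero_sub (w : ℝ → ℝ) (x : ℝ) :
    generator b σ r w x = generator b σ 0 w x - r * w x := by
  simp [generator]

theorem generator_timeDeriv {t : ℝ} (hv : ContDiff ℝ (2 : ℕ) (v t)) (hf : ContDiff ℝ (2 : ℕ) (f t))
    (hA : ContDiff ℝ (2 : ℕ) (generator b σ 0 (v t))) (x : ℝ) :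
    generator b σ r (timeDeriv b σ r f v t) x =
      generator b σ 0 (generator b σ 0 (v t)) x - r * generator b σ 0 (v t) x +
        generator b σ r (f t) x - r * (generator b σ 0 (v t) x - r * v t x) := by
  have e : timeDeriv b σ r f v t = fun x => (generator b σ 0 (v t) x - r * v t x) + f t x := by
    funext x
    rw [timeDeriv, generator_eq_zero_sub]
  have hrv : ContDiff ℝ (2 : ℕ) (fun x => r * v t x) := contDiff_const.mul hv
  have key : ∀ i ≤ 2, iteratedDeriv i (timeDeriv b σ r f v t) x =
      iteratedDeriv i (generator b σ 0 (v t)) x - r * iteratedDeriv i (v t) x +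
        iteratedDeriv i (f t) x := by
    intro i hi
    have hle : ((i : ℕ) : WithTop ℕ∞) ≤ (2 : ℕ) := by exact_mod_cast hi
    rw [e, iteratedDeriv_fun_add ((hA.sub hrv).of_le hle).contDiffAt (hf.of_le hle).contDiffAt,
      iteratedDeriv_fun_sub (hA.of_le hle).contDiffAt (hrv.of_le hle).contDiffAt,
      iteratedDeriv_const_mul_field]
  have k0 := key 0 (by norm_num)
  have k1 := key 1 (by norm_num)
  have k2 := key 2 le_rfl
  simp only [iteratedDeriv_zero, iteratedDeriv_one] at k0 k1
  have hA0 : generator b σ 0 (v t) x = σ x ^ 2 / 2 * iteratedDeriv 2 (v t) x + b x * deriv (v t) x := by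
    simp [generator]
  rw [generator, k0, k1, k2, generator_eq_zero_sub (f t)]
  rw [generator_eq_zero_sub (r := 0) (generator b σ 0 (v t))]
  simp only [generator]
  ring

theorem IsRegularSolution.isOrder_euler (H : IsRegularSolution 1 b σ r T f v) :
    IsOrder E 4 fun ε (a : Icc (0 : ℝ) T × ℝ) =>
      Real.exp (-r * ε ^ 2) * ∑ i, footWeight 1 i *
        v a.1 (a.2 + ε * footSlope 1 b σ (footIndex i) ε a.2) +
      sourceTerm 1 b σ r f (ε ^ 2) a.1 a.2 -
      (v a.1 a.2 + ε ^ 2 * timeDeriv b σ r f v a.1 a.2) := by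
  have hS := isOrder_euler_expansion (E := E) H.contDiff_b H.contDiff_σ H.periodic_b H.periodic_σ
    H.uniformCn
  have hx1 := isOrder_exp (α := Icc (0 : ℝ) T × ℝ) (E := E) r 2
  have hx0 : IsOrder E 0 fun ε (_ : Icc (0 : ℝ) T × ℝ) => Real.exp (-r * ε ^ 2) :=
    (isOrder_exp r 0).congr fun ε a => by simp
  have hv := H.uniformCn.isOrder (E := E) (Nat.zero_le _)
  have hA := (UniformCn.generator (r := 0) (uniformCn_of_periodic_one H.contDiff_b H.periodic_b)
    (uniformCn_of_periodic_one H.contDiff_σ H.periodic_σ) H.uniformCn).isOrder (E := E)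
      (Nat.zero_le _)
  simp only [iteratedDeriv_zero] at hv hA
  have he2 := IsOrder.eps₀ (α := Icc (0 : ℝ) T × ℝ) (E := E) |>.pow 2
  refine (((hx0.bdd_mul hS).add ((hv.add (he2.mul hA)).bdd_mul hx1)).add
    ((hA.const_mul (-r)).eps_mul 4)).congr fun ε a => ?_
  rw [sourceTerm, if_pos rfl, timeDeriv, generator_eq_zero_sub]
  simp only [Finset.sum_range_succ, Finset.sum_range_zero, Nat.factorial]
  generalize Real.exp (-r * ε ^ 2) = e
  push_cast
  ring

theorem IsRegularSolution.isOrder_platen (H : IsRegularSolution 2 b σ r T f v) :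
    IsOrder E 6 fun ε (a : Icc (0 : ℝ) T × ℝ) =>
      Real.exp (-r * ε ^ 2) * ∑ i, footWeight 2 i *
        v a.1 (a.2 + ε * footSlope 2 b σ (footIndex i) ε a.2) +
      sourceTerm 2 b σ r f (ε ^ 2) a.1 a.2 -
      (v a.1 a.2 + ε ^ 2 * timeDeriv b σ r f v a.1 a.2 +
        ε ^ 4 / 2 * timeDeriv₂ b σ r f v a.1 a.2) := by
  have hS := isOrder_platen_expansion (E := E) H.contDiff_b H.contDiff_σ H.periodic_b H.periodic_σ
    H.uniformCn
  have hx1 := isOrder_exp (α := Icc (0 : ℝ) T × ℝ) (E := E) r 3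
  have hx0 : IsOrder E 0 fun ε (_ : Icc (0 : ℝ) T × ℝ) => Real.exp (-r * ε ^ 2) :=
    (isOrder_exp r 0).congr fun ε a => by simp
  have hbU := uniformCn_of_periodic_one (ι := Icc (0 : ℝ) T) H.contDiff_b H.periodic_b
  have hσU := uniformCn_of_periodic_one (ι := Icc (0 : ℝ) T) H.contDiff_σ H.periodic_σ
  have hAU := UniformCn.generator (r := 0) hbU hσU H.uniformCn
  have hAAU := UniformCn.generator (r := 0) (hbU.of_le (m := 2) (by norm_num))
    (hσU.of_le (by norm_num)) hAU
  have hv := H.uniformCn.isOrder (E := E) (Nat.zero_le _)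
  have hA := hAU.isOrder (E := E) (Nat.zero_le _)
  have hAA := hAAU.isOrder (E := E) (Nat.zero_le _)
  simp only [iteratedDeriv_zero] at hv hA hAA
  have he2 := IsOrder.eps₀ (α := Icc (0 : ℝ) T × ℝ) (E := E) |>.pow 2
  -- The terms of order ε⁶ and ε⁸ in the product of the truncated exponential and the truncated
  -- expansion.
  have hR := ((hAA.const_mul (-r / 2)).add (hA.const_mul (r ^ 2 / 2))).add
    (he2.mul (hAA.const_mul (r ^ 2 / 4)))
  refine (((hx0.bdd_mul hS).add (((hv.add (he2.mul hA)).add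
    (((he2.mul he2).mul hAA).div_const 2)).bdd_mul hx1)).add (hR.eps_mul 6)).congr fun ε a => ?_
  have hle : ((2 : ℕ) : WithTop ℕ∞) ≤ (2 * 2 + 2 : ℕ) := by norm_num
  have hle' : ((2 : ℕ) : WithTop ℕ∞) ≤ (2 * 2 : ℕ) := by norm_num
  have hf : ContDiff ℝ (2 : ℕ) (f a.1) :=
    (H.contDiff_f.of_le hle').comp (contDiff_const.prodMk contDiff_id)
  rw [sourceTerm, if_neg (by norm_num), timeDeriv₂, generator_timeDeriv
    ((H.uniformCn.1 a.1).of_le hle) hf ((hAU.1 a.1).of_le hle'), timeDeriv,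
    generator_eq_zero_sub (v a.1)]
  simp only [Finset.sum_range_succ, Finset.sum_range_zero, Nat.factorial]
  generalize Real.exp (-r * ε ^ 2) = e
  push_cast
  ring

theorem IsRegularSolution.exists_consistency (hp : p = 1 ∨ p = 2)
    (H : IsRegularSolution p b σ r T f v) :
    ∃ K : ℝ, 0 ≤ K ∧ ∀ h t, 0 < h → 0 ≤ t → t + h ≤ T → ∀ x,
      |Real.exp (-r * h) * ∑ i, footWeight p i * v t (foot p b σ h (footIndex i) x) +
        sourceTerm p b σ r f h t x - v (t + h) x| ≤ K * h ^ (p + 1) := by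
  have hsq : ∀ h t, 0 < h → 0 ≤ t → t + h ≤ T → Real.sqrt h ^ 2 = h ∧
      Real.sqrt h ∈ Icc 0 (Real.sqrt T) := fun h t hh ht hT =>
    ⟨Real.sq_sqrt hh.le, Real.sqrt_nonneg h, Real.sqrt_le_sqrt (by linarith)⟩
  rcases hp with rfl | rfl
  · obtain ⟨K, hK, h1⟩ := H.isOrder_euler (E := Real.sqrt T)
    obtain ⟨L, hL, h2⟩ := H.exists_first_order (m := 0) rfl
    refine ⟨K + L, by positivity, fun h t hh ht hT x => ?_⟩
    obtain ⟨e, hm⟩ := hsq h t hh ht hT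
    have a1 := h1 _ hm ⟨⟨t, ht, by linarith⟩, x⟩
    have a2 := h2 0 le_rfl t (t + h) ht (by linarith) hT x
    beta_reduce at a1
    rw [show Real.sqrt h ^ 4 = (Real.sqrt h ^ 2) ^ 2 by ring, e] at a1
    simp only [iteratedDeriv_zero, add_sub_cancel_left] at a2
    simp only [foot_eq hh.le]
    rw [add_mul, show 1 + 1 = 2 from rfl]
    refine (le_of_eq (congrArg abs ?_)).trans ((abs_sub _ _).trans (add_le_add a1 a2))
    ring
  · obtain ⟨K, hK, h1⟩ := H.isOrder_platen (E := Real.sqrt T)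
    obtain ⟨L, hL, h2⟩ := H.exists_second_order
    refine ⟨K + L, by positivity, fun h t hh ht hT x => ?_⟩
    obtain ⟨e, hm⟩ := hsq h t hh ht hT
    have a1 := h1 _ hm ⟨⟨t, ht, by linarith⟩, x⟩
    have a2 := h2 t (t + h) ht (by linarith) hT x
    beta_reduce at a1
    rw [show Real.sqrt h ^ 4 = (Real.sqrt h ^ 2) ^ 2 by ring,
      show Real.sqrt h ^ 6 = (Real.sqrt h ^ 2) ^ 3 by ring, e] at a1
    simp only [add_sub_cancel_left] at a2
    simp only [foot_eq hh.le]
    rw [add_mul, show 2 + 1 = 3 from rfl]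
    refine (le_of_eq (congrArg abs ?_)).trans ((abs_sub _ _).trans (add_le_add a1 a2))
    ring

end PointwiseConsistency

/-! ### Approximation by cellwise Taylor polynomials -/

section CellTaylor

variable {k M : ℕ} {g φ y : ℝ → ℝ} {B : ℝ}

/-- `1`-periodic functions of class `C^{k+1}` whose derivative of order `k + 1` is bounded
by `B`. -/
structure HasTaylorBound (k : ℕ) (B : ℝ) (g : ℝ → ℝ) : Prop where
  contDiff : ContDiff ℝ (k + 1 : ℕ) g
  periodic : Function.Periodic g 1
  bound : ∀ x, |iteratedDeriv (k + 1) g x| ≤ B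

theorem HasTaylorBound.nonneg (hg : HasTaylorBound k B g) : 0 ≤ B :=
  (abs_nonneg _).trans (hg.bound 0)

theorem HasTaylorBound.mono {B' : ℝ} (hg : HasTaylorBound k B g) (h : B ≤ B') :
    HasTaylorBound k B' g :=
  ⟨hg.contDiff, hg.periodic, fun x => (hg.bound x).trans h⟩

/-- The piecewise Taylor polynomial of degree `k` at the left end points of the mesh cells. -/
noncomputable def cellTaylor (k M : ℕ) (g : ℝ → ℝ) (x : ℝ) : ℝ :=
  ∑ i ∈ Finset.range (k + 1), iteratedDeriv i g ((⌊(M : ℝ) * x⌋ : ℝ) / M) / i.factorial *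
    (x - (⌊(M : ℝ) * x⌋ : ℝ) / M) ^ i

theorem cellTaylor_mem_dgSpace (hM : 0 < M) (hg : Function.Periodic g 1) :
    cellTaylor k M g ∈ dgSpace k M := by
  have hM' : (M : ℝ) ≠ 0 := by exact_mod_cast hM.ne'
  refine ⟨fun x => ?_, fun j => ?_⟩
  · have h1 : ((⌊(M : ℝ) * (x + 1)⌋ : ℝ) / M) = (⌊(M : ℝ) * x⌋ : ℝ) / M + 1 := by
      rw [mul_add, mul_one, Int.floor_add_natCast]
      push_cast
      field_simp
    rw [cellTaylor, h1]
    refine Finset.sum_congr rfl fun i _ => ?_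
    rw [hg.iteratedDeriv i, add_sub_add_right_eq_sub]
  · refine ⟨∑ i ∈ Finset.range (k + 1), Polynomial.C (iteratedDeriv i g ((j : ℝ) / M) / i.factorial) *
      (Polynomial.X - Polynomial.C ((j : ℝ) / M)) ^ i, ?_, fun x hx => ?_⟩
    · refine Polynomial.natDegree_sum_le_of_forall_le _ _ fun i hi => ?_
      refine (Polynomial.natDegree_C_mul_le _ _).trans (Polynomial.natDegree_pow_le.trans ?_)
      rw [Polynomial.natDegree_X_sub_C, mul_one]
      exact Nat.lt_succ_iff.1 (Finset.mem_range.1 hi)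
    · rw [cellTaylor, floor_eq_of_mem_meshCell hM hx, Polynomial.eval_finsetSum]
      simp

theorem HasTaylorBound.abs_sub_cellTaylor_le (hg : HasTaylorBound k B g) (hM : 0 < M) (x : ℝ) :
    |g x - cellTaylor k M g x| ≤ B * (1 / (M : ℝ)) ^ (k + 1) := by
  have hM' : (0 : ℝ) < M := by exact_mod_cast hM
  have h := abs_sub_taylor_le k hg.contDiff hg.bound ((⌊(M : ℝ) * x⌋ : ℝ) / M)
    (x - (⌊(M : ℝ) * x⌋ : ℝ) / M)
  rw [add_sub_cancel] at h
  refine h.trans (mul_le_mul_of_nonneg_left (pow_le_pow_left₀ (abs_nonneg _) ?_ _) hg.nonneg)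
  have e : x - (⌊(M : ℝ) * x⌋ : ℝ) / M = Int.fract ((M : ℝ) * x) / M := by
    rw [Int.fract]; field_simp
  rw [e, abs_of_nonneg (div_nonneg (Int.fract_nonneg _) hM'.le)]
  exact div_le_div_of_nonneg_right (Int.fract_lt_one _).le hM'.le

theorem HasTaylorBound.normL2_sub_cellTaylor_le (hg : HasTaylorBound k B g) (hM : 0 < M) :
    normL2 (fun x => g x - cellTaylor k M g x) ≤ B * (1 / (M : ℝ)) ^ (k + 1) :=
  normL2_le_of_bound hM (hg.contDiff.continuous.isCutContinuous.sub
    (isCutContinuous_of_dgSpace (cellTaylor_mem_dgSpace hM hg.periodic)))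
    (mul_nonneg hg.nonneg (by positivity)) fun _ _ x _ => hg.abs_sub_cellTaylor_le hM x

theorem HasTaylorBound.abs_integral_sub_cellTaylor_mul_le (hg : HasTaylorBound k B g) (hM : 0 < M)
    (hφ : φ ∈ dgSpace k M) :
    |∫ x in (0 : ℝ)..1, (g x - cellTaylor k M g x) * φ x| ≤
      B * (1 / (M : ℝ)) ^ (k + 1) * normL2 φ :=
  (abs_integral_mul_le hM (hg.contDiff.continuous.isCutContinuous.sub
    (isCutContinuous_of_dgSpace (cellTaylor_mem_dgSpace hM hg.periodic)))
    (isCutContinuous_of_dgSpace hφ)).trans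
    (mul_le_mul_of_nonneg_right (hg.normL2_sub_cellTaylor_le hM) (normL2_nonneg _))

/-- Quadrature and integral agree on the cell Taylor polynomial times φ, since cutting a cell
preserves exactness. The remainder is small uniformly and is paired with φ by Cauchy–Schwarz on each
side. -/
theorem HasTaylorBound.abs_cutQuad_sub_integral_le (hg : HasTaylorBound k B g) (hM : 0 < M)
    (hy : IsDegreeOneLift y) (hφ : φ ∈ dgSpace k M) :
    |cutQuad k M y (fun x => g x * φ x) - ∫ x in (0 : ℝ)..1, g x * φ x| ≤
      2 * (B * (1 / (M : ℝ)) ^ (k + 1)) * normL2 φ := by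
  have hπ := cellTaylor_mem_dgSpace (k := k) hM hg.periodic
  have h1 := abs_cutQuad_mul_le_of_bound hM hy (mul_nonneg hg.nonneg (by positivity))
    (fun _ _ x _ => hg.abs_sub_cellTaylor_le hM x) hφ
  have h2 := hg.abs_integral_sub_cellTaylor_mul_le hM hφ
  have e1 := cutQuad_mul_eq hM hy hπ hφ
  have iG : IntervalIntegrable (fun x => g x * φ x) volume 0 1 :=
    (hg.contDiff.continuous.isCutContinuous.mul
      (isCutContinuous_of_dgSpace hφ)).intervalIntegrable hM isDegreeOneLift_id
  have iP : IntervalIntegrable (fun x => cellTaylor k M g x * φ x) volume 0 1 :=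
    ((isCutContinuous_of_dgSpace hπ).mul
      (isCutContinuous_of_dgSpace hφ)).intervalIntegrable hM isDegreeOneLift_id
  simp only [sub_mul] at h1 h2
  rw [cutQuad_sub hy, e1] at h1
  rw [intervalIntegral.integral_sub iG iP] at h2
  rw [abs_le] at *
  constructor <;> linarith

end CellTaylor

/-! ### Error of one step -/

section Step

variable {k p M : ℕ} {b σ : ℝ → ℝ} {r h t A B S : ℝ} {f : ℝ → ℝ → ℝ} {u u' w w' φ : ℝ → ℝ}

theorem abs_sldgForm_le (hM : 0 < M)
    (hy : ∀ i, IsDegreeOneLift (foot p b σ h (footIndex i))) (hφ : φ ∈ dgSpace k M) (hS : 0 ≤ S)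
    (hstab : ∑ i, footWeight p i * cutQuad k M (foot p b σ h (footIndex i))
      (fun x => u (foot p b σ h (footIndex i) x) ^ 2) ≤ S ^ 2 * ∫ x in (0 : ℝ)..1, u x ^ 2) :
    |sldgForm p k M b σ h u φ| ≤ S * normL2 u * normL2 φ := by
  have h0 : ∀ i, 0 ≤ cutQuad k M (foot p b σ h (footIndex i))
      (fun x => u (foot p b σ h (footIndex i) x) ^ 2) := fun i =>
    cutQuad_nonneg (hy i) fun _ _ _ _ => sq_nonneg _
  -- Jensen's inequality for the weights: averaging before squaring preserves the cancellation of
  -- order ε in the stability bound.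
  have h1 : ∑ i, footWeight p i * Real.sqrt (cutQuad k M (foot p b σ h (footIndex i))
      (fun x => u (foot p b σ h (footIndex i) x) ^ 2)) ≤ S * normL2 u := by
    refine le_of_sq_le_sq ?_ (mul_nonneg hS (normL2_nonneg u))
    refine (Real.pow_arith_mean_le_arith_mean_pow Finset.univ _ _
      (fun i _ => footWeight_nonneg p i) (sum_footWeight p) (fun i _ => Real.sqrt_nonneg _) 2).trans ?_
    rw [mul_pow, sq_normL2]
    simpa only [Real.sq_sqrt (h0 _)] using hstab
  rw [sldgForm_eq_sum]
  refine (Finset.abs_sum_le_sum_abs _ _).trans ?_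
  refine le_trans ?_ (mul_le_mul_of_nonneg_right h1 (normL2_nonneg φ))
  rw [Finset.sum_mul]
  refine Finset.sum_le_sum fun i _ => ?_
  rw [abs_mul, abs_of_nonneg (footWeight_nonneg p i), mul_assoc]
  refine mul_le_mul_of_nonneg_left ?_ (footWeight_nonneg p i)
  have h2 := abs_cutQuad_mul_le (k := k) (M := M) (hy i)
    (fun x => u (foot p b σ h (footIndex i) x)) φ
  rwa [cutQuad_sq_eq hM (hy i) hφ] at h2

theorem sldgForm_sub (hy : ∀ i, IsDegreeOneLift (foot p b σ h (footIndex i))) :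
    sldgForm p k M b σ h (fun x => u x - w x) φ =
      sldgForm p k M b σ h u φ - sldgForm p k M b σ h w φ := by
  simp only [sldgForm_eq_sum, sub_mul, cutQuad_sub (hy _), mul_sub, Finset.sum_sub_distrib]

theorem abs_sum_footWeight_mul_le {F : Fin 3 → ℝ} (hF : ∀ i, |F i| ≤ B) :
    |∑ i, footWeight p i * F i| ≤ B := by
  calc _ ≤ ∑ i, footWeight p i * B := by
        refine (Finset.abs_sum_le_sum_abs _ _).trans (Finset.sum_le_sum fun i _ => ?_)
        rw [abs_mul, abs_of_nonneg (footWeight_nonneg p i)]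
        exact mul_le_mul_of_nonneg_left (hF i) (footWeight_nonneg p i)
    _ = B := by rw [← Finset.sum_mul, sum_footWeight, one_mul]

theorem abs_sldgForm_sub_cellTaylor_le (hM : 0 < M)
    (hy : ∀ i, IsDegreeOneLift (foot p b σ h (footIndex i))) (hw : HasTaylorBound k B w)
    (hφ : φ ∈ dgSpace k M) :
    |sldgForm p k M b σ h w φ - sldgForm p k M b σ h (cellTaylor k M w) φ| ≤
      B * (1 / (M : ℝ)) ^ (k + 1) * normL2 φ := by
  rw [← sldgForm_sub hy, sldgForm_eq_sum]
  exact abs_sum_footWeight_mul_le fun i => abs_cutQuad_mul_le_of_bound hM (hy i)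
    (mul_nonneg hw.nonneg (by positivity)) (fun _ _ x _ => hw.abs_sub_cellTaylor_le hM _) hφ

/-- The Taylor bound is applied to the smooth compositions w ∘ y^q, not to w: the composition of π w
with a foot would not be polynomial on the cut intervals. -/
theorem abs_sldgForm_sub_integral_le (hM : 0 < M)
    (hy : ∀ i, IsDegreeOneLift (foot p b σ h (footIndex i)))
    (hw : ∀ i, HasTaylorBound k B fun x => w (foot p b σ h (footIndex i) x))
    (hφ : φ ∈ dgSpace k M) :
    |sldgForm p k M b σ h w φ -
      ∫ x in (0 : ℝ)..1, (∑ i, footWeight p i * w (foot p b σ h (footIndex i) x)) * φ x| ≤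
      2 * (B * (1 / (M : ℝ)) ^ (k + 1)) * normL2 φ := by
  have e : ∫ x in (0 : ℝ)..1, (∑ i, footWeight p i * w (foot p b σ h (footIndex i) x)) * φ x =
      ∑ i, footWeight p i * ∫ x in (0 : ℝ)..1, w (foot p b σ h (footIndex i) x) * φ x := by
    simp only [← intervalIntegral.integral_const_mul]
    rw [← intervalIntegral.integral_finsetSum]
    · simp only [Finset.sum_mul, mul_assoc]
    · intro i _
      exact (((hw i).contDiff.continuous.isCutContinuous.mul
        (isCutContinuous_of_dgSpace hφ)).intervalIntegrable hM isDegreeOneLift_id).const_mul _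
  rw [e, sldgForm_eq_sum, ← Finset.sum_sub_distrib]
  simp only [← mul_sub]
  exact abs_sum_footWeight_mul_le fun i => (hw i).abs_cutQuad_sub_integral_le hM (hy i) hφ

/-- Test the step with φ = u' − π w' and follow the chain from u to π w (stability), from π w to w
(error 1), from quadrature to the integral of the average (error 2), from the source quadrature to
its integral (error 2), from there to w' (consistency, A), and from w' to π w' (error 1). The unit
is B Δx^{k+1}; the first two errors carry the exponential factor, whence 3 exp(−r h) + 3. -/
theorem IsSLDGStep.normL2_sub_cellTaylor_le (hM : 0 < M)
    (hy : ∀ i, IsDegreeOneLift (foot p b σ h (footIndex i))) (hS : 0 ≤ S)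
    (hstab : ∀ z ∈ dgSpace k M, ∑ i, footWeight p i * cutQuad k M (foot p b σ h (footIndex i))
      (fun x => z (foot p b σ h (footIndex i) x) ^ 2) ≤ S ^ 2 * ∫ x in (0 : ℝ)..1, z x ^ 2)
    (hu : u ∈ dgSpace k M) (hstep : IsSLDGStep p k M b σ r f h t u u')
    (hw : HasTaylorBound k B w) (hw' : HasTaylorBound k B w')
    (hwy : ∀ i, HasTaylorBound k B fun x => w (foot p b σ h (footIndex i) x))
    (hf : HasTaylorBound k B (sourceTerm p b σ r f h t)) (hA : 0 ≤ A)
    (hcons : ∀ x, |Real.exp (-r * h) * ∑ i, footWeight p i * w (foot p b σ h (footIndex i) x) +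
      sourceTerm p b σ r f h t x - w' x| ≤ A) :
    normL2 (fun x => u' x - cellTaylor k M w' x) ≤
      Real.exp (-r * h) * S * normL2 (fun x => u x - cellTaylor k M w x) +
        ((3 * Real.exp (-r * h) + 3) * B * (1 / (M : ℝ)) ^ (k + 1) + A) := by
  obtain ⟨hu', hstep⟩ := hstep
  have hπ := cellTaylor_mem_dgSpace (k := k) hM hw.periodic
  have hπ' := cellTaylor_mem_dgSpace (k := k) hM hw'.periodic
  have heu := dgSpace_sub hu hπ
  have hφ := dgSpace_sub hu' hπ'
  set φ : ℝ → ℝ := fun x => u' x - cellTaylor k M w' x with hφdef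
  have hφc := isCutContinuous_of_dgSpace (y := id) hφ
  have hint : ∀ {F : ℝ → ℝ}, IsCutContinuous M id F →
      IntervalIntegrable (fun x => F x * φ x) volume 0 1 := fun hF =>
    (hF.mul hφc).intervalIntegrable hM isDegreeOneLift_id
  set δ := (1 / (M : ℝ)) ^ (k + 1)
  set e := Real.exp (-r * h)
  have he : 0 < e := Real.exp_pos _
  have s1 := abs_sldgForm_le hM hy hφ hS (hstab _ heu)
  rw [sldgForm_sub hy] at s1
  have s2 := abs_sldgForm_sub_cellTaylor_le hM hy hw hφ
  have s3 := abs_sldgForm_sub_integral_le hM hy hwy hφ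
  have s4 := hf.abs_cutQuad_sub_integral_le hM isDegreeOneLift_id hφ
  rw [← meshQuad_eq_cutQuad_id hM] at s4
  have s5 := hw'.abs_integral_sub_cellTaylor_mul_le hM hφ
  have cG : IsCutContinuous M id fun x => ∑ i, footWeight p i * w (foot p b σ h (footIndex i) x) :=
    (continuous_finsetSum _ fun i _ =>
      continuous_const.mul (hwy i).contDiff.continuous).isCutContinuous
  have cF : IsCutContinuous M id (sourceTerm p b σ r f h t) :=
    hf.contDiff.continuous.isCutContinuous
  have cw' : IsCutContinuous M id w' := hw'.contDiff.continuous.isCutContinuous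
  have cπ' := isCutContinuous_of_dgSpace (y := id) hπ'
  have ceG : IsCutContinuous M id fun x =>
      e * ∑ i, footWeight p i * w (foot p b σ h (footIndex i) x) :=
    (continuous_const.isCutContinuous (F := fun _ => e)).mul cG
  have s6 := (abs_integral_mul_le hM ((ceG.add cF).sub cw') hφc).trans
    (mul_le_mul_of_nonneg_right (normL2_le_of_bound hM ((ceG.add cF).sub cw') hA
      fun _ _ x _ => hcons x) (normL2_nonneg φ))
  have i6 : ∫ x in (0 : ℝ)..1, (e * ∑ i, footWeight p i * w (foot p b σ h (footIndex i) x) +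
      sourceTerm p b σ r f h t x - w' x) * φ x =
      e * (∫ x in (0 : ℝ)..1, (∑ i, footWeight p i * w (foot p b σ h (footIndex i) x)) * φ x) +
        (∫ x in (0 : ℝ)..1, sourceTerm p b σ r f h t x * φ x) - ∫ x in (0 : ℝ)..1, w' x * φ x := by
    rw [← intervalIntegral.integral_const_mul, ← intervalIntegral.integral_add
      ((hint cG).const_mul e) (hint cF), ← intervalIntegral.integral_sub
      (((hint cG).const_mul e).add (hint cF)) (hint cw')]
    exact intervalIntegral.integral_congr fun x _ => by ring
  rw [i6] at s6
  simp only [sub_mul] at s5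
  rw [intervalIntegral.integral_sub (hint cw') (hint cπ')] at s5
  have hsq : normL2 φ ^ 2 = (∫ x in (0 : ℝ)..1, u' x * φ x) -
      ∫ x in (0 : ℝ)..1, cellTaylor k M w' x * φ x := by
    rw [sq_normL2, ← intervalIntegral.integral_sub (hint (isCutContinuous_of_dgSpace hu'))
      (hint cπ')]
    exact intervalIntegral.integral_congr fun x _ => by simp only [hφdef]; ring
  rw [hstep φ hφ] at hsq
  -- Every estimate carries a factor ‖φ‖, which is divided out of ‖φ‖² unless it is zero.
  rcases (normL2_nonneg φ).eq_or_lt with h0 | h0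
  · rw [← h0]
    have := normL2_nonneg fun x => u x - cellTaylor k M w x
    have := hw.nonneg
    positivity
  refine le_of_mul_le_mul_right ?_ h0
  rw [← sq, hsq]
  have t1 := mul_le_mul_of_nonneg_left (abs_le.1 s1).2 he.le
  have t2 := mul_le_mul_of_nonneg_left (abs_le.1 s2).1 he.le
  have t3 := mul_le_mul_of_nonneg_left (abs_le.1 s3).2 he.le
  have t4 := (abs_le.1 s4).2
  have t5 := (abs_le.1 s5).2
  have t6 := (abs_le.1 s6).2
  linarith

end Step

/-- Discrete Gronwall inequality; each term of the geometric sum is bounded by q ^ n, so no division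
by q − 1 occurs. -/
theorem le_pow_mul_of_le_mul_add {a : ℕ → ℝ} {q d : ℝ} (hq : 1 ≤ q) (hd : 0 ≤ d) {N : ℕ}
    (h : ∀ n < N, a (n + 1) ≤ q * a n + d) : ∀ n ≤ N, a n ≤ q ^ n * (a 0 + n * d) := by
  intro n
  induction n with
  | zero => intro _; simp
  | succ n ih =>
    intro hn
    have h1 := ih (by omega)
    have h2 : d ≤ q ^ (n + 1) * d := le_mul_of_one_le_left hd (one_le_pow₀ hq)
    calc a (n + 1) ≤ q * a n + d := h n (by omega)
      _ ≤ q * (q ^ n * (a 0 + n * d)) + q ^ (n + 1) * d :=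
          add_le_add (mul_le_mul_of_nonneg_left h1 (by linarith)) h2
      _ = _ := by push_cast; ring

/-! ### Uniform constants for the step estimate -/

section Assembly

variable {k p : ℕ} {b σ : ℝ → ℝ} {r T : ℝ} {f v : ℝ → ℝ → ℝ}

/-- The square root of the time step is made part of the index, so that the bounds hold for all
steps up to T at once. -/
theorem uniformCn_comp_foot {n q : ℕ} {ι : Type*} {g : ι → ℝ → ℝ} (hg : UniformCn n g)
    (hb : ContDiff ℝ q b) (hσ : ContDiff ℝ q σ) (hq : n + 1 ≤ q)
    (hb_per : Function.Periodic b 1) (hσ_per : Function.Periodic σ 1) (i : Fin 3) :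
    UniformCn n (fun (ω : ι × Icc 0 (Real.sqrt T)) x =>
      g ω.1 (x + ω.2 * footSlope p b σ (footIndex i) ω.2 x)) := by
  have hZ : ContDiff ℝ (n + 1 : ℕ) (Function.uncurry (footSlope p b σ (footIndex i))) :=
    (contDiff_footSlope hb hσ _).of_le (by exact_mod_cast hq)
  have hZU := (uniformCn_of_periodic hZ (footSlope_periodic hb_per hσ_per _) 0
    (Real.sqrt T)).reindex (fun ω : ι × Icc 0 (Real.sqrt T) => ω.2)
  have hd : ∀ ω : ι × Icc 0 (Real.sqrt T), Differentiable ℝ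
      (footSlope p b σ (footIndex i) ω.2) := fun ω => (hZU.1 ω).differentiable (by norm_cast)
  refine UniformCn.comp (y := fun (ω : ι × Icc 0 (Real.sqrt T)) x =>
    x + ω.2 * footSlope p b σ (footIndex i) ω.2 x) (hg.reindex Prod.fst)
    (fun ω => differentiable_id.add ((hd ω).const_mul _)) ?_
  have h1 : UniformCn n (fun (_ : ι × Icc 0 (Real.sqrt T)) (_ : ℝ) => (1 : ℝ)) :=
    uniformCn_const fun _ => le_refl |(1 : ℝ)|
  have h2 : UniformCn n (fun (ω : ι × Icc 0 (Real.sqrt T)) (_ : ℝ) => (ω.2 : ℝ)) :=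
    uniformCn_const fun ω => (abs_of_nonneg ω.2.2.1).trans_le ω.2.2.2
  convert h1.add (h2.mul hZU.deriv) using 3 with ω x
  exact ((hasDerivAt_id x).add (((hd ω) x).hasDerivAt.const_mul _)).deriv

/-- With n = k + 1 the class required of f is exactly k + 2p. -/
theorem uniformCn_sourceTerm {n : ℕ} (hp : p = 1 ∨ p = 2) (hb : ContDiff ℝ n b)
    (hσ : ContDiff ℝ n σ) (hb_per : Function.Periodic b 1) (hσ_per : Function.Periodic σ 1)
    (hf : ContDiff ℝ (n + 2 * p - 1 : ℕ) (Function.uncurry f)) (hf_per : ∀ t, Function.Periodic (f t) 1) :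
    UniformCn n (fun ω : Icc 0 T × Icc 0 T => sourceTerm p b σ r f ω.2 ω.1) := by
  have hc : UniformCn n (fun (ω : Icc 0 T × Icc 0 T) (_ : ℝ) => (ω.2 : ℝ)) :=
    uniformCn_const fun ω => (abs_of_nonneg ω.2.2.1).trans_le ω.2.2.2
  have hfU := (uniformCn_of_periodic hf hf_per 0 T).reindex (fun ω : Icc 0 T × Icc 0 T => ω.1)
  rcases hp with rfl | rfl
  · convert hc.mul (hfU.of_le (m := n) (by omega)) using 3 with ω x
    rw [sourceTerm, if_pos rfl]
  · have hft : UniformCn n (fun s : Icc 0 T => fun x => deriv (fun s' => f s' x) s) :=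
      uniformCn_of_periodic (contDiff_deriv_fst hf (by omega))
        (fun s x => by simp only [hf_per _ x]) 0 T
    have hA := UniformCn.generator (r := r) (uniformCn_of_periodic_one hb hb_per)
      (uniformCn_of_periodic_one hσ hσ_per) (hfU.of_le (m := n + 2) (by omega))
    convert (hc.mul (hfU.of_le (by omega))).add (((hc.mul hc).const_mul (1 / 2)).mul
      (hA.add (hft.reindex Prod.fst))) using 3 with ω x
    rw [sourceTerm, if_neg (by norm_num)]
    ring

theorem generator_periodic {w : ℝ → ℝ} (hb : Function.Periodic b 1) (hσ : Function.Periodic σ 1)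
    (hw : Function.Periodic w 1) : Function.Periodic (generator b σ r w) 1 := fun x => by
  have h1 := hw.iteratedDeriv 1 x
  rw [iteratedDeriv_one] at h1
  rw [generator, generator, hb, hσ, hw, h1, hw.iteratedDeriv 2]

theorem sourceTerm_periodic (hb : Function.Periodic b 1) (hσ : Function.Periodic σ 1)
    (hf : ∀ t, Function.Periodic (f t) 1) (h t : ℝ) :
    Function.Periodic (sourceTerm p b σ r f h t) 1 := fun x => by
  simp only [sourceTerm, hf _ x, generator_periodic hb hσ (hf t) x]

theorem UniformCn.exists_hasTaylorBound {ι : Type*} {g : ι → ℝ → ℝ} (hg : UniformCn (k + 1) g)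
    (hper : ∀ ω, Function.Periodic (g ω) 1) : ∃ B : ℝ, 0 ≤ B ∧ ∀ ω, HasTaylorBound k B (g ω) := by
  obtain ⟨hc, K, hK, h⟩ := hg
  exact ⟨K, hK, fun ω => ⟨hc ω, hper ω, h (k + 1) le_rfl ω⟩⟩

theorem exists_stability_foot (k p : ℕ) (hp : p = 1 ∨ p = 2) (hb_per : Function.Periodic b 1)
    (hσ_per : Function.Periodic σ 1) (hb : ContDiff ℝ (max (2 * k + 2) (2 * p) : ℕ) b)
    (hσ : ContDiff ℝ (max (2 * k + 2) (2 * p) : ℕ) σ) (lam : ℝ) {θ : ℝ} (hθ : θ < 1) :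
    ∃ L : ℝ, 0 ≤ L ∧ ∀ (M : ℕ) (h : ℝ), 0 < M → 0 ≤ h → (1 / (M : ℝ)) ^ 4 ≤ lam * h →
      StepCondition p b σ θ h → (∀ i, IsDegreeOneLift (foot p b σ h (footIndex i))) ∧
      ∀ u ∈ dgSpace k M, ∑ i, footWeight p i * cutQuad k M (foot p b σ h (footIndex i))
        (fun x => u (foot p b σ h (footIndex i) x) ^ 2) ≤
          (1 + L * h) * ∫ x in (0 : ℝ)..1, u x ^ 2 := by
  obtain ⟨K, hK, hσK, hfoot⟩ := exists_footBounds k p hp hb_per hσ_per hb hσ hθ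
  have h1 : (1 : WithTop ℕ∞) ≤ (max (2 * k + 2) (2 * p) : ℕ) := by
    exact_mod_cast le_max_of_le_left (by omega)
  have hσ' : Continuous (deriv σ) := hσ.continuous_deriv h1
  have hσ'per : Function.Periodic (deriv σ) 1 := by simpa using hσ_per.iteratedDeriv 1
  obtain ⟨L, hL, hstab⟩ := exists_stability k K (1 - θ) hK (by linarith) (footWeight p)
    (fun i => footCoeff p (footIndex i)) (footWeight_nonneg p) (sum_footWeight p)
    (sum_footWeight_mul_footCoeff p) hσ' hσ'per hσK lam
  refine ⟨L, hL, fun M h hM hh hcfl hstep => ?_⟩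
  have hF := hfoot h hh hstep
  refine ⟨fun i => (hF i).lift, fun u hu => ?_⟩
  have := hstab M (Real.sqrt h) (fun i => foot p b σ h (footIndex i)) u hM (Real.sqrt_nonneg h)
    (by rwa [Real.sq_sqrt hh]) hF hu
  rwa [Real.sq_sqrt hh] at this

theorem exists_step_error (hp : p = 1 ∨ p = 2) (hb_per : Function.Periodic b 1)
    (hσ_per : Function.Periodic σ 1) (hb : ContDiff ℝ (max (2 * k + 2) (2 * p) : ℕ) b)
    (hσ : ContDiff ℝ (max (2 * k + 2) (2 * p) : ℕ) σ)
    (hf : ContDiff ℝ (k + 2 * p : ℕ) (Function.uncurry f)) (hf_per : ∀ t, Function.Periodic (f t) 1)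
    (hsol : IsPeriodicSolution b σ r f T v) (hv : HasBoundedXDeriv (max (2 * p + 2) (k + 1)) T v) :
    ∃ B : ℝ, 0 ≤ B ∧ (∀ t ∈ Icc 0 T, HasTaylorBound k B (v t)) ∧
      ∀ (M : ℕ) (S h t : ℝ) (u u' : ℝ → ℝ), 0 < M → 0 ≤ S → 0 < h → 0 ≤ t → t + h ≤ T →
      (∀ i, IsDegreeOneLift (foot p b σ h (footIndex i))) →
      (∀ z ∈ dgSpace k M, ∑ i, footWeight p i * cutQuad k M (foot p b σ h (footIndex i))
        (fun x => z (foot p b σ h (footIndex i) x) ^ 2) ≤ S ^ 2 * ∫ x in (0 : ℝ)..1, z x ^ 2) →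
      u ∈ dgSpace k M → IsSLDGStep p k M b σ r f h t u u' →
      normL2 (fun x => u' x - cellTaylor k M (v (t + h)) x) ≤
        Real.exp (-r * h) * S * normL2 (fun x => u x - cellTaylor k M (v t) x) +
          B * ((1 / (M : ℝ)) ^ (k + 1) + h ^ (p + 1)) := by
  have hkm : k + 2 ≤ max (2 * k + 2) (2 * p) := le_max_of_le_left (by omega)
  have hpm : 2 * p ≤ max (2 * k + 2) (2 * p) := le_max_right _ _
  have hU := uniformCn_solution hsol.periodic hsol.continuousOn hv
  have H : IsRegularSolution p b σ r T f v :=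
    { contDiff_b := hb.of_le (by exact_mod_cast hpm)
      contDiff_σ := hσ.of_le (by exact_mod_cast hpm)
      periodic_b := hb_per
      periodic_σ := hσ_per
      contDiff_f := hf.of_le (by norm_cast; omega)
      periodic_f := hf_per
      solution := hsol
      uniformCn := hU.of_le (le_max_left _ _) }
  have hUk : UniformCn (k + 1) (fun t : Icc 0 T => v t) := hU.of_le (le_max_right _ _)
  obtain ⟨B₁, hB₁, h₁⟩ := hUk.exists_hasTaylorBound fun t => hsol.periodic t t.2
  choose B₂ hB₂ h₂ using fun i : Fin 3 => (uniformCn_comp_foot (T := T) (p := p) hUk hb hσ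
    hkm hb_per hσ_per i).exists_hasTaylorBound fun ω x => by
      rw [footSlope_periodic hb_per hσ_per _ _ x, add_right_comm, hsol.periodic _ ω.1.2]
  have hk1 : ((k + 1 : ℕ) : WithTop ℕ∞) ≤ (max (2 * k + 2) (2 * p) : ℕ) := by
    exact_mod_cast le_max_of_le_left (by omega)
  obtain ⟨B₃, hB₃, h₃⟩ := (uniformCn_sourceTerm (T := T) (r := r) hp (hb.of_le hk1) (hσ.of_le hk1)
    hb_per hσ_per (hf.of_le (by norm_cast; omega)) hf_per).exists_hasTaylorBound
      fun ω => sourceTerm_periodic hb_per hσ_per hf_per _ _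
  obtain ⟨K, hK, hcons⟩ := H.exists_consistency hp
  obtain ⟨B, hBd⟩ : ∃ B, B = B₁ + ∑ i, B₂ i + B₃ := ⟨_, rfl⟩
  have hsum : 0 ≤ ∑ i, B₂ i := Finset.sum_nonneg fun i _ => hB₂ i
  have hB : 0 ≤ B := by rw [hBd]; positivity
  -- A bound for exp(−r h) over all h ≤ T. Dependence on T is allowed here, as it only enters the
  -- constant of the error term.
  obtain ⟨G, hG⟩ : ∃ G, G = Real.exp (|r| * T) := ⟨_, rfl⟩
  have hG0 : 0 < G := hG ▸ Real.exp_pos _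
  have hBG : B ≤ (3 * G + 3) * B + K := by nlinarith [mul_nonneg hG0.le hB]
  refine ⟨(3 * G + 3) * B + K, by positivity, fun t ht => (h₁ ⟨t, ht⟩).mono (by linarith), ?_⟩
  intro M S h t u u' hM hS hh ht htT hy hstab hu hstep
  have hmem : ∀ {s : ℝ}, 0 ≤ s → s ≤ T → HasTaylorBound k B (v s) := fun h0 h1 =>
    (h₁ ⟨_, h0, h1⟩).mono (by linarith)
  have key := hstep.normL2_sub_cellTaylor_le hM hy hS hstab hu (hmem ht (by linarith))
    (hmem (by linarith) htT) (fun i => by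
      have := h₂ i (⟨t, ht, by linarith⟩,
        ⟨Real.sqrt h, Real.sqrt_nonneg h, Real.sqrt_le_sqrt (by linarith)⟩)
      simp only [foot_eq hh.le]
      refine this.mono ?_
      have := Finset.single_le_sum (fun i _ => hB₂ i) (Finset.mem_univ i)
      linarith)
    ((h₃ (⟨t, ht, by linarith⟩, ⟨h, hh.le, by linarith⟩)).mono (by linarith))
    (by positivity) (hcons h t hh ht htT)
  refine key.trans (add_le_add le_rfl ?_)
  have he : Real.exp (-r * h) ≤ G := by
    rw [hG, Real.exp_le_exp]
    exact mul_le_mul (neg_le_abs r) (by linarith : _ ≤ T) hh.le (abs_nonneg r)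
  rw [mul_add]
  refine add_le_add ?_ ?_
  · refine mul_le_mul_of_nonneg_right ?_ (by positivity)
    nlinarith [mul_le_mul_of_nonneg_right he hB]
  · refine mul_le_mul_of_nonneg_right ?_ (by positivity)
    nlinarith [mul_nonneg hG0.le hB]

end Assembly

/-! ### The error estimate -/

theorem mainTheorem3 (k p : ℕ) (hp : p = 1 ∨ p = 2)
    (b σ : ℝ → ℝ) (hb_per : Function.Periodic b 1) (hσ_per : Function.Periodic σ 1)
    (hb : ContDiff ℝ (max (2 * k + 2) (2 * p) : ℕ) b)
    (hσ : ContDiff ℝ (max (2 * k + 2) (2 * p) : ℕ) σ)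
    (r lam θ : ℝ) (hlam : 0 < lam) (hθ : θ < 1) :
    ∃ L₁ : ℝ, 0 ≤ L₁ ∧
      ∀ (T : ℝ) (f v : ℝ → ℝ → ℝ), 0 < T →
        ContDiff ℝ (k + 2 * p : ℕ) (Function.uncurry f) →
        (∀ t, Function.Periodic (f t) 1) →
        IsPeriodicSolution b σ r f T v →
        HasBoundedXDeriv (max (2 * p + 2) (k + 1)) T v →
        ∃ C : ℝ, 0 ≤ C ∧
          ∀ (N M : ℕ), 0 < N → 0 < M →
            (1 / (M : ℝ)) ^ 4 ≤ lam * (T / N) →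
            StepCondition p b σ θ (T / N) →
            ∀ u : ℕ → ℝ → ℝ, u 0 ∈ dgSpace k M →
              (∀ n < N, IsSLDGStep p k M b σ r f (T / N) (n * (T / N)) (u n) (u (n + 1))) →
              ∀ n ≤ N,
                normL2 (fun x => u n x - v (n * (T / N)) x) ≤
                  Real.exp (L₁ * T) *
                    (normL2 (fun x => u 0 x - v 0 x)
                      + C * T * ((1 / (M : ℝ)) ^ (k + 1) / (T / N) + (T / N) ^ p)) := by
  obtain ⟨L, hL, hstab⟩ := exists_stability_foot k p hp hb_per hσ_per hb hσ lam hθ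
  refine ⟨|r| + L, by positivity, fun T f v hT hf hf_per hsol hv => ?_⟩
  obtain ⟨B, hB, hvB, hstep⟩ := exists_step_error hp hb_per hσ_per hb hσ hf hf_per hsol hv
  -- One B for the accumulated step errors, and one for each passage between v and π v, at the
  -- initial and at the final time.
  refine ⟨3 * B, by positivity, fun N M hN hM hcfl hcond u hu0 hu => ?_⟩
  have hN' : (0 : ℝ) < N := by exact_mod_cast hN
  obtain ⟨h, hh⟩ : ∃ h, h = T / N := ⟨_, rfl⟩
  have hNh : N * h = T := by rw [hh]; field_simp
  rw [← hh] at hcfl hcond hu ⊢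
  have hh0 : 0 < h := by rw [hh]; positivity
  obtain ⟨hy, hst⟩ := hstab M h hM hh0.le hcfl hcond
  have hnT : ∀ n : ℕ, n ≤ N → (n : ℝ) * h ∈ Icc 0 T := fun n hn => by
    have : (n : ℝ) ≤ N := by exact_mod_cast hn
    exact ⟨by positivity, hNh ▸ by gcongr⟩
  have huV : ∀ n ≤ N, u n ∈ dgSpace k M := fun n hn => by
    rcases n with _ | n
    · exact hu0
    · exact (hu n (by omega)).1
  obtain ⟨a, ha⟩ : ∃ a : ℕ → ℝ, a = fun n => normL2 (fun x => u n x - cellTaylor k M (v (n * h)) x) :=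
    ⟨_, rfl⟩
  set δ := (1 / (M : ℝ)) ^ (k + 1) with hδ
  have hδ0 : 0 ≤ δ := by positivity
  set q := Real.exp ((|r| + L) * h) with hq
  have hq1 : 1 ≤ q := Real.one_le_exp (by positivity)
  have hrec : ∀ n < N, a (n + 1) ≤ q * a n + B * (δ + h ^ (p + 1)) := by
    intro n hn
    have e : (n : ℝ) * h + h = ((n + 1 : ℕ) : ℝ) * h := by push_cast; ring
    -- Stability bounds squares by 1 + L h, which is at most (1 + L h)²; this avoids a square root
    -- in the amplification factor.
    have h1 := hstep M (1 + L * h) h (n * h) (u n) (u (n + 1)) hM (by positivity) hh0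
      (hnT n hn.le).1 (e ▸ (hnT (n + 1) hn).2) hy (fun z hz => (hst z hz).trans
        (mul_le_mul_of_nonneg_right (by nlinarith [mul_nonneg hL hh0.le])
          (intervalIntegral.integral_nonneg zero_le_one fun _ _ => sq_nonneg _)))
      (huV n hn.le) (hu n hn)
    rw [e] at h1
    rw [ha]
    refine h1.trans (add_le_add ?_ le_rfl)
    refine mul_le_mul_of_nonneg_right ?_ (normL2_nonneg _)
    rw [hq, add_mul, Real.exp_add]
    refine mul_le_mul (Real.exp_le_exp.2 ?_) ?_ (by positivity) (Real.exp_pos _).le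
    · exact mul_le_mul_of_nonneg_right (neg_le_abs r) hh0.le
    · linarith [Real.add_one_le_exp (L * h)]
  intro n hn
  have hnN : (n : ℝ) ≤ N := by exact_mod_cast hn
  have hgr := le_pow_mul_of_le_mul_add hq1 (by positivity : 0 ≤ B * (δ + h ^ (p + 1))) hrec n hn
  have hqn : q ^ n ≤ Real.exp ((|r| + L) * T) := by
    rw [hq, ← Real.exp_nat_mul, Real.exp_le_exp, ← hNh]
    have : 0 ≤ (|r| + L) * h := by positivity
    nlinarith
  have hV : ∀ m ≤ N, IsCutContinuous M id (u m) ∧ IsCutContinuous M id (v (m * h)) ∧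
      IsCutContinuous M id (cellTaylor k M (v (m * h))) := fun m hm =>
    ⟨isCutContinuous_of_dgSpace (huV m hm), (hvB _ (hnT m hm)).contDiff.continuous.isCutContinuous,
      isCutContinuous_of_dgSpace (cellTaylor_mem_dgSpace hM (hvB _ (hnT m hm)).periodic)⟩
  have hproj : ∀ m ≤ N, normL2 (fun x => v (m * h) x - cellTaylor k M (v (m * h)) x) ≤ B * δ :=
    fun m hm => (hvB _ (hnT m hm)).normL2_sub_cellTaylor_le hM
  have hneg : ∀ m : ℕ, normL2 (fun x => cellTaylor k M (v (m * h)) x - v (m * h) x) =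
      normL2 (fun x => v (m * h) x - cellTaylor k M (v (m * h)) x) := fun m => by
    rw [normL2, normL2]
    simp only [← neg_sub (v (m * h) _), neg_sq]
  have h0 : a 0 ≤ normL2 (fun x => u 0 x - v 0 x) + B * δ := by
    obtain ⟨c1, c2, c3⟩ := hV 0 (Nat.zero_le N)
    have := normL2_add_le hM (c1.sub c2) (c2.sub c3)
    simp only [sub_add_sub_cancel] at this
    have hp0 := hproj 0 (Nat.zero_le N)
    simp only [Nat.cast_zero, zero_mul] at this hp0
    rw [ha]
    simp only [Nat.cast_zero, zero_mul]
    linarith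
  have hfin : normL2 (fun x => u n x - v (n * h) x) ≤ a n + B * δ := by
    obtain ⟨c1, c2, c3⟩ := hV n hn
    have := normL2_add_le hM (c1.sub c3) (c3.sub c2)
    simp only [sub_add_sub_cancel] at this
    rw [hneg] at this
    rw [ha]
    linarith [hproj n hn]
  have hE1 : 1 ≤ Real.exp ((|r| + L) * T) := Real.one_le_exp (by positivity)
  set X := normL2 (fun x => u 0 x - v 0 x)
  have hX : 0 ≤ X := normL2_nonneg _
  set G := Real.exp ((|r| + L) * T)
  have hBδ : B * δ ≤ G * (B * δ) := le_mul_of_one_le_left (by positivity) hE1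
  have hn1 : (1 : ℝ) ≤ N := by exact_mod_cast hN
  have hTδ : T * (δ / h + h ^ p) = N * (δ + h ^ (p + 1)) := by
    rw [← hNh]; field_simp
    ring
  -- As N ≥ 1, a single projection error is absorbed in the accumulated one.
  have hδN : δ ≤ N * (δ + h ^ (p + 1)) := by
    have : 0 ≤ h ^ (p + 1) := by positivity
    nlinarith
  have hnd : (n : ℝ) * (B * (δ + h ^ (p + 1))) ≤ N * (B * (δ + h ^ (p + 1))) := by gcongr
  calc normL2 (fun x => u n x - v (n * h) x) ≤ a n + B * δ := hfin
    _ ≤ q ^ n * (a 0 + n * (B * (δ + h ^ (p + 1)))) + B * δ := by linarith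
    _ ≤ G * (X + B * δ + N * (B * (δ + h ^ (p + 1)))) + G * (B * δ) := by
        refine add_le_add (mul_le_mul hqn (add_le_add h0 hnd) ?_ (Real.exp_pos _).le) hBδ
        have : 0 ≤ a 0 := by rw [ha]; exact normL2_nonneg _
        positivity
    _ = G * (X + 2 * B * δ + B * (N * (δ + h ^ (p + 1)))) := by ring
    _ ≤ G * (X + 2 * B * (N * (δ + h ^ (p + 1))) + B * (N * (δ + h ^ (p + 1)))) := by gcongr
    _ = G * (X + 3 * B * T * (δ / h + h ^ p)) := by rw [mul_assoc _ T, hTδ]; ring
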